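/- Let $N\ge 0$, let $V=\mathbb R^N$ with its standard inner product $(\cdot,\cdot)$, and for $0\ne v\in V$ let $R_v(x)=x-2\frac{(x,v)}{(v,v)}v$. Let $\mathcal R\subset V\setminus\{0\}$ be a finite (possibly empty) root system: $R_v(\mathcal R)\subseteq\mathcal R$ for all $v\in\mathcal R$, and collinear $v,w\in\mathcal R$ satisfy $w=\pm v$. Let $W(\mathcal R)\subset O(V)$ be the (finite) group generated by the $R_v$, $v\in\mathcal R$, and let $\nu=(\nu_v)_{v\in\mathcal R}$ be complex constants with $\nu_v=\nu_w$ whenever $R_v$ and $R_w$ are conjugate in $W(\mathcal R)$. Let $H_{W(\mathcal R)}(\nu)$ be the associative unital $\mathbb C$-algebra generated by the group algebra $\mathbb C[W(\mathcal R)]$ and elements $a_{\alpha,i}$ ($\alpha=0,1$, $i=1,\dots,N$) subject to the following relations, where $x_\alpha=\sum_i x^i a_{\alpha,i}$ for $x\in V$: $$g\,x_\alpha=(gx)_\alpha\,g,\qquad [x_\alpha,y_\beta]=\varepsilon_{\alpha\beta}\Big((x,y)+\sum_{v\in\mathcal R}\nu_v\frac{(x,v)(y,v)}{(v,v)}R_v\Big)$$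 for all $g\in W(\mathcal R)$, $x,y\in V$, $\alpha,\beta\in\{0,1\}$, with $\varepsilon_{\alpha\beta}$ antisymmetric and $\varepsilon_{01}=1$. It is a superalgebra with parity $\pi(a_{\alpha,i})=1$, $\pi(g)=0$. For $\varkappa\in\{1,-1\}$, a $\varkappa$-trace on $H_{W(\mathcal R)}(\nu)$ is a $\mathbb C$-linear function $sp:H_{W(\mathcal R)}(\nu)\to\mathbb C$ such that $sp(fg)=\varkappa^{\pi(f)\pi(g)}sp(gf)$ for all homogeneous $f,g$ (a trace for $\varkappa=1$, a supertrace for $\varkappa=-1$). Then the dimension of the space of $\varkappa$-traces on $H_{W(\mathcal R)}(\nu)$ equals the number of conjugacy classes of $W(\mathcal R)$ whose elements do not have the eigenvalue $\varkappa$ (as linear operators on $\mathbb R^N$). -/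

import Mathlib

open scoped RealInnerProductSpace

noncomputable section

namespace Calogero

/-- The Euclidean space `ℝ^N` with its standard inner product. -/
abbrev Vec (N : ℕ) : Type := EuclideanSpace ℝ (Fin N)

/-- The reflection `x ↦ x - 2 (x, v) / (v, v) v` in the hyperplane orthogonal to `v`
(see `refl_apply`). -/
def refl {N : ℕ} (v : Vec N) : Vec N ≃ₗᵢ[ℝ] Vec N := (ℝ ∙ v)ᗮ.reflection

theorem refl_apply {N : ℕ} (v x : Vec N) :
    refl v x = x - (2 * (⟪x, v⟫ / ⟪v, v⟫)) • v := by
  rw [refl, Submodule.reflection_orthogonal_apply, Submodule.reflection_singleton_apply,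
    real_inner_comm, real_inner_self_eq_norm_sq, mul_smul, two_smul, two_smul]
  simp

/-- Finite root systems in `ℝ^N`: not necessarily crystallographic, not necessarily spanning,
possibly empty. -/
structure IsRootSystem {N : ℕ} (R : Finset (Vec N)) : Prop where
  ne_zero : ∀ v ∈ R, v ≠ 0
  refl_mem : ∀ v ∈ R, ∀ w ∈ R, refl v w ∈ R
  eq_or_eq_neg : ∀ v ∈ R, ∀ w ∈ R, (∃ c : ℝ, w = c • v) → w = v ∨ w = -v

/-- The group `W(R)` generated by the reflections in the roots. -/
def W {N : ℕ} (R : Finset (Vec N)) : Subgroup (Vec N ≃ₗᵢ[ℝ] Vec N) :=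
  Subgroup.closure (refl '' (R : Set (Vec N)))

/-- The reflection in a root, as an element of `W(R)`. -/
def rootRefl {N : ℕ} (R : Finset (Vec N)) (v : R) : W R :=
  ⟨refl (v : Vec N), Subgroup.subset_closure ⟨v, v.2, rfl⟩⟩

/-- The coupling constants depend only on the conjugacy class of the reflection. -/
def IsInvariantCoupling {N : ℕ} (R : Finset (Vec N)) (ν : R → ℂ) : Prop :=
  ∀ v w : R, IsConj (rootRefl R v) (rootRefl R w) → ν v = ν w

/-- Generators: the `a_{α,i}` with `α = 0, 1` and `i = 1, …, N`, and the elements of `W(R)`. -/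
abbrev Gen {N : ℕ} (R : Finset (Vec N)) : Type := (Fin 2 × Fin N) ⊕ W R

/-- The free algebra's copy `x_α = ∑ i, x^i a_{α,i}` of the vector `x`. -/
def freeVec {N : ℕ} (R : Finset (Vec N)) (α : Fin 2) (x : Vec N) : FreeAlgebra ℂ (Gen R) :=
  ∑ i, (x i : ℂ) • FreeAlgebra.ι ℂ (Sum.inl (α, i))

/-- The free algebra's copy of the group element `g`. -/
def freeGrp {N : ℕ} (R : Finset (Vec N)) (g : W R) : FreeAlgebra ℂ (Gen R) :=
  FreeAlgebra.ι ℂ (Sum.inr g)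

/-- The antisymmetric tensor with `ε 0 1 = 1`. -/
def eps : Matrix (Fin 2) (Fin 2) ℂ := !![0, 1; -1, 0]

/-- The defining relations. The first two say that the group elements span a copy
of the group algebra. -/
inductive Rel {N : ℕ} (R : Finset (Vec N)) (ν : R → ℂ) :
    FreeAlgebra ℂ (Gen R) → FreeAlgebra ℂ (Gen R) → Prop
  | grp_one : Rel R ν (freeGrp R 1) 1
  | grp_mul (g h : W R) : Rel R ν (freeGrp R (g * h)) (freeGrp R g * freeGrp R h)
  | grp_vec (g : W R) (α : Fin 2) (x : Vec N) :
      Rel R ν (freeGrp R g * freeVec R α x)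
        (freeVec R α ((g : Vec N ≃ₗᵢ[ℝ] Vec N) x) * freeGrp R g)
  | comm (α β : Fin 2) (x y : Vec N) :
      Rel R ν (freeVec R α x * freeVec R β y - freeVec R β y * freeVec R α x)
        (eps α β • ((⟪x, y⟫ : ℂ) • 1 +
          ∑ v : R, (ν v * ((⟪x, (v : Vec N)⟫ * ⟪y, (v : Vec N)⟫ /
            ⟪(v : Vec N), (v : Vec N)⟫ : ℝ) : ℂ)) • freeGrp R (rootRefl R v)))

/-- The algebra of observables `H_{W(R)}(ν)`. -/
abbrev H {N : ℕ} (R : Finset (Vec N)) (ν : R → ℂ) : Type := RingQuot (Rel R ν)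

/-- The generator `a_{α,i}` in `H_{W(R)}(ν)`. -/
def a {N : ℕ} (R : Finset (Vec N)) (ν : R → ℂ) (I : Fin 2 × Fin N) : H R ν :=
  RingQuot.mkAlgHom ℂ (Rel R ν) (FreeAlgebra.ι ℂ (Sum.inl I))

/-- The group element `g` in `H_{W(R)}(ν)`. -/
def grp {N : ℕ} (R : Finset (Vec N)) (ν : R → ℂ) (g : W R) : H R ν :=
  RingQuot.mkAlgHom ℂ (Rel R ν) (freeGrp R g)

/-- The elements of parity `p`: the span of the monomials `a_{I₁} ⋯ a_{I_k} g` with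
`k ≡ p` modulo 2. -/
def parityPart {N : ℕ} (R : Finset (Vec N)) (ν : R → ℂ) (p : ZMod 2) : Submodule ℂ (H R ν) :=
  Submodule.span ℂ {f | ∃ (l : List (Fin 2 × Fin N)) (g : W R),
    (l.length : ZMod 2) = p ∧ f = (l.map (a R ν)).prod * grp R ν g}

/-- The space of `κ`-traces: the linear functions `sp` on `H_{W(R)}(ν)` such that
`sp (f g) = κ ^ (π(f) π(g)) sp (g f)` for all homogeneous `f` and `g`. -/
def kappaTraces {N : ℕ} (R : Finset (Vec N)) (ν : R → ℂ) (κ : ℤˣ) :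
    Submodule ℂ (H R ν →ₗ[ℂ] ℂ) where
  carrier := {sp | ∀ p q : ZMod 2, ∀ f ∈ parityPart R ν p, ∀ g ∈ parityPart R ν q,
    sp (f * g) = ((κ : ℤ) : ℂ) ^ (p.val * q.val) * sp (g * f)}
  add_mem' := by
    intro s t hs ht p q f hf g hg
    rw [LinearMap.add_apply, LinearMap.add_apply, hs p q f hf g hg, ht p q f hf g hg, mul_add]
  zero_mem' := by
    intro p q f _ g _
    simp
  smul_mem' := by
    intro c s hs p q f hf g hg
    rw [LinearMap.smul_apply, LinearMap.smul_apply, hs p q f hf g hg, smul_eq_mul, smul_eq_mul,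
      mul_left_comm]

/-- The conjugacy classes of `W(R)` whose elements do not have the eigenvalue `κ` on `ℝ^N`. -/
def classesWithout {N : ℕ} (R : Finset (Vec N)) (κ : ℤˣ) : Set (ConjClasses (W R)) :=
  {c | ∀ g ∈ c.carrier, ¬ Module.End.HasEigenvalue
    ((g : Vec N ≃ₗᵢ[ℝ] Vec N).toLinearEquiv : Module.End ℝ (Vec N)) ((κ : ℤ) : ℝ)}

end Calogero

end

/-! Upper bound. Call `a b - κ b a`, with `a` a generator, a twisted commutator. Modulo these, a
word times `g ∈ W(R)` reduces by induction on its length and on the dimension of the `κ`-eigenspace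
of `g`. A letter `y - κ g y` is itself a twisted commutator up to shorter words. If all letters are
eigenvectors, commuting with `x_0` for an eigenvector `x` recovers the word, up to words of the same
length whose group element `R_v g` has a smaller eigenspace. What survives are the group elements
without eigenvalue `κ` (`Realization.word_mul_grp_mem`). A `κ`-trace is a class function on the
group, and its odd part vanishes (`IsGenerated.eq_zero_of_parity`), so it is determined by its
values on the classes counted.

Existence. Replace `ν` by `tν` over `ℂ[t]`. Dunkl operators generate an algebra `B` with a
Poincaré-Birkhoff-Witt basis (`Model.ev_quant`, `Model.quant_ev`). Let `C ⊆ B` be spanned by the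
twisted commutators and the commutators with the group. By the same reduction the sums over
conjugacy classes without eigenvalue `κ` span `B / C`; the point is that they are independent over
`ℂ[t]`. At `t = 0` the problem splits into sectors indexed by `g ∈ W(R)`, where the twisted
commutators with generators are commuting operators on polynomials. Their Koszul complex has
vanishing first homology (`isBoundary_twComm`), and in a sector without eigenvalue `κ` the constant
1 is not in their image (`eq_zero_of_sum_twComm_eq_C`).

Vanishing of the first homology says that `B / C` has no `t`-torsion. If `t b` is a sum of twisted
commutators of elements `f_J`, their symbols at `t = 0` form a cycle, hence a boundary. Lifting it
expresses `t b` by commutators of two twisted commutators, which lie in `t C`, and by `t` times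
twisted commutators; then `t` cancels (`Model.mem_commutators_of_smul_mem`). A relation between
class sums modulo `C` can thus be divided by `t` indefinitely, so it is trivial. The coordinate
functionals of the free module `B / C` are evaluated at `t = 1` and pulled back along `H → B / (t -
1) B`; only this homomorphism is needed, not that it is bijective. -/

noncomputable section

namespace Calogero

/-! ### Eigenspaces of orthogonal maps and reflections. -/

section LinearAlgebra

variable {N : ℕ}

/-- The eigenspace of `g` for the eigenvalue `σ`. -/
def signFix (σ : ℤˣ) (g : Vec N ≃ₗᵢ[ℝ] Vec N) : Submodule ℝ (Vec N) :=
  Module.End.eigenspace (g.toLinearEquiv : Module.End ℝ (Vec N)) ((σ : ℤ) : ℝ)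

theorem mem_signFix {σ : ℤˣ} {g : Vec N ≃ₗᵢ[ℝ] Vec N} {x : Vec N} :
    x ∈ signFix σ g ↔ g x = ((σ : ℤ) : ℝ) • x :=
  Module.End.mem_eigenspace_iff

theorem sign_mul_self (σ : ℤˣ) : ((σ : ℤ) : ℝ) * ((σ : ℤ) : ℝ) = 1 := by
  rcases Int.units_eq_one_or σ with rfl | rfl <;> simp

theorem sign_smul_sign_smul (σ : ℤˣ) (x : Vec N) :
    ((σ : ℤ) : ℝ) • ((σ : ℤ) : ℝ) • x = x := by
  rw [smul_smul, sign_mul_self, one_smul]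

/-- Pairing with an eigenvector of eigenvalue `σ`. -/
theorem inner_map_of_mem_signFix {σ : ℤˣ} {g : Vec N ≃ₗᵢ[ℝ] Vec N} {x : Vec N}
    (hx : x ∈ signFix σ g) (z : Vec N) : ⟪g z, x⟫ = ((σ : ℤ) : ℝ) * ⟪z, x⟫ := by
  have h := mem_signFix.1 hx
  have h2 : x = ((σ : ℤ) : ℝ) • g x := by rw [h, sign_smul_sign_smul]
  conv_lhs => rw [h2]
  rw [inner_smul_right, LinearIsometryEquiv.inner_map_map]

/-- For `T = 1 - σ g` with `g` orthogonal, the kernel is orthogonal to the range, so by dimension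
count the two span the space. This splits each letter of a word into an eigenvector and a letter
that twisted commutators remove. -/
theorem exists_signFix_add_sub (σ : ℤˣ) (g : Vec N ≃ₗᵢ[ℝ] Vec N) (x : Vec N) :
    ∃ z ∈ signFix σ g, ∃ y : Vec N, x = z + (y - ((σ : ℤ) : ℝ) • g y) := by
  let T : Vec N →ₗ[ℝ] Vec N :=
    LinearMap.id - ((σ : ℤ) : ℝ) • (g.toLinearEquiv : Vec N →ₗ[ℝ] Vec N)
  have hT : ∀ y, T y = y - ((σ : ℤ) : ℝ) • g y := fun y => rfl
  have hker : ∀ z ∈ LinearMap.ker T, z ∈ signFix σ g := by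
    intro z hz
    rw [LinearMap.mem_ker, hT, sub_eq_zero] at hz
    rw [mem_signFix]
    conv_rhs => rw [hz, sign_smul_sign_smul]
  have hdisj : Disjoint (LinearMap.ker T) (LinearMap.range T) := by
    rw [Submodule.disjoint_def]
    rintro z hz ⟨y, rfl⟩
    have h1 := inner_map_of_mem_signFix (hker _ hz) y
    have h2 : ⟪T y, T y⟫ = 0 := by
      have h3 : ⟪T y, T y⟫ = ⟪y, T y⟫ - ((σ : ℤ) : ℝ) * ⟪g y, T y⟫ := by
        conv_lhs => enter [2]; rw [hT y]
        rw [inner_sub_left, inner_smul_left]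
        simp
      rw [h3, h1]
      linear_combination (-⟪y, T y⟫) * sign_mul_self σ
    exact inner_self_eq_zero.1 h2
  have htop : LinearMap.ker T ⊔ LinearMap.range T = ⊤ := by
    apply Submodule.eq_top_of_disjoint _ _ _ hdisj
    rw [add_comm, LinearMap.finrank_range_add_finrank_ker]
  have hx : x ∈ LinearMap.ker T ⊔ LinearMap.range T := htop ▸ Submodule.mem_top
  obtain ⟨z, hz, _, ⟨y, rfl⟩, h⟩ := Submodule.mem_sup.1 hx
  exact ⟨z, hker z hz, y, by rw [← hT, h]⟩

/-- Composing with a reflection that moves some eigenvector makes the eigenspace smaller. -/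
theorem finrank_signFix_refl_mul_lt {σ : ℤˣ} {g : Vec N ≃ₗᵢ[ℝ] Vec N} {x v : Vec N}
    (hx : x ∈ signFix σ g) (hxv : ⟪x, v⟫ ≠ 0) :
    Module.finrank ℝ (signFix σ (refl v * g)) < Module.finrank ℝ (signFix σ g) := by
  have key : ∀ z ∈ signFix σ (refl v * g), ⟪z, v⟫ = 0 ∧ z ∈ signFix σ g := by
    intro z hz
    have h1 : g z = ((σ : ℤ) : ℝ) • refl v z := by
      have := congrArg (refl v) (mem_signFix.1 hz)
      rw [LinearIsometryEquiv.coe_mul, Function.comp_apply, map_smul] at this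
      rw [← this, refl, Submodule.reflection_reflection]
    have h2 := inner_map_of_mem_signFix hx z
    have hv : v ≠ 0 := by rintro rfl; simp at hxv
    have hvv : ⟪v, v⟫ ≠ 0 := fun h => hv (inner_self_eq_zero.1 h)
    -- Pairing `g z = σ R_v z` with the eigenvector `x` gives `(R_v z, x) = (z, x)`, that is `(z,
    -- v)(v, x) = 0`. So the new eigenspace lies in the old one and in the hyperplane orthogonal to
    -- `v`, which misses `x`.
    have h3 : ⟪z, v⟫ = 0 := by
      rw [h1, refl_apply, inner_smul_left, inner_sub_left, inner_smul_left] at h2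
      simp only [RCLike.conj_to_real] at h2
      have hs := sign_mul_self σ
      have h4 : ⟪z, v⟫ / ⟪v, v⟫ * ⟪v, x⟫ = 0 := by
        have : ((σ : ℤ) : ℝ) * (2 * (⟪z, v⟫ / ⟪v, v⟫ * ⟪v, x⟫)) = 0 := by
          linear_combination -h2
        linear_combination (((σ : ℤ) : ℝ) / 2) * this - (⟪z, v⟫ / ⟪v, v⟫ * ⟪v, x⟫) * hs
      rw [real_inner_comm] at hxv
      rcases mul_eq_zero.1 h4 with h | h
      · rcases div_eq_zero_iff.1 h with h | h
        · exact h
        · exact absurd h hvv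
      · exact absurd h hxv
    refine ⟨h3, mem_signFix.2 ?_⟩
    rw [h1, refl_apply, h3]; simp
  apply Submodule.finrank_lt_finrank_of_lt
  refine lt_of_le_of_ne (fun z hz => (key z hz).2) fun h => hxv (key x (h ▸ hx)).1

end LinearAlgebra

/-! ### Algebras satisfying the defining relations, and words in them. -/

/-- An algebra over `K` with elements `a_{α,i}` and `g ∈ W(R)` that satisfy the defining relations
with coupling constants `c`; real numbers enter through `ρ`. -/
structure Realization {N : ℕ} (R : Finset (Vec N)) {K : Type*} [CommRing K] (ρ : ℝ →+* K)
    (c : R → K) (B : Type*) [Ring B] [Algebra K B] where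
  gen : Fin 2 × Fin N → B
  grp : W R →* B
  grp_vec : ∀ (g : W R) (α : Fin 2) (x : Vec N),
    grp g * ∑ i, ρ (x i) • gen (α, i) =
      (∑ i, ρ ((g : Vec N ≃ₗᵢ[ℝ] Vec N) x i) • gen (α, i)) * grp g
  comm : ∀ (α β : Fin 2) (x y : Vec N),
    (∑ i, ρ (x i) • gen (α, i)) * (∑ i, ρ (y i) • gen (β, i)) -
      (∑ i, ρ (y i) • gen (β, i)) * (∑ i, ρ (x i) • gen (α, i)) =
    (!![0, 1; -1, 0] : Matrix (Fin 2) (Fin 2) K) α β • (ρ ⟪x, y⟫ • 1 +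
      ∑ v : R, (c v * ρ (⟪x, (v : Vec N)⟫ * ⟪y, (v : Vec N)⟫ / ⟪(v : Vec N), (v : Vec N)⟫)) •
        grp (rootRefl R v))

namespace Realization

variable {N : ℕ} {R : Finset (Vec N)} {K : Type*} [CommRing K] {ρ : ℝ →+* K} {c : R → K}
  {B : Type*} [Ring B] [Algebra K B] (A : Realization R ρ c B)

/-- The element `x_α`. -/
def vec (α : Fin 2) (x : Vec N) : B := ∑ i, ρ (x i) • A.gen (α, i)

theorem vec_add (α : Fin 2) (x y : Vec N) : A.vec α (x + y) = A.vec α x + A.vec α y := by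
  simp [vec, add_smul, Finset.sum_add_distrib]

theorem vec_smul (α : Fin 2) (r : ℝ) (x : Vec N) : A.vec α (r • x) = ρ r • A.vec α x := by
  simp [vec, mul_smul, Finset.smul_sum]

theorem vec_sub (α : Fin 2) (x y : Vec N) : A.vec α (x - y) = A.vec α x - A.vec α y := by
  simp [vec, sub_smul]

theorem vec_zero (α : Fin 2) : A.vec α (0 : Vec N) = 0 := by simp [vec]

theorem vec_single (α : Fin 2) (i : Fin N) :
    A.vec α (EuclideanSpace.single i (1 : ℝ)) = A.gen (α, i) := by
  rw [vec, Finset.sum_eq_single i]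
  · simp
  · intro j _ hj; simp [hj]
  · simp

theorem grp_mul_vec (g : W R) (α : Fin 2) (x : Vec N) :
    A.grp g * A.vec α x = A.vec α ((g : Vec N ≃ₗᵢ[ℝ] Vec N) x) * A.grp g :=
  A.grp_vec g α x

/-- The group algebra element in the commutation relations. -/
def bracket (x y : Vec N) : B :=
  ρ ⟪x, y⟫ • 1 + ∑ v : R, (c v * ρ (⟪x, (v : Vec N)⟫ * ⟪y, (v : Vec N)⟫ /
    ⟪(v : Vec N), (v : Vec N)⟫)) • A.grp (rootRefl R v)

theorem vec_comm (α β : Fin 2) (x y : Vec N) :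
    A.vec α x * A.vec β y - A.vec β y * A.vec α x =
      (!![0, 1; -1, 0] : Matrix (Fin 2) (Fin 2) K) α β • A.bracket x y :=
  A.comm α β x y

/-- The product of a word in the letters `x_α`. -/
def word (l : List (Fin 2 × Vec N)) : B := (l.map fun p => A.vec p.1 p.2).prod

@[simp] theorem word_nil : A.word [] = 1 := rfl

@[simp] theorem word_cons (p : Fin 2 × Vec N) (l : List (Fin 2 × Vec N)) :
    A.word (p :: l) = A.vec p.1 p.2 * A.word l := by simp [word]

@[simp] theorem word_append (l l' : List (Fin 2 × Vec N)) :
    A.word (l ++ l') = A.word l * A.word l' := by simp [word]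

/-- The action of the group on words. -/
def mapWord (g : W R) (l : List (Fin 2 × Vec N)) : List (Fin 2 × Vec N) :=
  l.map fun p => (p.1, (g : Vec N ≃ₗᵢ[ℝ] Vec N) p.2)

@[simp] theorem length_mapWord (g : W R) (l : List (Fin 2 × Vec N)) :
    (mapWord g l).length = l.length := by simp [mapWord]

theorem grp_mul_word (g : W R) (l : List (Fin 2 × Vec N)) :
    A.grp g * A.word l = A.word (mapWord g l) * A.grp g := by
  induction l with
  | nil => simp [mapWord]
  | cons p l ih =>
    rw [word_cons, ← mul_assoc, grp_mul_vec, mul_assoc, ih, ← mul_assoc]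
    simp [mapWord]

theorem word_grp_word_grp (l l' : List (Fin 2 × Vec N)) (g h : W R) :
    A.word l * A.grp g * A.word l' * A.grp h = A.word (l ++ mapWord g l') * A.grp (g * h) := by
  rw [mul_assoc (A.word l), grp_mul_word, word_append, map_mul]; noncomm_ring

/-! ### Reduction of words modulo twisted commutators. -/

section Generation

variable {M : Submodule K B}

/-- A commutator of two letters lies in the group algebra, so replacing two adjacent letters by it
yields words two letters shorter, once the reflections have been moved to the right. -/
theorem word_commutator_mem {n : ℕ}
    (hn : ∀ (l : List (Fin 2 × Vec N)) (g : W R), l.length = n → A.word l * A.grp g ∈ M)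
    (l₁ l₂ : List (Fin 2 × Vec N)) (p q : Fin 2 × Vec N) (g : W R)
    (hl : l₁.length + l₂.length = n) :
    A.word l₁ * (A.vec p.1 p.2 * A.vec q.1 q.2 - A.vec q.1 q.2 * A.vec p.1 p.2) * A.word l₂ *
      A.grp g ∈ M := by
  rw [vec_comm, mul_smul_comm, smul_mul_assoc, smul_mul_assoc]
  apply M.smul_mem
  rw [bracket, mul_add, add_mul, add_mul, Finset.mul_sum, Finset.sum_mul, Finset.sum_mul]
  refine M.add_mem ?_ (M.sum_mem fun v _ => ?_)
  · rw [mul_smul_comm, smul_mul_assoc, smul_mul_assoc, mul_one, ← word_append]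
    exact M.smul_mem _ (hn _ _ (by simpa using hl))
  · rw [mul_smul_comm, smul_mul_assoc, smul_mul_assoc, word_grp_word_grp]
    exact M.smul_mem _ (hn _ _ (by simpa using hl))

/-- Reordering the letters of a word changes it by shorter words. -/
theorem word_perm_sub_mem {n : ℕ}
    (hn : ∀ (l : List (Fin 2 × Vec N)) (g : W R), l.length + 2 = n → A.word l * A.grp g ∈ M)
    {l l' : List (Fin 2 × Vec N)} (h : l.Perm l') (l₁ : List (Fin 2 × Vec N)) (g : W R)
    (hl : l₁.length + l.length = n) :
    A.word (l₁ ++ l) * A.grp g - A.word (l₁ ++ l') * A.grp g ∈ M := by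
  induction h generalizing l₁ with
  | nil => simp
  | @cons p l l' h ih =>
    have := ih (l₁ ++ [p]) (by simp at hl ⊢; omega)
    simpa using this
  | swap p q l =>
    have := A.word_commutator_mem (M := M) (n := n - 2)
      (fun l g h => hn l g (by simp at hl; omega)) l₁ l q p g (by simp at hl; omega)
    convert this using 1
    simp only [word_append, word_cons]
    noncomm_ring
  | @trans a b c hab hbc ih₁ ih₂ =>
    have h1 := ih₁ l₁ hl
    have h2 := ih₂ l₁ (by rw [← hab.length_eq]; exact hl)
    simpa using M.add_mem h1 h2

theorem word_perm_mem_iff {n : ℕ}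
    (hn : ∀ (l : List (Fin 2 × Vec N)) (g : W R), l.length + 2 = n → A.word l * A.grp g ∈ M)
    {l l' : List (Fin 2 × Vec N)} (h : l.Perm l') (g : W R) (hl : l.length = n) :
    A.word l * A.grp g ∈ M ↔ A.word l' * A.grp g ∈ M := by
  have := A.word_perm_sub_mem hn h [] g (by simpa using hl)
  simp only [List.nil_append] at this
  constructor
  · intro h; simpa using M.sub_mem h this
  · intro h; simpa using M.add_mem this h

variable {σ : ℤˣ}

theorem vec_commutator_mem (hM : ∀ I b, A.gen I * b - ((σ : ℤ) : K) • (b * A.gen I) ∈ M)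
    (α : Fin 2) (x : Vec N) (b : B) :
    A.vec α x * b - ((σ : ℤ) : K) • (b * A.vec α x) ∈ M := by
  have : A.vec α x * b - ((σ : ℤ) : K) • (b * A.vec α x) =
      ∑ i, ρ (x i) • (A.gen (α, i) * b - ((σ : ℤ) : K) • (b * A.gen (α, i))) := by
    simp only [vec, smul_sub, Finset.sum_sub_distrib, Finset.sum_mul, Finset.mul_sum,
      Finset.smul_sum, smul_mul_assoc, mul_smul_comm]
    congr 1
    exact Finset.sum_congr rfl fun i _ => smul_comm _ _ _
  rw [this]
  exact M.sum_mem fun i _ => M.smul_mem _ (hM _ _)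

/-- In the twisted commutator of `y_α` with `l g`, the second term `σ l g y_α` equals `σ l (g y)_α
g`, and `(g y)_α` can be moved to the front at the cost of shorter words. -/
theorem sub_letter_mem (hM : ∀ I b, A.gen I * b - ((σ : ℤ) : K) • (b * A.gen I) ∈ M) {n : ℕ}
    (hn : ∀ (l : List (Fin 2 × Vec N)) (g : W R), l.length + 2 = n → A.word l * A.grp g ∈ M)
    (α : Fin 2) (y : Vec N) (l : List (Fin 2 × Vec N)) (g : W R) (hl : l.length + 1 = n) :
    A.word ((α, y - ((σ : ℤ) : ℝ) • (g : Vec N ≃ₗᵢ[ℝ] Vec N) y) :: l) * A.grp g ∈ M := by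
  have h1 := A.vec_commutator_mem hM α y (A.word l * A.grp g)
  have h2 := A.word_perm_sub_mem hn
    (List.perm_append_singleton (α, (g : Vec N ≃ₗᵢ[ℝ] Vec N) y) l) [] g (by simpa using hl)
  have h3 := M.add_mem h1 (M.smul_mem ((σ : ℤ) : K) h2)
  convert h3 using 1
  rw [mul_assoc (A.word l), grp_mul_vec]
  simp only [List.nil_append, word_cons, word_append, word_nil, vec_sub, vec_smul, smul_sub,
    map_intCast, mul_one, sub_mul, smul_mul_assoc, mul_assoc]
  abel

/-- Commuting `x_0` with one letter of a word in a sector where `x` is an eigenvector. -/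
theorem commutator_letter_mem {n : ℕ} {x : Vec N} {g : W R}
    (hx : x ∈ signFix σ (g : Vec N ≃ₗᵢ[ℝ] Vec N))
    (hk : ∀ (l : List (Fin 2 × Vec N)) (h : W R), l.length = n →
      Module.finrank ℝ (signFix σ (h : Vec N ≃ₗᵢ[ℝ] Vec N)) <
        Module.finrank ℝ (signFix σ (g : Vec N ≃ₗᵢ[ℝ] Vec N)) → A.word l * A.grp h ∈ M)
    (l₁ l₂ : List (Fin 2 × Vec N)) (p : Fin 2 × Vec N) (hl : l₁.length + l₂.length = n) :
    A.word l₁ * (A.vec 0 x * A.vec p.1 p.2 - A.vec p.1 p.2 * A.vec 0 x) * A.word l₂ * A.grp g -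
      ((!![0, 1; -1, 0] : Matrix (Fin 2) (Fin 2) K) 0 p.1 * ρ ⟪x, p.2⟫) •
        (A.word (l₁ ++ l₂) * A.grp g) ∈ M := by
  rw [vec_comm, mul_smul_comm, smul_mul_assoc, smul_mul_assoc, mul_smul, ← smul_sub]
  apply M.smul_mem
  rw [bracket, mul_add, add_mul, add_mul, Finset.mul_sum, Finset.sum_mul, Finset.sum_mul,
    mul_smul_comm, smul_mul_assoc, smul_mul_assoc, mul_one, ← word_append, add_sub_cancel_left]
  refine M.sum_mem fun v _ => ?_
  rw [mul_smul_comm, smul_mul_assoc, smul_mul_assoc, word_grp_word_grp]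
  by_cases hv : ⟪x, (v : Vec N)⟫ = 0
  · simp [hv]
  · exact M.smul_mem _ (hk _ _ (by simpa using hl) (finrank_signFix_refl_mul_lt hx hv))

/-- A word with letters that commute with `x_0` up to reflections. -/
theorem commutator_good_mem {n : ℕ} {x : Vec N} {g : W R}
    (hx : x ∈ signFix σ (g : Vec N ≃ₗᵢ[ℝ] Vec N))
    (hk : ∀ (l : List (Fin 2 × Vec N)) (h : W R), l.length = n →
      Module.finrank ℝ (signFix σ (h : Vec N ≃ₗᵢ[ℝ] Vec N)) <
        Module.finrank ℝ (signFix σ (g : Vec N ≃ₗᵢ[ℝ] Vec N)) → A.word l * A.grp h ∈ M)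
    (l l₁ : List (Fin 2 × Vec N)) (hgood : ∀ p ∈ l, p.1 = 0 ∨ ⟪x, p.2⟫ = 0)
    (hl : l₁.length + l.length = n + 1) :
    A.word l₁ * (A.vec 0 x * A.word l - A.word l * A.vec 0 x) * A.grp g ∈ M := by
  induction l generalizing l₁ with
  | nil => simp
  | cons p l ih =>
    have h1 := A.commutator_letter_mem hx hk l₁ l p (by simp at hl; omega)
    have h2 := ih (l₁ ++ [p]) (fun q hq => hgood q (List.mem_cons_of_mem _ hq))
      (by simp at hl ⊢; omega)
    have h0 : (!![0, 1; -1, 0] : Matrix (Fin 2) (Fin 2) K) 0 p.1 * ρ ⟪x, p.2⟫ = 0 := by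
      rcases hgood p List.mem_cons_self with h | h <;> simp [h]
    rw [h0, zero_smul, sub_zero] at h1
    convert M.add_mem h1 h2 using 1
    simp only [word_cons, word_append, word_nil, mul_one]
    noncomm_ring

/-- `x_0` and `x_1` form a canonical pair up to reflections `R_v` with `(x, v) ≠ 0`, which shrink
the eigenspace. So `x_0` acts on `x_1^k l` like a derivative. The index `j` counts the copies of
`x_1` that `x_0` has already passed. -/
theorem commutator_replicate_mem {n : ℕ} {x : Vec N} {g : W R}
    (hx : x ∈ signFix σ (g : Vec N ≃ₗᵢ[ℝ] Vec N))
    (hk : ∀ (l : List (Fin 2 × Vec N)) (h : W R), l.length = n →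
      Module.finrank ℝ (signFix σ (h : Vec N ≃ₗᵢ[ℝ] Vec N)) <
        Module.finrank ℝ (signFix σ (g : Vec N ≃ₗᵢ[ℝ] Vec N)) → A.word l * A.grp h ∈ M)
    (l : List (Fin 2 × Vec N)) (hgood : ∀ p ∈ l, p.1 = 0 ∨ ⟪x, p.2⟫ = 0) (m : ℕ)
    (hl : m + l.length = n) (k j : ℕ) (hjk : j + k = m + 1) :
    A.word (List.replicate j (1, x)) * (A.vec 0 x * A.word (List.replicate k (1, x) ++ l) -
      A.word (List.replicate k (1, x) ++ l) * A.vec 0 x) * A.grp g -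
      ((k : K) * ρ ⟪x, x⟫) • (A.word (List.replicate m (1, x) ++ l) * A.grp g) ∈ M := by
  induction k generalizing j with
  | zero =>
    have := A.commutator_good_mem hx hk l (List.replicate j (1, x)) hgood (by simp; omega)
    simpa using this
  | succ k ih =>
    have h1 := A.commutator_letter_mem hx hk (List.replicate j (1, x))
      (List.replicate k (1, x) ++ l) (1, x) (by simp; omega)
    have h2 := ih (j + 1) (by omega)
    rw [← List.append_assoc, ← List.replicate_add, show j + k = m by omega] at h1
    convert M.add_mem h1 h2 using 1
    rw [List.replicate_succ' (n := j), List.replicate_succ (n := k)]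
    simp only [word_cons, word_append, word_nil, mul_one, List.cons_append]
    simp only [Matrix.of_apply, Matrix.cons_val', Matrix.cons_val_zero, Matrix.cons_val_one,
      Matrix.cons_val_fin_one, one_mul, Nat.cast_add, Nat.cast_one, add_mul, add_smul]
    noncomm_ring

/-- A word is integrated in the variable `x_1`: up to smaller words, `x_1^m l g` is a multiple of
the commutator of `x_0` with `x_1^(m+1) l g`, provided the letters of `l` commute with `x_0` up to
reflections. The induction sorts the letters of `l'` into the block `x_1^m` and the list `l`. -/
theorem special_word_mem (hM : ∀ I b, A.gen I * b - ((σ : ℤ) : K) • (b * A.gen I) ∈ M) {n : ℕ}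
    (hn : ∀ (l : List (Fin 2 × Vec N)) (g : W R), l.length + 2 = n → A.word l * A.grp g ∈ M)
    {x : Vec N} {g : W R} (hx : x ∈ signFix σ (g : Vec N ≃ₗᵢ[ℝ] Vec N)) (hx0 : x ≠ 0)
    (hk : ∀ (l : List (Fin 2 × Vec N)) (h : W R), l.length = n →
      Module.finrank ℝ (signFix σ (h : Vec N ≃ₗᵢ[ℝ] Vec N)) <
        Module.finrank ℝ (signFix σ (g : Vec N ≃ₗᵢ[ℝ] Vec N)) → A.word l * A.grp h ∈ M)
    (l' : List (Fin 2 × Vec N)) (l : List (Fin 2 × Vec N))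
    (hgood : ∀ p ∈ l, p.1 = 0 ∨ ⟪x, p.2⟫ = 0) (m : ℕ)
    (hl : m + l.length + l'.length = n) :
    A.word (List.replicate m (1, x) ++ l ++ l') * A.grp g ∈ M := by
  have hxx : ⟪x, x⟫ ≠ 0 := fun h => hx0 (inner_self_eq_zero.1 h)
  induction l' generalizing l m with
  | nil =>
    simp only [List.length_nil, add_zero] at hl
    have h1 := A.commutator_replicate_mem hx hk l hgood m hl (m + 1) 0 (by omega)
    have h2 := A.vec_commutator_mem hM 0 x
      (A.word (List.replicate (m + 1) (1, x) ++ l) * A.grp g)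
    have hs : ((σ : ℤ) : K) * ((σ : ℤ) : K) = 1 := by
      rw [← Int.cast_mul, ← Units.val_mul, Int.units_mul_self]; simp
    -- As `g x_0 = σ x_0 g` and `σ² = 1`, the twisted commutator is an ordinary commutator with the
    -- word, times `g`.
    rw [mul_assoc _ (A.grp g), grp_mul_vec, mem_signFix.1 hx, vec_smul, map_intCast,
      smul_mul_assoc, mul_smul_comm, smul_smul, hs, one_smul, ← mul_assoc, ← mul_assoc,
      ← sub_mul] at h2
    simp only [List.replicate_zero, word_nil, one_mul] at h1
    have h3 := M.sub_mem h2 h1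
    rw [sub_sub_cancel] at h3
    have h4 := M.smul_mem (ρ ((((m + 1 : ℕ) : ℝ) * ⟪x, x⟫)⁻¹)) h3
    rw [smul_smul, ← map_natCast ρ, ← map_mul, ← map_mul, inv_mul_cancel₀, map_one,
      one_smul] at h4
    · simpa using h4
    · exact mul_ne_zero (by positivity) hxx
  | cons p l' ih =>
    obtain ⟨α, y⟩ := p
    by_cases hα : α = 0
    · have := ih (l ++ [(α, y)]) (by
        intro q hq
        rcases List.mem_append.1 hq with h | h
        · exact hgood q h
        · rw [List.mem_singleton.1 h]; exact Or.inl hα) m (by simp at hl ⊢; omega)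
      simpa using this
    · have hα : α = 1 := by fin_cases α <;> simp at hα ⊢
      subst hα
      -- The component of `y` along `x` joins the block of letters `x_1`; the rest is orthogonal to
      -- `x` and joins `l`.
      set r : ℝ := ⟪x, y⟫ / ⟪x, x⟫ with hr
      have h1 := ih (l ++ [(1, y - r • x)]) (by
        intro q hq
        rcases List.mem_append.1 hq with h | h
        · exact hgood q h
        · rw [List.mem_singleton.1 h]
          right
          simp only [inner_sub_right, inner_smul_right, hr]
          field_simp
          simp) m (by simp at hl ⊢; omega)
      have h2 := ih l hgood (m + 1) (by simp at hl ⊢; omega)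
      have hp : (List.replicate (m + 1) ((1 : Fin 2), x) ++ l ++ l').Perm
          (List.replicate m (1, x) ++ l ++ (1, x) :: l') := by
        rw [List.replicate_succ, List.cons_append, List.cons_append]
        exact List.perm_middle.symm
      rw [A.word_perm_mem_iff hn hp g (by simp at hl ⊢; omega)] at h2
      convert M.add_mem h1 (M.smul_mem (ρ r) h2) using 1
      simp only [word_cons, word_append, word_nil, mul_one, vec_sub, vec_smul]
      simp only [mul_sub, sub_mul, mul_smul_comm, smul_mul_assoc, mul_assoc]
      abel

/-- A subspace that contains the twisted commutators with the generators and the group elements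
without eigenvalue `σ` contains all words. -/
theorem word_mul_grp_mem (hM : ∀ I b, A.gen I * b - ((σ : ℤ) : K) • (b * A.gen I) ∈ M)
    (hgrp : ∀ g : W R, signFix σ (g : Vec N ≃ₗᵢ[ℝ] Vec N) = ⊥ → A.grp g ∈ M)
    (l : List (Fin 2 × Vec N)) (g : W R) : A.word l * A.grp g ∈ M := by
  -- The outer induction absorbs the shorter words from reordering; the inner one, on the dimension
  -- of the eigenspace, absorbs the words of equal length produced by reflections.
  induction hn : l.length using Nat.strong_induction_on generalizing l g with
  | _ n ihn =>
  induction hk : Module.finrank ℝ (signFix σ (g : Vec N ≃ₗᵢ[ℝ] Vec N))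
    using Nat.strong_induction_on generalizing l g with
  | _ k ihk =>
  have hn2 : ∀ (l : List (Fin 2 × Vec N)) (g : W R), l.length + 2 = n →
      A.word l * A.grp g ∈ M := fun l g h => ihn l.length (by omega) l g rfl
  have hk2 : ∀ (l : List (Fin 2 × Vec N)) (h : W R), l.length = n →
      Module.finrank ℝ (signFix σ (h : Vec N ≃ₗᵢ[ℝ] Vec N)) <
        Module.finrank ℝ (signFix σ (g : Vec N ≃ₗᵢ[ℝ] Vec N)) → A.word l * A.grp h ∈ M :=
    fun l h hl hlt => ihk _ (hk ▸ hlt) l h hl rfl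
  -- `l₁` holds the letters already replaced by eigenvectors of `g`; the other component of each
  -- letter contributes an element of `M` by `sub_letter_mem`.
  have main : ∀ l₂ l₁ : List (Fin 2 × Vec N),
      (∀ p ∈ l₁, p.2 ∈ signFix σ (g : Vec N ≃ₗᵢ[ℝ] Vec N)) → l₁.length + l₂.length = n →
      A.word (l₁ ++ l₂) * A.grp g ∈ M := by
    intro l₂
    induction l₂ with
    | nil =>
      intro l₁ h₁ hlen
      by_cases hbot : signFix σ (g : Vec N ≃ₗᵢ[ℝ] Vec N) = ⊥
      · rcases l₁ with _ | ⟨p, l₁⟩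
        · simpa using hgrp g hbot
        · have : p.2 = 0 := by
            have := h₁ p List.mem_cons_self
            rwa [hbot, Submodule.mem_bot] at this
          simp [this, vec_zero]
      · obtain ⟨x, hx, hx0⟩ := Submodule.exists_mem_ne_zero_of_ne_bot hbot
        have := A.special_word_mem hM hn2 hx hx0 hk2 l₁ [] (by simp) 0
          (by simpa using hlen)
        simpa using this
    | cons p l₂ ih =>
      intro l₁ h₁ hlen
      obtain ⟨α, x⟩ := p
      obtain ⟨z, hz, y, rfl⟩ := exists_signFix_add_sub σ (g : Vec N ≃ₗᵢ[ℝ] Vec N) x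
      have h2 := ih (l₁ ++ [(α, z)]) (by
        intro q hq
        rcases List.mem_append.1 hq with h | h
        · exact h₁ q h
        · rw [List.mem_singleton.1 h]; exact hz) (by simp at hlen ⊢; omega)
      have h3 := A.sub_letter_mem hM hn2 α y (l₁ ++ l₂) g (by simp at hlen ⊢; omega)
      rw [A.word_perm_mem_iff hn2 List.perm_middle.symm g (by simp at hlen ⊢; omega)] at h3
      convert M.add_mem h2 h3 using 1
      simp only [word_cons, word_append, word_nil, mul_one, vec_add, mul_add, add_mul, mul_assoc]
  exact main l [] (by simp) (by simpa using hn)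

end Generation

end Realization

end Calogero

end

noncomputable section

namespace Calogero

/-! ### The action of the group on the roots. -/

section Roots

variable {N : ℕ}

theorem refl_map_map (g : Vec N ≃ₗᵢ[ℝ] Vec N) (v x : Vec N) :
    refl (g v) (g x) = g (refl v x) := by
  simp only [refl_apply, map_sub, map_smul, LinearIsometryEquiv.inner_map_map]

theorem refl_map_mul (g : Vec N ≃ₗᵢ[ℝ] Vec N) (v : Vec N) : refl (g v) * g = g * refl v := by
  ext1 x; exact refl_map_map g v x

variable {R : Finset (Vec N)}

theorem IsRootSystem.map_mem (hR : IsRootSystem R) (g : W R) {v : Vec N} (hv : v ∈ R) :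
    (g : Vec N ≃ₗᵢ[ℝ] Vec N) v ∈ R := by
  obtain ⟨g, hg⟩ := g
  simp only
  induction hg using Subgroup.closure_induction generalizing v with
  | mem g hg => obtain ⟨w, hw, rfl⟩ := hg; exact hR.refl_mem w hw v hv
  | one => exact hv
  | mul g h _ _ ihg ihh => exact ihg (ihh hv)
  | inv g _ ih =>
    -- An injective self-map of the finite set of roots is surjective, so preimages of roots are
    -- roots.
    have hinj : Function.Injective (fun w : R => (⟨g w, ih w.2⟩ : R)) := by
      intro a b hab
      exact Subtype.ext (g.injective (congrArg Subtype.val hab))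
    obtain ⟨w, hw⟩ := (Finite.surjective_of_injective hinj) ⟨v, hv⟩
    have : g w = v := congrArg Subtype.val hw
    rw [← this]
    have : g⁻¹ (g w) = (w : Vec N) := g.symm_apply_apply _
    rw [this]; exact w.2

/-- The permutation of the roots by an element of the group. -/
def rootPerm (hR : IsRootSystem R) (g : W R) : R ≃ R :=
  Equiv.ofBijective (fun v => ⟨(g : Vec N ≃ₗᵢ[ℝ] Vec N) v, hR.map_mem g v.2⟩) <| by
    apply Finite.injective_iff_bijective.1
    intro a b hab
    exact Subtype.ext ((g : Vec N ≃ₗᵢ[ℝ] Vec N).injective (congrArg Subtype.val hab))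

@[simp] theorem coe_rootPerm (hR : IsRootSystem R) (g : W R) (v : R) :
    (rootPerm hR g v : Vec N) = (g : Vec N ≃ₗᵢ[ℝ] Vec N) v := rfl

theorem rootRefl_rootPerm_mul (hR : IsRootSystem R) (g : W R) (v : R) :
    rootRefl R (rootPerm hR g v) * g = g * rootRefl R v :=
  Subtype.ext (refl_map_mul _ _)

theorem isConj_rootRefl_rootPerm (hR : IsRootSystem R) (g : W R) (v : R) :
    IsConj (rootRefl R v) (rootRefl R (rootPerm hR g v)) :=
  isConj_iff.2 ⟨g, by rw [← rootRefl_rootPerm_mul hR, mul_inv_cancel_right]⟩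

end Roots

/-! ### Polynomials on two copies of the space, derivatives and divided differences. -/

section Polynomial

open MvPolynomial

variable {N : ℕ} {K : Type*} [CommRing K] (ρ : ℝ →+* K)

/-- The linear form `x_α`. -/
def lin (α : Fin 2) (x : Vec N) : MvPolynomial (Fin 2 × Fin N) K := ∑ i, ρ (x i) • X (α, i)

theorem lin_add (α : Fin 2) (x y : Vec N) : lin ρ α (x + y) = lin ρ α x + lin ρ α y := by
  simp [lin, add_smul, Finset.sum_add_distrib]

theorem lin_smul (α : Fin 2) (r : ℝ) (x : Vec N) : lin ρ α (r • x) = ρ r • lin ρ α x := by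
  simp [lin, mul_smul, Finset.smul_sum]

theorem lin_sub (α : Fin 2) (x y : Vec N) : lin ρ α (x - y) = lin ρ α x - lin ρ α y := by
  simp [lin, sub_smul]

theorem lin_sum {ι : Type*} (s : Finset ι) (α : Fin 2) (x : ι → Vec N) :
    lin ρ α (∑ j ∈ s, x j) = ∑ j ∈ s, lin ρ α (x j) := by
  simp only [lin, WithLp.ofLp_sum, Finset.sum_apply, map_sum, Finset.sum_smul]
  exact Finset.sum_comm

theorem lin_single (α : Fin 2) (i : Fin N) :
    lin ρ α (EuclideanSpace.single i (1 : ℝ)) = X (α, i) := by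
  rw [lin, Finset.sum_eq_single i]
  · simp
  · intro j _ hj; simp [hj]
  · simp

theorem vec_eq_sum (x : Vec N) : x = ∑ i, x i • EuclideanSpace.single i (1 : ℝ) := by
  ext j
  simp [WithLp.ofLp_sum, Finset.sum_apply, Pi.single_apply]

theorem lin_ne_zero [Nontrivial K] (α : Fin 2) {x : Vec N} (hx : x ≠ 0) : lin ρ α x ≠ 0 := by
  intro h
  apply hx
  ext i
  have h2 := congrArg (coeff (Finsupp.single (α, i) 1)) h
  rw [lin, coeff_sum, Finset.sum_eq_single i] at h2
  · simpa using h2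
  · intro j _ hj
    rw [coeff_smul, coeff_X, if_neg]
    · simp
    · intro h; apply hj
      have := Finsupp.single_left_injective (one_ne_zero) h
      simpa using this
  · simp

/-- The substitution that transforms the `α`-variables by `G α`. -/
def subst (G : Fin 2 → Vec N ≃ₗᵢ[ℝ] Vec N) :
    MvPolynomial (Fin 2 × Fin N) K →ₐ[K] MvPolynomial (Fin 2 × Fin N) K :=
  aeval fun p => lin ρ p.1 (G p.1 (EuclideanSpace.single p.2 (1 : ℝ)))

theorem subst_lin (G : Fin 2 → Vec N ≃ₗᵢ[ℝ] Vec N) (α : Fin 2) (x : Vec N) :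
    subst ρ G (lin ρ α x) = lin ρ α (G α x) := by
  conv_rhs => rw [vec_eq_sum x, map_sum, lin_sum]
  simp [lin, subst, map_sum, Finset.smul_sum, mul_smul]

theorem subst_subst (G H : Fin 2 → Vec N ≃ₗᵢ[ℝ] Vec N) (f : MvPolynomial (Fin 2 × Fin N) K) :
    subst ρ G (subst ρ H f) = subst ρ (G * H) f := by
  have : (subst ρ G).comp (subst ρ H) = subst (K := K) ρ (G * H) := by
    ext1 p
    obtain ⟨α, i⟩ := p
    rw [AlgHom.comp_apply, ← lin_single ρ α i, subst_lin, subst_lin, subst_lin]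
    rfl
  rw [← this]; rfl

theorem subst_one (f : MvPolynomial (Fin 2 × Fin N) K) : subst ρ 1 f = f := by
  have : subst ρ (1 : Fin 2 → Vec N ≃ₗᵢ[ℝ] Vec N) = AlgHom.id K _ := by
    ext1 p
    obtain ⟨α, i⟩ := p
    rw [← lin_single ρ α i, subst_lin]; rfl
  rw [this]; rfl

/-- The action of an orthogonal transformation on polynomials. -/
abbrev act (g : Vec N ≃ₗᵢ[ℝ] Vec N) :
    MvPolynomial (Fin 2 × Fin N) K →ₐ[K] MvPolynomial (Fin 2 × Fin N) K :=
  subst ρ fun _ => g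

/-- The derivative in the `α`-variables along `x`. -/
def pd (α : Fin 2) (x : Vec N) :
    Derivation K (MvPolynomial (Fin 2 × Fin N) K) (MvPolynomial (Fin 2 × Fin N) K) :=
  ∑ i, ρ (x i) • pderiv (α, i)

theorem pd_apply (α : Fin 2) (x : Vec N) (f : MvPolynomial (Fin 2 × Fin N) K) :
    pd ρ α x f = ∑ i, ρ (x i) • pderiv (α, i) f := by
  have := congrFun (map_sum (Derivation.coeFnAddMonoidHom (R := K)
    (A := MvPolynomial (Fin 2 × Fin N) K) (M := MvPolynomial (Fin 2 × Fin N) K))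
    (fun i => ρ (x i) • pderiv (α, i)) Finset.univ) f
  rw [Finset.sum_apply] at this
  exact this

theorem pd_mul (α : Fin 2) (x : Vec N) (f g : MvPolynomial (Fin 2 × Fin N) K) :
    pd ρ α x (f * g) = f * pd ρ α x g + g * pd ρ α x f := by
  rw [Derivation.leibniz]; simp

theorem pd_X (α β : Fin 2) (x : Vec N) (i : Fin N) :
    pd ρ α x (X (β, i)) = if α = β then C (ρ (x i)) else 0 := by
  rw [pd_apply]
  split_ifs with h
  · subst h
    rw [Finset.sum_eq_single i]
    · simp [smul_eq_C_mul]
    · intro j _ hj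
      rw [pderiv_X_of_ne (by simpa using Ne.symm hj)]; simp
    · simp
  · apply Finset.sum_eq_zero
    intro j _
    rw [pderiv_X_of_ne (by simp [Ne.symm h])]; simp

theorem pd_lin (α β : Fin 2) (x y : Vec N) :
    pd ρ α x (lin ρ β y) = if α = β then C (ρ ⟪x, y⟫) else 0 := by
  rw [lin, map_sum]
  simp only [Derivation.map_smul, pd_X]
  split_ifs with h
  · simp [PiLp.inner_apply, smul_eq_C_mul, mul_comm]
  · simp

theorem pd_add_left (α : Fin 2) (x y : Vec N) (f : MvPolynomial (Fin 2 × Fin N) K) :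
    pd ρ α (x + y) f = pd ρ α x f + pd ρ α y f := by
  simp [pd_apply, add_smul, Finset.sum_add_distrib]

theorem pd_smul_left (α : Fin 2) (r : ℝ) (x : Vec N) (f : MvPolynomial (Fin 2 × Fin N) K) :
    pd ρ α (r • x) f = ρ r • pd ρ α x f := by
  simp [pd_apply, mul_smul, Finset.smul_sum]

theorem pd_comm (α β : Fin 2) (x y : Vec N) (f : MvPolynomial (Fin 2 × Fin N) K) :
    pd ρ α x (pd ρ β y f) = pd ρ β y (pd ρ α x f) := by
  have : ⁅pd (K := K) ρ α x, pd ρ β y⁆ = 0 := by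
    apply MvPolynomial.derivation_ext
    rintro ⟨γ, i⟩
    rw [Derivation.commutator_apply, pd_X, pd_X]
    split_ifs <;> simp
  have h := DFunLike.congr_fun this f
  rw [Derivation.commutator_apply] at h
  simpa [sub_eq_zero] using h

theorem act_pd (g : Vec N ≃ₗᵢ[ℝ] Vec N) (α : Fin 2) (x : Vec N)
    (f : MvPolynomial (Fin 2 × Fin N) K) :
    act ρ g (pd ρ α x f) = pd ρ α (g x) (act ρ g f) := by
  induction f using MvPolynomial.induction_on with
  | C a => simp [← algebraMap_eq]
  | add p q hp hq => simp only [map_add, hp, hq]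
  | mul_X p n hp =>
    obtain ⟨β, i⟩ := n
    rw [← lin_single ρ β i, pd_mul, map_add, map_mul, map_mul, hp, map_mul, pd_mul, subst_lin,
      pd_lin, pd_lin, LinearIsometryEquiv.inner_map_map]
    split_ifs <;> simp [← algebraMap_eq]

/-- The substitution that applies the reflection to the `0`-variables only. -/
abbrev halfRefl (v : Vec N) :
    MvPolynomial (Fin 2 × Fin N) K →ₐ[K] MvPolynomial (Fin 2 × Fin N) K :=
  subst ρ ![refl v, 1]

/-- The two substitutions differ only on the `1`-variables, where `y - R_v y` is a multiple of `v`.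
The quotient arises when `x_0` is moved through `p q`, with `p` in the `1`-variables and `q` in the
`0`-variables: passing `p` leaves `(p - R_v p) / v_1` followed by `R_v`, which then acts on `q`. -/
theorem lin_dvd_halfRefl_sub (v : Vec N) (f : MvPolynomial (Fin 2 × Fin N) K) :
    lin ρ 1 v ∣ halfRefl ρ v f - act ρ (refl v) f := by
  induction f using MvPolynomial.induction_on with
  | C a => simp [← algebraMap_eq]
  | add p q hp hq =>
    rw [map_add, map_add, add_sub_add_comm]; exact dvd_add hp hq
  | mul_X p n hp =>
    obtain ⟨α, i⟩ := n
    rw [← lin_single ρ α i, map_mul, map_mul, subst_lin, subst_lin]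
    set y : Vec N := EuclideanSpace.single i 1
    have h : lin ρ 1 v ∣ lin (K := K) ρ α ((![refl v, 1] : Fin 2 → Vec N ≃ₗᵢ[ℝ] Vec N) α y) -
        lin ρ α (refl v y) := by
      fin_cases α
      · simp
      · simp only [Fin.mk_one, Matrix.cons_val_one, Matrix.cons_val_fin_one]
        rw [← lin_sub, refl_apply]
        change _ ∣ lin ρ 1 (y - _)
        rw [sub_sub_cancel, lin_smul, smul_eq_C_mul]
        exact dvd_mul_left _ _
    have := dvd_add (hp.mul_right (lin ρ α ((![refl v, 1] : Fin 2 → Vec N ≃ₗᵢ[ℝ] Vec N) α y)))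
      (h.mul_left (act ρ (refl v) p))
    convert this using 1
    ring

variable [IsDomain K]

/-- The divided difference attached to a reflection. -/
def divDiff {v : Vec N} (hv : v ≠ 0) :
    MvPolynomial (Fin 2 × Fin N) K →ₗ[K] MvPolynomial (Fin 2 × Fin N) K where
  toFun f := (lin_dvd_halfRefl_sub ρ v f).choose
  map_add' f g := by
    apply mul_left_cancel₀ (lin_ne_zero ρ 1 hv)
    rw [mul_add, ← (lin_dvd_halfRefl_sub ρ v f).choose_spec,
      ← (lin_dvd_halfRefl_sub ρ v g).choose_spec,
      ← (lin_dvd_halfRefl_sub ρ v (f + g)).choose_spec, map_add, map_add]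
    ring
  map_smul' r f := by
    apply mul_left_cancel₀ (lin_ne_zero ρ 1 hv)
    rw [RingHom.id_apply, mul_smul_comm, ← (lin_dvd_halfRefl_sub ρ v f).choose_spec,
      ← (lin_dvd_halfRefl_sub ρ v (r • f)).choose_spec, map_smul, map_smul, smul_sub]

theorem lin_mul_divDiff {v : Vec N} (hv : v ≠ 0) (f : MvPolynomial (Fin 2 × Fin N) K) :
    lin ρ 1 v * divDiff ρ hv f = halfRefl ρ v f - act ρ (refl v) f :=
  (lin_dvd_halfRefl_sub ρ v f).choose_spec.symm

theorem divDiff_lin_one_mul {v : Vec N} (hv : v ≠ 0) (y : Vec N)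
    (f : MvPolynomial (Fin 2 × Fin N) K) :
    divDiff ρ hv (lin ρ 1 y * f) =
      lin ρ 1 y * divDiff ρ hv f + ρ (2 * (⟪y, v⟫ / ⟪v, v⟫)) • act ρ (refl v) f := by
  apply mul_left_cancel₀ (lin_ne_zero (K := K) ρ 1 hv)
  rw [mul_add, mul_left_comm, lin_mul_divDiff, lin_mul_divDiff, map_mul, map_mul, subst_lin,
    subst_lin, mul_smul_comm, ← smul_mul_assoc, ← lin_smul]
  have : (2 * (⟪y, v⟫ / ⟪v, v⟫)) • v = y - refl v y := by rw [refl_apply, sub_sub_cancel]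
  rw [this, lin_sub]
  change lin ρ 1 y * _ - _ = _
  ring

theorem divDiff_eq_zero {v : Vec N} (hv : v ≠ 0) {f : MvPolynomial (Fin 2 × Fin N) K}
    (hf : halfRefl ρ v f = act ρ (refl v) f) : divDiff ρ hv f = 0 := by
  apply mul_left_cancel₀ (lin_ne_zero (K := K) ρ 1 hv)
  rw [lin_mul_divDiff, hf]; simp

/-- Both sides agree after multiplication by `(g v)_1`, because `R_{gv} g = g R_v`. -/
theorem act_divDiff {v : Vec N} (hv : v ≠ 0) (g : Vec N ≃ₗᵢ[ℝ] Vec N) (hgv : g v ≠ 0)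
    (f : MvPolynomial (Fin 2 × Fin N) K) :
    act ρ g (divDiff ρ hv f) = divDiff ρ hgv (act ρ g f) := by
  apply mul_left_cancel₀ (lin_ne_zero (K := K) ρ 1 hgv)
  rw [lin_mul_divDiff]
  have := congrArg (act ρ g) (lin_mul_divDiff ρ hv f)
  rw [map_mul, subst_lin] at this
  rw [this, map_sub]
  simp only [subst_subst]
  congr 3
  · funext α
    fin_cases α
    · exact (refl_map_mul g v).symm
    · rfl
  · funext α
    exact (refl_map_mul g v).symm

end Polynomial

end Calogero

end

/-! ### Dunkl operators on the Fock space. -/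

noncomputable section

namespace Calogero

open MvPolynomial

variable {N : ℕ} (R : Finset (Vec N)) (K : Type*) [CommRing K]

/-- The space `S(V ⊕ V) ⊗ K[W(R)]` underlying the algebra of observables. -/
abbrev Fock : Type _ := W R →₀ MvPolynomial (Fin 2 × Fin N) K

variable {R K}

/-- The operator that moves the sector `w` to the sector `s w` and acts there by `T`. -/
def sectorMap (s : W R → W R)
    (T : W R → MvPolynomial (Fin 2 × Fin N) K →ₗ[K] MvPolynomial (Fin 2 × Fin N) K) :
    Fock R K →ₗ[K] Fock R K :=
  Finsupp.lsum K fun w => Finsupp.lsingle (s w) ∘ₗ T w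

@[simp] theorem sectorMap_single (s : W R → W R)
    (T : W R → MvPolynomial (Fin 2 × Fin N) K →ₗ[K] MvPolynomial (Fin 2 × Fin N) K)
    (w : W R) (p : MvPolynomial (Fin 2 × Fin N) K) :
    sectorMap s T (Finsupp.single w p) = Finsupp.single (s w) (T w p) := by
  simp [sectorMap]

theorem fock_ext {T T' : Fock R K →ₗ[K] Fock R K}
    (h : ∀ w p, T (Finsupp.single w p) = T' (Finsupp.single w p)) : T = T' := by
  apply Finsupp.lhom_ext
  exact h

variable (ρ : ℝ →+* K)

/-- The action of the group. -/
def opG : W R →* Module.End K (Fock R K) where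
  toFun g := sectorMap (fun w => g * w) fun _ => (act ρ (g : Vec N ≃ₗᵢ[ℝ] Vec N)).toLinearMap
  map_one' := by
    apply fock_ext
    intro w p
    simp only [sectorMap_single, one_mul]
    congr 1
    exact subst_one ρ p
  map_mul' g h := by
    apply fock_ext
    intro w p
    simp only [sectorMap_single, Module.End.mul_apply, mul_assoc, AlgHom.toLinearMap_apply]
    rw [act, act, subst_subst]
    rfl

@[simp] theorem opG_single (g w : W R) (p : MvPolynomial (Fin 2 × Fin N) K) :
    opG ρ g (Finsupp.single w p) =
      Finsupp.single (g * w) (act ρ (g : Vec N ≃ₗᵢ[ℝ] Vec N) p) := by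
  simp [opG]

variable (R) in
/-- Multiplication by `x_1`. -/
def opX (x : Vec N) : Module.End K (Fock R K) :=
  sectorMap id fun _ => LinearMap.mulLeft K (lin ρ 1 x)

@[simp] theorem opX_single (x : Vec N) (w : W R) (p : MvPolynomial (Fin 2 × Fin N) K) :
    opX R ρ x (Finsupp.single w p) = Finsupp.single w (lin ρ 1 x * p) := by
  simp [opX]

variable (R) in
/-- The action of `x_0` for vanishing coupling constants. -/
def opFree (x : Vec N) : Module.End K (Fock R K) :=
  sectorMap id fun _ => LinearMap.mulLeft K (lin ρ 0 x) + (pd ρ 1 x).toLinearMap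

@[simp] theorem opFree_single (x : Vec N) (w : W R) (p : MvPolynomial (Fin 2 × Fin N) K) :
    opFree R ρ x (Finsupp.single w p) = Finsupp.single w (lin ρ 0 x * p + pd ρ 1 x p) := by
  simp [opFree]

theorem opX_add (x y : Vec N) : opX R ρ (x + y) = opX R ρ x + opX R ρ y := by
  apply fock_ext; intro w p
  simp [lin_add, add_mul]

theorem opX_smul (r : ℝ) (x : Vec N) : opX R ρ (r • x) = ρ r • opX R ρ x := by
  apply fock_ext; intro w p
  rw [LinearMap.smul_apply, opX_single, opX_single, Finsupp.smul_single, lin_smul,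
    smul_mul_assoc]

theorem opFree_add (x y : Vec N) : opFree R ρ (x + y) = opFree R ρ x + opFree R ρ y := by
  apply fock_ext; intro w p
  simp only [opFree_single, LinearMap.add_apply, lin_add, add_mul, pd_add_left]
  rw [← Finsupp.single_add]; congr 1; abel

theorem opFree_smul (r : ℝ) (x : Vec N) : opFree R ρ (r • x) = ρ r • opFree R ρ x := by
  apply fock_ext; intro w p
  rw [LinearMap.smul_apply, opFree_single, opFree_single, Finsupp.smul_single, lin_smul,
    smul_mul_assoc, pd_smul_left, smul_add]

theorem opG_mul_opX (g : W R) (x : Vec N) :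
    opG ρ g * opX R ρ x = opX R ρ ((g : Vec N ≃ₗᵢ[ℝ] Vec N) x) * opG ρ g := by
  apply fock_ext; intro w p
  simp only [Module.End.mul_apply, opX_single, opG_single, map_mul, subst_lin]

theorem opG_mul_opFree (g : W R) (x : Vec N) :
    opG ρ g * opFree R ρ x = opFree R ρ ((g : Vec N ≃ₗᵢ[ℝ] Vec N) x) * opG ρ g := by
  apply fock_ext; intro w p
  simp only [Module.End.mul_apply, opFree_single, opG_single, map_add, map_mul, subst_lin, act_pd]

theorem opX_comm (x y : Vec N) : opX R ρ x * opX R ρ y = opX R ρ y * opX R ρ x := by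
  apply fock_ext; intro w p
  simp only [Module.End.mul_apply, opX_single]
  rw [mul_left_comm]

/-- Polynomials in the `0`-variables. -/
def zeroPoly (N : ℕ) (K : Type*) [CommRing K] : Subalgebra K (MvPolynomial (Fin 2 × Fin N) K) :=
  Algebra.adjoin K (Set.range fun i : Fin N => X (0, i))

theorem lin_zero_mem_zeroPoly (x : Vec N) : lin ρ 0 x ∈ zeroPoly N K :=
  Subalgebra.sum_mem _ fun i _ =>
    Subalgebra.smul_mem _ (Algebra.subset_adjoin (Set.mem_range_self i)) _

theorem pd_eq_zero_of_mem_zeroPoly {p : MvPolynomial (Fin 2 × Fin N) K} (hp : p ∈ zeroPoly N K)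
    (x : Vec N) : pd ρ 1 x p = 0 := by
  induction hp using Algebra.adjoin_induction with
  | mem p hp => obtain ⟨i, rfl⟩ := hp; simp [pd_X]
  | algebraMap r => simp
  | add p q _ _ hp hq => simp [hp, hq]
  | mul p q _ _ hp hq => simp [hp, hq]

theorem halfRefl_eq_of_mem_zeroPoly {p : MvPolynomial (Fin 2 × Fin N) K}
    (hp : p ∈ zeroPoly N K) (v : Vec N) : halfRefl ρ v p = act ρ (refl v) p := by
  induction hp using Algebra.adjoin_induction with
  | mem p hp =>
    obtain ⟨i, rfl⟩ := hp
    simp only [← lin_single ρ]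
    rw [subst_lin, subst_lin]; rfl
  | algebraMap r => rw [AlgHom.commutes, AlgHom.commutes]
  | add p q _ _ hp hq => rw [map_add, map_add, hp, hq]
  | mul p q _ _ hp hq => rw [map_mul, map_mul, hp, hq]

/-- An operator that commutes with the multiplications by the `1`-variables and kills the
polynomials in the `0`-variables vanishes. -/
theorem eq_zero_of_commute_opX {T : Module.End K (Fock R K)}
    (hT : ∀ x, T * opX R ρ x = opX R ρ x * T)
    (h0 : ∀ w, ∀ p ∈ zeroPoly N K, T (Finsupp.single w p) = 0) : T = 0 := by
  have key : ∀ f : MvPolynomial (Fin 2 × Fin N) K, ∀ w, ∀ p ∈ zeroPoly N K,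
      T (Finsupp.single w (f * p)) = 0 := by
    intro f
    induction f using MvPolynomial.induction_on with
    | C a => intro w p hp; rw [← smul_eq_C_mul]; exact h0 w _ (Subalgebra.smul_mem _ hp a)
    | add f g hf hg =>
      intro w p hp
      rw [add_mul, Finsupp.single_add, map_add, hf w p hp, hg w p hp, add_zero]
    | mul_X f n hf =>
      intro w p hp
      obtain ⟨α, i⟩ := n
      by_cases hα : α = 0
      · subst hα
        rw [mul_assoc]
        exact hf w _ (Subalgebra.mul_mem _ (Algebra.subset_adjoin ⟨i, rfl⟩) hp)
      · have hα : α = 1 := by fin_cases α <;> simp at hα ⊢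
        subst hα
        have h1 := LinearMap.congr_fun (hT (EuclideanSpace.single i 1))
          (Finsupp.single w (f * p))
        rw [Module.End.mul_apply, Module.End.mul_apply, hf w p hp, map_zero, opX_single,
          lin_single] at h1
        rw [← h1]
        congr 2; ring
  apply fock_ext
  intro w p
  have := key p w 1 (Subalgebra.one_mem _)
  rw [mul_one] at this
  simpa using this

/-- The Jacobi identity for two elements whose commutators with a third one are known. -/
theorem commutator_commute {E : Type*} [Ring E] {a b z p q : E} (ha : a * z = z * a + p)
    (hb : b * z = z * b + q) (h : a * q - q * a = b * p - p * b) :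
    (a * b - b * a) * z = z * (a * b - b * a) := by
  have e1 : a * b * z = z * (a * b) + p * b + a * q := by
    rw [mul_assoc, hb, mul_add, ← mul_assoc, ha]; noncomm_ring
  have e2 : b * a * z = z * (b * a) + q * a + b * p := by
    rw [mul_assoc, ha, mul_add, ← mul_assoc, hb]; noncomm_ring
  rw [sub_mul, mul_sub, e1, e2, sub_eq_iff_eq_add.1 h]; abel

theorem eq_neg_one_smul_add {E : Type*} [Ring E] [Algebra K E] (a b : E) :
    a = (-1 : K) • b + (a + b) := by
  rw [neg_smul, one_smul]; abel

variable [IsDomain K] (hR : IsRootSystem R) (c : R → K)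

/-- The reflection part of the Dunkl operator for one root. -/
def opRefl (v : R) : Module.End K (Fock R K) :=
  sectorMap (fun w => rootRefl R v * w) fun _ => divDiff ρ (hR.ne_zero v v.2)

@[simp] theorem opRefl_single (v : R) (w : W R) (p : MvPolynomial (Fin 2 × Fin N) K) :
    opRefl ρ hR v (Finsupp.single w p) =
      Finsupp.single (rootRefl R v * w) (divDiff ρ (hR.ne_zero v v.2) p) := by
  simp [opRefl]

/-- The Dunkl operators. -/
def opD (x : Vec N) : Module.End K (Fock R K) :=
  opFree R ρ x + ∑ v : R, (c v * ρ (⟪x, (v : Vec N)⟫ / 2)) • opRefl ρ hR v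

theorem opD_add (x y : Vec N) : opD ρ hR c (x + y) = opD ρ hR c x + opD ρ hR c y := by
  simp only [opD, opFree_add, inner_add_left, add_div, map_add, mul_add, add_smul,
    Finset.sum_add_distrib]
  abel

theorem opD_smul (r : ℝ) (x : Vec N) : opD ρ hR c (r • x) = ρ r • opD ρ hR c x := by
  simp only [opD, opFree_smul, inner_smul_left, RCLike.conj_to_real, mul_div_assoc, map_mul,
    smul_add, Finset.smul_sum, smul_smul, mul_left_comm]

theorem opG_mul_opRefl (g : W R) (v : R) :
    opG ρ g * opRefl ρ hR v = opRefl ρ hR (rootPerm hR g v) * opG ρ g := by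
  apply fock_ext; intro w p
  simp only [Module.End.mul_apply, opRefl_single, opG_single]
  rw [← mul_assoc, ← mul_assoc, rootRefl_rootPerm_mul]
  congr 1
  exact act_divDiff ρ _ _ _ _

variable {c}

theorem opG_mul_opD (hc : ∀ v w : R, IsConj (rootRefl R v) (rootRefl R w) → c v = c w)
    (g : W R) (x : Vec N) :
    opG ρ g * opD ρ hR c x = opD ρ hR c ((g : Vec N ≃ₗᵢ[ℝ] Vec N) x) * opG ρ g := by
  rw [opD, opD, mul_add, add_mul, opG_mul_opFree, Finset.mul_sum, Finset.sum_mul]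
  congr 1
  refine Fintype.sum_equiv (rootPerm hR g) _ _ fun v => ?_
  rw [mul_smul_comm, smul_mul_assoc, opG_mul_opRefl, ← hc _ _ (isConj_rootRefl_rootPerm hR g v),
    coe_rootPerm, LinearIsometryEquiv.inner_map_map]

variable (c) in
/-- The value of the commutators of Dunkl operators with multiplications. -/
def opBracket (x y : Vec N) : Module.End K (Fock R K) :=
  ρ ⟪x, y⟫ • 1 + ∑ v : R, (c v * ρ (⟪x, (v : Vec N)⟫ * ⟪y, (v : Vec N)⟫ /
    ⟪(v : Vec N), (v : Vec N)⟫)) • opG ρ (rootRefl R v)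

/-- The derivative yields the scalar product, and the divided differences yield the reflections by
their twisted Leibniz rule `divDiff_lin_one_mul`, whose factor 2 cancels the 1/2 in `opD`. -/
theorem opD_mul_opX (x y : Vec N) :
    opD ρ hR c x * opX R ρ y = opX R ρ y * opD ρ hR c x + opBracket ρ c x y := by
  have h1 : opFree R ρ x * opX R ρ y = opX R ρ y * opFree R ρ x + ρ ⟪x, y⟫ • 1 := by
    apply fock_ext; intro w p
    simp only [Module.End.mul_apply, opX_single, opFree_single, LinearMap.add_apply,
      LinearMap.smul_apply, Module.End.one_apply, Finsupp.smul_single, pd_mul, pd_lin, if_true]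
    rw [← Finsupp.single_add, smul_eq_C_mul]
    congr 1; ring
  have h2 : ∀ v : R, opRefl ρ hR v * opX R ρ y = opX R ρ y * opRefl ρ hR v +
      ρ (2 * (⟪y, (v : Vec N)⟫ / ⟪(v : Vec N), (v : Vec N)⟫)) • opG ρ (rootRefl R v) := by
    intro v
    apply fock_ext; intro w p
    simp only [Module.End.mul_apply, opX_single, opRefl_single, LinearMap.add_apply,
      LinearMap.smul_apply, opG_single, Finsupp.smul_single, divDiff_lin_one_mul]
    rw [← Finsupp.single_add]
    rfl
  rw [opD, opBracket, add_mul, mul_add, h1, Finset.sum_mul, Finset.mul_sum]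
  simp only [smul_mul_assoc, mul_smul_comm, h2, smul_add, Finset.sum_add_distrib, smul_smul]
  have h3 : ∀ v : R, c v * ρ (⟪x, (v : Vec N)⟫ / 2) *
      ρ (2 * (⟪y, (v : Vec N)⟫ / ⟪(v : Vec N), (v : Vec N)⟫)) =
      c v * ρ (⟪x, (v : Vec N)⟫ * ⟪y, (v : Vec N)⟫ / ⟪(v : Vec N), (v : Vec N)⟫) := by
    intro v
    rw [mul_assoc, ← map_mul]
    congr 2
    ring
  simp only [h3]
  abel

/-- Without `1`-variables the derivative vanishes and the two substitutions in the divided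
difference coincide. -/
theorem opD_single_of_mem_zeroPoly {p : MvPolynomial (Fin 2 × Fin N) K} (hp : p ∈ zeroPoly N K)
    (x : Vec N) (w : W R) :
    opD ρ hR c x (Finsupp.single w p) = Finsupp.single w (lin ρ 0 x * p) := by
  rw [opD, LinearMap.add_apply, LinearMap.sum_apply, opFree_single,
    pd_eq_zero_of_mem_zeroPoly ρ hp, add_zero]
  rw [Finset.sum_eq_zero, add_zero]
  intro v _
  rw [LinearMap.smul_apply, opRefl_single,
    divDiff_eq_zero ρ _ (halfRefl_eq_of_mem_zeroPoly ρ hp v)]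
  simp

theorem opD_mul_opG_rootRefl
    (hc : ∀ v w : R, IsConj (rootRefl R v) (rootRefl R w) → c v = c w) (x : Vec N) (v : R) :
    opD ρ hR c x * opG ρ (rootRefl R v) = opG ρ (rootRefl R v) * opD ρ hR c x +
      ρ (2 * (⟪x, (v : Vec N)⟫ / ⟪(v : Vec N), (v : Vec N)⟫)) •
        (opD ρ hR c v * opG ρ (rootRefl R v)) := by
  rw [opG_mul_opD ρ hR hc, ← smul_mul_assoc, ← opD_smul, ← add_mul, ← opD_add]
  congr 2
  change x = refl (v : Vec N) x + _
  rw [refl_apply, sub_add_cancel]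

/-- The commutator commutes with all multiplications by `1`-variables. It kills the polynomials in
the `0`-variables, on which Dunkl operators are mere multiplications. These polynomials generate
everything, so it is zero. -/
theorem opD_comm (hc : ∀ v w : R, IsConj (rootRefl R v) (rootRefl R w) → c v = c w)
    (x y : Vec N) : opD ρ hR c x * opD ρ hR c y = opD ρ hR c y * opD ρ hR c x := by
  rw [← sub_eq_zero]
  apply eq_zero_of_commute_opX ρ
  · intro z
    -- By the Jacobi identity it suffices that `[D_x, [D_y, z_1]]` is symmetric in `x` and `y`.
    -- Since `[D_x, R_v]` is `2 (x, v) / (v, v)` times `D_v R_v`, the coefficients are symmetric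
    -- products of `(x, v)`, `(y, v)` and `(z, v)`.
    have hb : ∀ x y : Vec N, opD ρ hR c x * opBracket ρ c y z =
        opBracket ρ c y z * opD ρ hR c x + ∑ v : R, (c v * ρ (⟪y, (v : Vec N)⟫ * ⟪z, (v : Vec N)⟫ /
          ⟪(v : Vec N), (v : Vec N)⟫ * (2 * (⟪x, (v : Vec N)⟫ / ⟪(v : Vec N), (v : Vec N)⟫)))) •
            (opD ρ hR c v * opG ρ (rootRefl R v)) := by
      intro x y
      rw [opBracket, mul_add, add_mul, Finset.mul_sum, Finset.sum_mul]
      simp only [mul_smul_comm, smul_mul_assoc, opD_mul_opG_rootRefl ρ hR hc x, smul_add,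
        Finset.sum_add_distrib, smul_smul, mul_one, one_mul, map_mul, mul_assoc]
      abel
    have h1 := hb x y
    have h2 := hb y x
    have h3 : ∀ v : R, ⟪y, (v : Vec N)⟫ * ⟪z, (v : Vec N)⟫ /
          ⟪(v : Vec N), (v : Vec N)⟫ * (2 * (⟪x, (v : Vec N)⟫ / ⟪(v : Vec N), (v : Vec N)⟫)) =
        ⟪x, (v : Vec N)⟫ * ⟪z, (v : Vec N)⟫ /
          ⟪(v : Vec N), (v : Vec N)⟫ * (2 * (⟪y, (v : Vec N)⟫ / ⟪(v : Vec N), (v : Vec N)⟫)) := by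
      intro v; ring
    simp only [h3] at h1
    have h4 : opD ρ hR c x * opBracket ρ c y z - opBracket ρ c y z * opD ρ hR c x =
        opD ρ hR c y * opBracket ρ c x z - opBracket ρ c x z * opD ρ hR c y := by
      rw [h1, h2]; abel
    have hx := opD_mul_opX ρ hR (c := c) x z
    have hy := opD_mul_opX ρ hR (c := c) y z
    exact commutator_commute (E := Module.End K (Fock R K)) hx hy h4
  · intro w p hp
    rw [LinearMap.sub_apply, Module.End.mul_apply, Module.End.mul_apply,
      opD_single_of_mem_zeroPoly ρ hR hp, opD_single_of_mem_zeroPoly ρ hR hp,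
      opD_single_of_mem_zeroPoly ρ hR (Subalgebra.mul_mem _ (lin_zero_mem_zeroPoly ρ y) hp),
      opD_single_of_mem_zeroPoly ρ hR (Subalgebra.mul_mem _ (lin_zero_mem_zeroPoly ρ x) hp),
      mul_left_comm, sub_self]

variable (c) in
/-- The Dunkl operators and the multiplications, with a common index. -/
def opVec (α : Fin 2) : Vec N → Module.End K (Fock R K) := ![opD ρ hR c, opX R ρ] α

variable (c) in
theorem opVec_eq_sum (α : Fin 2) (x : Vec N) :
    ∑ i, ρ (x i) • opVec ρ hR c α (EuclideanSpace.single i 1) = opVec ρ hR c α x := by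
  have hsum : ∀ s : Finset (Fin N), opVec ρ hR c α (∑ i ∈ s, x i • EuclideanSpace.single i 1) =
      ∑ i ∈ s, ρ (x i) • opVec ρ hR c α (EuclideanSpace.single i 1) := by
    intro s
    have h0 : opVec ρ hR c α (0 : Vec N) = 0 := by
      have h1 := opD_smul ρ hR c 0 0
      have h2 := opX_smul (R := R) ρ 0 0
      rw [zero_smul, map_zero, zero_smul] at h1 h2
      fin_cases α
      · exact h1
      · exact h2
    induction s using Finset.cons_induction with
    | empty => simpa using h0
    | cons i s hi ih =>
      rw [Finset.sum_cons, Finset.sum_cons, ← ih]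
      fin_cases α
      · change opD ρ hR c _ = ρ _ • opD ρ hR c _ + opD ρ hR c _
        rw [opD_add, opD_smul]
      · change opX R ρ _ = ρ _ • opX R ρ _ + opX R ρ _
        rw [opX_add, opX_smul]
  rw [← hsum, ← vec_eq_sum]

/-- The Dunkl operator realization. -/
def dunkl (hc : ∀ v w : R, IsConj (rootRefl R v) (rootRefl R w) → c v = c w) :
    Realization R ρ c (Module.End K (Fock R K)) where
  gen I := opVec ρ hR c I.1 (EuclideanSpace.single I.2 1)
  grp := opG ρ
  grp_vec g α x := by
    simp only [opVec_eq_sum]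
    fin_cases α
    · exact opG_mul_opD ρ hR hc g x
    · exact opG_mul_opX ρ g x
  comm α β x y := by
    simp only [opVec_eq_sum]
    fin_cases α <;> fin_cases β
    · simpa [opVec, sub_eq_zero] using opD_comm ρ hR hc x y
    · simp only [opVec, Fin.zero_eta, Fin.mk_one, Matrix.cons_val_zero, Matrix.cons_val_one,
        Matrix.cons_val_fin_one, Matrix.of_apply, one_smul]
      exact sub_eq_of_eq_add' (G := Module.End K (Fock R K)) (opD_mul_opX ρ hR x y)
    · simp only [opVec, Fin.zero_eta, Fin.mk_one, Matrix.cons_val_zero, Matrix.cons_val_one,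
        Matrix.cons_val_fin_one, Matrix.of_apply]
      have h := opD_mul_opX ρ hR (c := c) y x
      rw [opBracket, real_inner_comm] at h
      simp only [mul_comm ⟪y, _⟫] at h
      refine sub_eq_of_eq_add (G := Module.End K (Fock R K)) ?_
      rw [h]
      exact eq_neg_one_smul_add (K := K) (E := Module.End K (Fock R K)) _ _
    · simpa [opVec, sub_eq_zero] using opX_comm ρ x y

end Calogero

end

/-! ### Ordered words and the Poincaré-Birkhoff-Witt property. -/

noncomputable section

namespace Calogero

open MvPolynomial

namespace Realization

variable {N : ℕ} {R : Finset (Vec N)} {K : Type*} [CommRing K] {ρ : ℝ →+* K} {c : R → K}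
  {B : Type*} [Ring B] [Algebra K B] (A : Realization R ρ c B)

/-- The letters of a word in the generators. -/
def basisWord (l : List (Fin 2 × Fin N)) : List (Fin 2 × Vec N) :=
  l.map fun p => (p.1, EuclideanSpace.single p.2 1)

theorem word_basisWord (l : List (Fin 2 × Fin N)) :
    A.word (basisWord l) = (l.map A.gen).prod := by
  simp [word, basisWord, Function.comp_def, vec_single]

/-- Words in vectors are linear combinations of words in the generators. -/
theorem word_mem_of_basisWord_mem {M : Submodule K B} {n : ℕ} {g : W R}
    (h : ∀ l : List (Fin 2 × Fin N), l.length = n → A.word (basisWord l) * A.grp g ∈ M)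
    (l : List (Fin 2 × Vec N)) (hl : l.length = n) : A.word l * A.grp g ∈ M := by
  have key : ∀ (l : List (Fin 2 × Vec N)) (l' : List (Fin 2 × Fin N)),
      l'.length + l.length = n → A.word (basisWord l' ++ l) * A.grp g ∈ M := by
    intro l
    induction l with
    | nil => intro l' hl'; simpa using h l' (by simpa using hl')
    | cons p l ih =>
      intro l' hl'
      have : A.word (basisWord l' ++ p :: l) * A.grp g = ∑ i, ρ (p.2 i) •
          (A.word (basisWord (l' ++ [(p.1, i)]) ++ l) * A.grp g) := by
        simp only [word_append, word_cons, basisWord, List.map_append, List.map_cons, List.map_nil,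
          word_nil, mul_one, vec_single]
        conv_lhs => rw [vec]
        simp only [Finset.sum_mul, Finset.mul_sum, smul_mul_assoc, mul_smul_comm, mul_assoc]
      rw [this]
      exact M.sum_mem fun i _ => M.smul_mem _ (ih _ (by simp at hl' ⊢; omega))
  simpa [basisWord] using key l [] (by simpa using hl)

/-- The algebra is generated by the `a_{α,i}` and the group. -/
def IsGenerated : Prop :=
  Algebra.adjoin K (Set.range A.gen ∪ Set.range A.grp) = ⊤

variable {A}

theorem IsGenerated.mem_of_word_mem (hA : A.IsGenerated) {M : Submodule K B}
    (h : ∀ (l : List (Fin 2 × Vec N)) (g : W R), A.word l * A.grp g ∈ M) (b : B) : b ∈ M := by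
  let S : Submodule K B :=
    Submodule.span K (Set.range fun q : List (Fin 2 × Vec N) × W R => A.word q.1 * A.grp q.2)
  have hS : S ≤ M := Submodule.span_le.2 (by rintro _ ⟨q, rfl⟩; exact h _ _)
  apply hS
  have hb : b ∈ Algebra.adjoin K (Set.range A.gen ∪ Set.range A.grp) := hA ▸ Algebra.mem_top
  induction hb using Algebra.adjoin_induction with
  | mem b hb =>
    rcases hb with ⟨⟨α, i⟩, rfl⟩ | ⟨g, rfl⟩
    · exact Submodule.subset_span ⟨([(α, EuclideanSpace.single i 1)], 1), by simp [vec_single]⟩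
    · exact Submodule.subset_span ⟨([], g), by simp⟩
  | algebraMap r =>
    rw [Algebra.algebraMap_eq_smul_one]
    exact S.smul_mem _ (Submodule.subset_span ⟨([], 1), by simp⟩)
  | add a b _ _ ha hb => exact S.add_mem ha hb
  | mul a b _ _ ha hb =>
    have := Submodule.mul_mem_mul ha hb
    rw [Submodule.span_mul_span] at this
    refine Submodule.span_mono ?_ this
    rintro _ ⟨_, ⟨q, rfl⟩, _, ⟨q', rfl⟩, rfl⟩
    refine ⟨(q.1 ++ mapWord q.2 q'.1, q.2 * q'.2), ?_⟩
    simp only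
    rw [← word_grp_word_grp]; noncomm_ring

variable (A)

/-- The word with the `1`-letters before the `0`-letters. -/
def ordWord (l : List (Fin 2 × Fin N)) : B :=
  ((l.filter fun p => p.1 = 1).map A.gen).prod * ((l.filter fun p => ¬ p.1 = 1).map A.gen).prod

theorem gen_comm_of_eq (α : Fin 2) (i j : Fin N) :
    A.gen (α, i) * A.gen (α, j) = A.gen (α, j) * A.gen (α, i) := by
  have h := A.vec_comm α α (EuclideanSpace.single i 1) (EuclideanSpace.single j 1)
  rw [vec_single, vec_single] at h
  rw [← sub_eq_zero, h]
  fin_cases α <;> simp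

theorem prod_map_gen_eq_of_perm {l l' : List (Fin 2 × Fin N)} (h : l.Perm l') (α : Fin 2)
    (hl : ∀ p ∈ l, p.1 = α) : (l.map A.gen).prod = (l'.map A.gen).prod := by
  apply (h.map A.gen).prod_eq'
  rw [List.pairwise_map]
  apply List.pairwise_of_forall_mem_list
  rintro ⟨_, i⟩ hp ⟨_, j⟩ hq
  obtain rfl := hl _ hp
  obtain h2 := hl _ hq
  simp only at h2
  subst h2
  exact A.gen_comm_of_eq _ i j

theorem ordWord_eq_of_perm {l l' : List (Fin 2 × Fin N)} (h : l.Perm l') :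
    A.ordWord l = A.ordWord l' := by
  rw [ordWord, ordWord, A.prod_map_gen_eq_of_perm (h.filter _) 1,
    A.prod_map_gen_eq_of_perm (h.filter (fun p => decide ¬p.1 = 1)) 0]
  · intro p hp
    have := (List.mem_filter.1 hp).2
    simp only [decide_not, Bool.not_eq_eq_eq_not, Bool.not_true, decide_eq_false_iff_not] at this
    obtain ⟨α, i⟩ := p
    fin_cases α <;> simp at this ⊢
  · intro p hp
    simpa using (List.mem_filter.1 hp).2

variable {A}

/-- Sorting the letters of a word costs only words two letters shorter, so induction on the length
leaves ordered words. -/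
theorem IsGenerated.mem_of_ordWord_mem (hA : A.IsGenerated) {M : Submodule K B}
    (h : ∀ (l : List (Fin 2 × Fin N)) (g : W R), A.ordWord l * A.grp g ∈ M) (b : B) : b ∈ M := by
  apply hA.mem_of_word_mem
  intro l
  induction hn : l.length using Nat.strong_induction_on generalizing l with
  | _ n ih =>
  intro g
  refine A.word_mem_of_basisWord_mem (n := n) ?_ l hn
  intro l' hl'
  have hperm := (List.filter_append_perm (fun p : Fin 2 × Fin N => decide (p.1 = 1)) l').symm
  rw [basisWord, A.word_perm_mem_iff (n := n) (fun l g hl => ih l.length (by omega) l rfl g)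
    (hperm.map _) g (by simpa using hl')]
  have := h l' g
  rw [ordWord, ← word_basisWord, ← word_basisWord, ← word_append] at this
  simpa [basisWord] using this

end Realization

theorem prod_map_X_eq_monomial {N : ℕ} {K : Type*} [CommRing K] (l : List (Fin 2 × Fin N)) :
    ((l.map X).prod : MvPolynomial (Fin 2 × Fin N) K) =
      monomial (Multiset.toFinsupp (l : Multiset (Fin 2 × Fin N))) 1 := by
  induction l with
  | nil => simp
  | cons p l ih =>
    rw [List.map_cons, List.prod_cons, ih, X, monomial_mul, one_mul, ← Multiset.cons_coe,
      ← Multiset.singleton_add, map_add, Multiset.toFinsupp_singleton]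

/-- A generated realization that acts on the Fock space by Dunkl operators, through the vector
`ev b = b · 1`. -/
structure Model {N : ℕ} {R : Finset (Vec N)} {K : Type*} [CommRing K] [IsDomain K] (ρ : ℝ →+* K)
    (hR : IsRootSystem R) (c : R → K) (B : Type*) [Ring B] [Algebra K B] extends
    Realization R ρ c B where
  generated : toRealization.IsGenerated
  ev : B →ₗ[K] Fock R K
  ev_one : ev 1 = Finsupp.single 1 1
  ev_gen_mul : ∀ I b, ev (gen I * b) = opVec ρ hR c I.1 (EuclideanSpace.single I.2 1) (ev b)
  ev_grp_mul : ∀ g b, ev (grp g * b) = opG ρ g (ev b)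

section Dunkl

variable {N : ℕ} {R : Finset (Vec N)} {K : Type*} [CommRing K] [IsDomain K] (ρ : ℝ →+* K)
  (hR : IsRootSystem R) {c : R → K}
  (hc : ∀ v w : R, IsConj (rootRefl R v) (rootRefl R w) → c v = c w)

variable (R K) in
/-- The ring of operators on the Fock space. -/
def FockEnd : Type _ := Module.End K (Fock R K)

instance : Ring (FockEnd R K) := inferInstanceAs (Ring (Module.End K (Fock R K)))

instance : Algebra K (FockEnd R K) := inferInstanceAs (Algebra K (Module.End K (Fock R K)))

/-- The Dunkl operator realization in the ring of operators. -/
def dunklEnd : Realization R ρ c (FockEnd R K) := dunkl ρ hR hc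

/-- The value of an operator at the vacuum vector. -/
def FockEnd.vac : FockEnd R K →ₗ[K] Fock R K where
  toFun T := (show Module.End K (Fock R K) from T) (Finsupp.single 1 1)
  map_add' _ _ := rfl
  map_smul' _ _ := rfl

theorem vac_gen_mul (I : Fin 2 × Fin N) (T : FockEnd R K) :
    FockEnd.vac ((dunklEnd ρ hR hc).gen I * T) =
      opVec ρ hR c I.1 (EuclideanSpace.single I.2 1) (FockEnd.vac T) := rfl

theorem vac_grp_mul (g : W R) (T : FockEnd R K) :
    FockEnd.vac ((dunklEnd ρ hR hc).grp g * T) = opG ρ g (FockEnd.vac T) := rfl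

theorem FockEnd.smul_cancel {s : K} (hs : s ≠ 0) {S T : FockEnd R K} (h : s • S = s • T) :
    S = T := by
  apply LinearMap.ext (M := Fock R K)
  intro f
  have h2 : s • (show Module.End K (Fock R K) from S) f =
    s • (show Module.End K (Fock R K) from T) f :=
    congrArg (fun U : FockEnd R K => (show Module.End K (Fock R K) from U) f) h
  ext w d
  have h3 := congrArg (fun F : Fock R K => coeff d (F w)) h2
  simpa [hs] using h3

/-- The algebra generated by the Dunkl operators, the multiplications and the group. -/
def dunklAlgebra : Subalgebra K (FockEnd R K) :=
  Algebra.adjoin K (Set.range (dunklEnd ρ hR hc).gen ∪ Set.range (dunklEnd ρ hR hc).grp)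

/-- The realization in the algebra generated by the Dunkl operators. -/
def dunklRealization : Realization R ρ c (dunklAlgebra ρ hR hc) where
  gen I := ⟨(dunklEnd ρ hR hc).gen I, Algebra.subset_adjoin (Or.inl ⟨I, rfl⟩)⟩
  grp :=
    { toFun := fun g => ⟨(dunklEnd ρ hR hc).grp g, Algebra.subset_adjoin (Or.inr ⟨g, rfl⟩)⟩
      map_one' := Subtype.ext (map_one _)
      map_mul' := fun g h => Subtype.ext (map_mul _ g h) }
  grp_vec g α x := by
    apply Subtype.ext
    have := (dunklEnd ρ hR hc).grp_vec g α x
    simpa using this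
  comm α β x y := by
    apply Subtype.ext
    have := (dunklEnd ρ hR hc).comm α β x y
    simpa using this

theorem dunklRealization_isGenerated : (dunklRealization ρ hR hc).IsGenerated := by
  have h := Algebra.adjoin_adjoin_coe_preimage (R := K)
    (s := Set.range (dunklEnd ρ hR hc).gen ∪ Set.range (dunklEnd ρ hR hc).grp)
  refine Eq.trans (congrArg (Algebra.adjoin K) ?_) h
  ext b
  simp only [dunklRealization, Set.mem_union, Set.mem_range, MonoidHom.coe_mk,
    OneHom.coe_mk, Subtype.ext_iff]
  exact Iff.rfl

/-- The vacuum vector map on the algebra of Dunkl operators. -/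
def dunklEv : dunklAlgebra ρ hR hc →ₗ[K] Fock R K where
  toFun b := FockEnd.vac (b : FockEnd R K)
  map_add' a b := by rw [Subalgebra.coe_add, map_add]
  map_smul' r a := by rw [Subalgebra.coe_smul, map_smul, RingHom.id_apply]

theorem dunklEv_gen_mul (I : Fin 2 × Fin N) (b : dunklAlgebra ρ hR hc) :
    dunklEv ρ hR hc ((dunklRealization ρ hR hc).gen I * b) =
      opVec ρ hR c I.1 (EuclideanSpace.single I.2 1) (dunklEv ρ hR hc b) := by
  change FockEnd.vac (((dunklRealization ρ hR hc).gen I * b : dunklAlgebra ρ hR hc) : FockEnd R K)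
    = opVec ρ hR c I.1 (EuclideanSpace.single I.2 1) (FockEnd.vac (b : FockEnd R K))
  rw [← vac_gen_mul ρ hR hc, Subalgebra.coe_mul, dunklRealization]

theorem dunklEv_grp_mul (g : W R) (b : dunklAlgebra ρ hR hc) :
    dunklEv ρ hR hc ((dunklRealization ρ hR hc).grp g * b) =
      opG ρ g (dunklEv ρ hR hc b) := by
  change FockEnd.vac (((dunklRealization ρ hR hc).grp g * b : dunklAlgebra ρ hR hc) : FockEnd R K)
    = opG ρ g (FockEnd.vac (b : FockEnd R K))
  rw [← vac_grp_mul ρ hR hc, Subalgebra.coe_mul]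
  rfl

/-- The model given by the Dunkl operators. -/
def dunklModel : Model ρ hR c (dunklAlgebra ρ hR hc) where
  toRealization := dunklRealization ρ hR hc
  generated := dunklRealization_isGenerated ρ hR hc
  ev := dunklEv ρ hR hc
  ev_one := rfl
  ev_gen_mul := dunklEv_gen_mul ρ hR hc
  ev_grp_mul := dunklEv_grp_mul ρ hR hc

/-- Operators on a torsion-free module have no torsion. This allows cancelling the deformation
parameter later. -/
theorem smul_dunklAlgebra_cancel {s : K} (hs : s ≠ 0) {a b : dunklAlgebra ρ hR hc}
    (h : s • a = s • b) : a = b :=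
  Subtype.ext (FockEnd.smul_cancel hs (congrArg Subtype.val h))

end Dunkl

namespace Model

variable {N : ℕ} {R : Finset (Vec N)} {K : Type*} [CommRing K] [IsDomain K] {ρ : ℝ →+* K}
  {hR : IsRootSystem R} {c : R → K} {B : Type*} [Ring B] [Algebra K B] (A : Model ρ hR c B)

theorem ev_vec_mul (α : Fin 2) (x : Vec N) (b : B) :
    A.ev (A.vec α x * b) = opVec ρ hR c α x (A.ev b) := by
  rw [Realization.vec, Finset.sum_mul, map_sum, ← opVec_eq_sum, LinearMap.sum_apply]
  exact Finset.sum_congr rfl fun i _ => by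
    rw [smul_mul_assoc, map_smul, ev_gen_mul, LinearMap.smul_apply]

/-- The `0`-letters act first, on polynomials in the `0`-variables only, where Dunkl operators
multiply; the `1`-letters then multiply as well. No correction terms appear, so ordered words go to
monomials. -/
theorem ev_ordWord_mul_grp (l : List (Fin 2 × Fin N)) (g : W R) :
    A.ev (A.ordWord l * A.grp g) = Finsupp.single g (l.map X).prod := by
  have h0 : A.ev (A.grp g) = Finsupp.single g 1 := by
    have := A.ev_grp_mul g 1
    rw [mul_one] at this
    rw [this, ev_one, opG_single, mul_one, map_one]
  have hzero : ∀ l : List (Fin 2 × Fin N), (∀ p ∈ l, ¬ p.1 = 1) →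
      (l.map X).prod ∈ zeroPoly N K ∧
        A.ev ((l.map A.gen).prod * A.grp g) = Finsupp.single g (l.map X).prod := by
    intro l hl
    induction l with
    | nil => exact ⟨Subalgebra.one_mem _, by simpa using h0⟩
    | cons p l ih =>
      obtain ⟨α, i⟩ := p
      have hα : α = 0 := by
        have := hl (α, i) List.mem_cons_self
        fin_cases α <;> simp at this ⊢
      subst hα
      obtain ⟨h1, h2⟩ := ih fun p hp => hl p (List.mem_cons_of_mem _ hp)
      simp only [List.map_cons, List.prod_cons]
      refine ⟨Subalgebra.mul_mem _ (Algebra.subset_adjoin ⟨i, rfl⟩) h1, ?_⟩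
      rw [mul_assoc, ev_gen_mul, h2]
      change opD ρ hR c _ _ = _
      rw [opD_single_of_mem_zeroPoly ρ hR h1, lin_single]
  have hone : ∀ l l₀ : List (Fin 2 × Fin N), (∀ p ∈ l, p.1 = 1) → (∀ p ∈ l₀, ¬ p.1 = 1) →
      A.ev ((l.map A.gen).prod * (l₀.map A.gen).prod * A.grp g) =
        Finsupp.single g ((l.map X).prod * (l₀.map X).prod) := by
    intro l l₀ hl hl₀
    induction l with
    | nil => simpa using (hzero l₀ hl₀).2
    | cons p l ih =>
      obtain ⟨α, i⟩ := p
      obtain rfl : α = 1 := hl (α, i) List.mem_cons_self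
      have h2 := ih fun p hp => hl p (List.mem_cons_of_mem _ hp)
      simp only [List.map_cons, List.prod_cons]
      rw [mul_assoc (A.gen _), mul_assoc (A.gen _), ev_gen_mul, h2]
      change opX R ρ _ _ = _
      rw [opX_single, lin_single, mul_assoc]
  rw [Realization.ordWord, hone]
  · congr 1
    rw [← List.prod_append, ← List.map_append]
    have := ((List.filter_append_perm (fun p : Fin 2 × Fin N => decide (p.1 = 1)) l).map
      (X : _ → MvPolynomial (Fin 2 × Fin N) K)).prod_eq
    simpa only [decide_not] using this
  · intro p hp; simpa using (List.mem_filter.1 hp).2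
  · intro p hp; simpa using (List.mem_filter.1 hp).2

/-- The inverse of `ev`. -/
def quant : Fock R K →ₗ[K] B :=
  Finsupp.lsum K fun g => (basisMonomials (Fin 2 × Fin N) K).constr K fun d =>
    A.ordWord (Finsupp.toMultiset d).toList * A.grp g

theorem quant_single_monomial (g : W R) (d : Fin 2 × Fin N →₀ ℕ) :
    A.quant (Finsupp.single g (monomial d 1)) =
      A.ordWord (Finsupp.toMultiset d).toList * A.grp g := by
  rw [quant, Finsupp.lsum_single]
  have := (basisMonomials (Fin 2 × Fin N) K).constr_basis K
    (fun d => A.ordWord (Finsupp.toMultiset d).toList * A.grp g) d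
  rwa [coe_basisMonomials] at this

theorem ev_quant (f : Fock R K) : A.ev (A.quant f) = f := by
  have : A.ev ∘ₗ A.quant = LinearMap.id := by
    apply fock_ext
    intro g p
    induction p using MvPolynomial.induction_on' with
    | monomial d r =>
      have h1 : (monomial d r : MvPolynomial (Fin 2 × Fin N) K) = r • monomial d 1 := by
        rw [smul_monomial, smul_eq_mul, mul_one]
      rw [h1, ← Finsupp.smul_single, map_smul, map_smul]
      congr 1
      rw [LinearMap.comp_apply, quant_single_monomial, ev_ordWord_mul_grp, prod_map_X_eq_monomial]
      simp
    | add p q hp hq => rw [Finsupp.single_add, map_add, map_add, hp, hq]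
  exact LinearMap.congr_fun this f

/-- Ordered words span the algebra, and on them the identity follows from `ev_ordWord_mul_grp`,
since an ordered word depends only on the multiset of its letters. -/
theorem quant_ev (b : B) : A.quant (A.ev b) = b := by
  have : b ∈ LinearMap.eqLocus (A.quant ∘ₗ A.ev) LinearMap.id := by
    refine A.generated.mem_of_ordWord_mem ?_ b
    intro l g
    change A.quant (A.ev _) = _
    rw [ev_ordWord_mul_grp, prod_map_X_eq_monomial, quant_single_monomial, LinearMap.id_apply]
    congr 1
    apply A.ordWord_eq_of_perm
    rw [Multiset.toFinsupp_toMultiset]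
    exact Multiset.coe_eq_coe.1 (Multiset.coe_toList _)
  exact this

end Model

end Calogero

end

noncomputable section

namespace Calogero

open MvPolynomial

/-! ### Boundaries in the Koszul complex of a family of operators. -/

section Boundary

variable {ι k S : Type*} [Fintype ι] [Field k] [AddCommGroup S] [Module k S]

/-- The `1`-chains of the Koszul complex of the operators `L i` that are boundaries. -/
def IsBoundary (L : ι → S →ₗ[k] S) (f : ι → S) : Prop :=
  ∃ g : ι → ι → S, (∀ i j, g i j = -g j i) ∧ ∀ j, f j = ∑ i, L i (g i j)

theorem IsBoundary.add {L : ι → S →ₗ[k] S} {f f' : ι → S} (h : IsBoundary L f)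
    (h' : IsBoundary L f') : IsBoundary L (f + f') := by
  obtain ⟨g, hg, hf⟩ := h
  obtain ⟨g', hg', hf'⟩ := h'
  refine ⟨g + g', fun i j => ?_, fun j => ?_⟩
  · simp only [Pi.add_apply, hg i j, hg' i j]; abel
  · simp [hf j, hf' j, Finset.sum_add_distrib]

theorem IsBoundary.smul {L : ι → S →ₗ[k] S} {f : ι → S} (r : k) (h : IsBoundary L f) :
    IsBoundary L (r • f) := by
  obtain ⟨g, hg, hf⟩ := h
  refine ⟨r • g, fun i j => ?_, fun j => ?_⟩
  · simp only [Pi.smul_apply, hg i j, smul_neg]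
  · simp [hf j, Finset.smul_sum]

/-- A double sum of the symmetric `L_j L_i` against an antisymmetric array equals its own negative.
-/
theorem IsBoundary.sum_eq_zero [CharZero k] {L : ι → S →ₗ[k] S}
    (hL : ∀ i j p, L i (L j p) = L j (L i p)) {f : ι → S} (h : IsBoundary L f) :
    ∑ j, L j (f j) = 0 := by
  obtain ⟨g, hg, hf⟩ := h
  have h1 : ∑ j, L j (f j) = ∑ j, ∑ i, L j (L i (g i j)) :=
    Finset.sum_congr rfl fun j _ => by rw [hf j, map_sum]
  have h2 : ∑ j, L j (f j) = -∑ j, L j (f j) := by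
    conv_lhs => rw [h1, Finset.sum_comm]
    rw [h1, ← Finset.sum_neg_distrib]
    refine Finset.sum_congr rfl fun i _ => ?_
    rw [← Finset.sum_neg_distrib]
    refine Finset.sum_congr rfl fun j _ => ?_
    rw [hL, hg i j, map_neg, map_neg]
  have h3 : (2 : k) • ∑ j, L j (f j) = 0 := by
    rw [two_smul]; exact add_eq_zero_iff_eq_neg.2 h2
  exact (smul_eq_zero.1 h3).resolve_left two_ne_zero

theorem IsBoundary.of_changeBasis [DecidableEq ι] {L L' : ι → S →ₗ[k] S} {P Q : ι → ι → k}
    (hQP : ∀ j l, ∑ i, Q j i * P i l = if j = l then 1 else 0)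
    (hL' : ∀ i, L' i = ∑ j, P i j • L j) {f : ι → S}
    (h : IsBoundary L' fun i => ∑ j, Q j i • f j) : IsBoundary L f := by
  obtain ⟨g, hg, hf⟩ := h
  refine ⟨fun m n => ∑ i, ∑ l, (P l m * P i n) • g l i, fun m n => ?_, fun n => ?_⟩
  · simp only
    rw [Finset.sum_comm, ← Finset.sum_neg_distrib]
    refine Finset.sum_congr rfl fun i _ => ?_
    rw [← Finset.sum_neg_distrib]
    refine Finset.sum_congr rfl fun l _ => ?_
    rw [hg i l, smul_neg, mul_comm]
  · have h1 : f n = ∑ i, P i n • ∑ j, Q j i • f j := by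
      simp only [Finset.smul_sum, smul_smul]
      rw [Finset.sum_comm]
      simp only [← Finset.sum_smul]
      rw [Finset.sum_eq_single n]
      · simp only [mul_comm (P _ _), hQP, if_true, one_smul]
      · intro j _ hj
        simp only [mul_comm (P _ _), hQP, if_neg hj, zero_smul]
      · simp
    rw [h1]
    simp only [map_sum, map_smul]
    rw [Finset.sum_comm]
    refine Finset.sum_congr rfl fun i _ => ?_
    have hfi := hf i
    simp only at hfi
    rw [hfi, Finset.smul_sum, Finset.sum_comm]
    refine Finset.sum_congr rfl fun l _ => ?_
    rw [hL' l, LinearMap.sum_apply, Finset.smul_sum]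
    refine Finset.sum_congr rfl fun m _ => ?_
    rw [LinearMap.smul_apply, smul_smul, mul_comm]

theorem sum_changeBasis [DecidableEq ι] {L L' : ι → S →ₗ[k] S} {P Q : ι → ι → k}
    (hQP : ∀ j l, ∑ i, Q j i * P i l = if j = l then 1 else 0)
    (hL' : ∀ i, L' i = ∑ j, P i j • L j) (f : ι → S) :
    ∑ i, L' i (∑ j, Q j i • f j) = ∑ j, L j (f j) := by
  simp only [map_sum, map_smul]
  rw [Finset.sum_comm]
  refine Finset.sum_congr rfl fun j _ => ?_
  simp only [hL', LinearMap.sum_apply, LinearMap.smul_apply, Finset.smul_sum, smul_smul]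
  rw [Finset.sum_comm]
  simp only [← Finset.sum_smul, hQP]
  simp

/-- Cycles are boundaries if two of the operators have right inverses compatible with the other
operators. -/
theorem isBoundary_of_rightInverse [DecidableEq ι] {L : ι → S →ₗ[k] S} {p q : ι} (hpq : p ≠ q)
    (hp : ∀ F : Finset S, ∃ J : S →ₗ[k] S, (∀ i ≠ p, ∀ f, J (L i f) = L i (J f)) ∧
      ∀ f ∈ F, L p (J f) = f)
    (hq : ∀ f, ∃ J : S →ₗ[k] S, (∀ f, J (L p f) = L p (J f)) ∧ L q (J f) = f)
    {f : ι → S} (hf : ∑ i, L i (f i) = 0) : IsBoundary L f := by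
  classical
  -- `J` inverts `L p` only on a prescribed finite set; the entries of `f` and `L p (f p)` are all
  -- that is needed.
  obtain ⟨J, hJ, hJf⟩ := hp (insert (L p (f p)) (Finset.univ.image f))
  set h : S := f p - J (L p (f p)) with hh
  have hLh : L p h = 0 := by
    rw [hh, map_sub, hJf _ (Finset.mem_insert_self _ _), sub_self]
  have hfJ : ∀ j, L p (J (f j)) = f j := fun j =>
    hJf _ (Finset.mem_insert_of_mem (Finset.mem_image_of_mem f (Finset.mem_univ j)))
  obtain ⟨J', hJ', hJ'h⟩ := hq h
  -- The array with entries `J (f j)` at `(p, j)`, antisymmetrized, has boundary `f` away from `p`.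
  -- At `p` the cycle condition and the commutation of `J` with the other operators give `J (L p (f
  -- p))`.
  have b1 : IsBoundary L (f - Pi.single p h) := by
    refine ⟨fun i j => (if i = p then J (f j) else 0) - (if j = p then J (f i) else 0),
      fun i j => (neg_sub _ _).symm, fun j => ?_⟩
    simp only [map_sub, Finset.sum_sub_distrib, apply_ite (L _), map_zero]
    rw [Finset.sum_ite_eq' Finset.univ p]
    simp only [Finset.mem_univ, if_true, Pi.sub_apply]
    by_cases hj : j = p
    · subst hj
      simp only [if_true, Pi.single_eq_same]
      have h1 : ∑ i, L i (J (f i)) = L j (J (f j)) + ∑ i ∈ Finset.univ.erase j, L i (J (f i)) :=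
        (Finset.add_sum_erase _ _ (Finset.mem_univ j)).symm
      have h2 : ∑ i ∈ Finset.univ.erase j, L i (J (f i)) =
          J (∑ i ∈ Finset.univ.erase j, L i (f i)) := by
        rw [map_sum]
        exact Finset.sum_congr rfl fun i hi => (hJ i (Finset.ne_of_mem_erase hi) _).symm
      have h3 : ∑ i ∈ Finset.univ.erase j, L i (f i) = -L j (f j) := by
        rw [← Finset.add_sum_erase _ _ (Finset.mem_univ j)] at hf
        exact eq_neg_of_add_eq_zero_right hf
      rw [h1, h2, h3, map_neg, hh]
      abel
    · simp [hj, hfJ]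
  -- The remaining entry `h` is `L q (J' h)`, and `L p (J' h) = J' (L p h) = 0`, so one
  -- antisymmetric pair of entries suffices.
  have b2 : IsBoundary L (Pi.single p h) := by
    refine ⟨fun i j => (if i = q ∧ j = p then J' h else 0) - (if j = q ∧ i = p then J' h else 0),
      fun i j => (neg_sub _ _).symm, fun j => ?_⟩
    simp only [map_sub, Finset.sum_sub_distrib, apply_ite (L _), map_zero, ite_and]
    rw [Finset.sum_ite_eq' Finset.univ q]
    by_cases hj : j = p
    · subst hj
      simp [hJ'h, hpq]
    · by_cases hj2 : j = q
      · subst hj2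
        have : L p (J' h) = 0 := by rw [← hJ', hLh, map_zero]
        simp [hj, this]
      · simp [hj, hj2]
  have := b1.add b2
  rwa [sub_add_cancel] at this

end Boundary

/-! ### Formal integration in an algebra with `[D, y] = 1`. -/

section Antiderivative

variable {k E : Type*} [Field k] [Ring E] [Algebra k E]

/-- A partial sum of the right inverse of `D` built from `y` with `[D, y] = 1`. -/
def antideriv (k : Type*) [Field k] {E : Type*} [Ring E] [Algebra k E] (D y : E) (n : ℕ) : E :=
  ∑ m ∈ Finset.range n, ((-1) ^ m * ((m + 1).factorial : k)⁻¹) • (y ^ (m + 1) * D ^ m)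

theorem mul_pow_of_commutator_eq_one {D y : E} (h : D * y = y * D + 1) (m : ℕ) :
    D * y ^ m = y ^ m * D + (m : k) • y ^ (m - 1) := by
  induction m with
  | zero => simp
  | succ m ih =>
    rw [pow_succ, ← mul_assoc, ih, add_mul, mul_assoc, h, mul_add, smul_mul_assoc]
    rcases m with _ | m
    · simp
    · simp only [Nat.add_sub_cancel, ← pow_succ, Nat.cast_add, Nat.cast_one, add_smul, one_smul]
      noncomm_ring

/-- The sum telescopes: differentiating each `y^(m+1) D^m` gives two terms, one cancelling against
its neighbour. Where `D^n` vanishes, a right inverse of `D` results. -/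
theorem mul_antideriv [CharZero k] {D y : E} (h : D * y = y * D + 1) (n : ℕ) :
    D * antideriv k D y n = 1 - ((-1) ^ n * (n.factorial : k)⁻¹) • (y ^ n * D ^ n) := by
  induction n with
  | zero => simp [antideriv]
  | succ n ih =>
    rw [antideriv, Finset.sum_range_succ, ← antideriv, mul_add, ih, mul_smul_comm, ← mul_assoc,
      mul_pow_of_commutator_eq_one (k := k) h, add_mul, smul_mul_assoc, Nat.add_sub_cancel,
      mul_assoc (y ^ (n + 1)), ← pow_succ', smul_add, smul_smul]
    have h1 : (-1 : k) ^ n * ((n + 1).factorial : k)⁻¹ * ((n + 1 : ℕ) : k) =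
        (-1) ^ n * (n.factorial : k)⁻¹ := by
      rw [Nat.factorial_succ, Nat.cast_mul, mul_inv, mul_assoc, mul_comm (_ * _) ((n + 1 : ℕ) : k),
        ← mul_assoc ((n + 1 : ℕ) : k), mul_inv_cancel₀ (Nat.cast_ne_zero.2 n.succ_ne_zero),
        one_mul]
    rw [h1, pow_succ (-1 : k), mul_neg_one, neg_mul, neg_smul]
    abel

theorem commute_antideriv {D y z : E} (hD : Commute z D) (hy : Commute z y) (n : ℕ) :
    Commute z (antideriv k D y n) :=
  Commute.sum_right _ _ _ fun _ _ => ((hy.pow_right _).mul_right (hD.pow_right _)).smul_right _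

end Antiderivative

/-! ### A Poincaré lemma for polynomials. -/

section Derivations

variable {ι k : Type*} [Field k]

/-- Derivations with constant coefficients are locally nilpotent. -/
theorem exists_pow_apply_eq_zero (D : Derivation k (MvPolynomial ι k) (MvPolynomial ι k))
    (hD : ∀ i, ∃ r, D (X i) = C r) (f : MvPolynomial ι k) :
    ∃ n, ∀ m ≥ n, (D.toLinearMap ^ m) f = 0 := by
  induction f using MvPolynomial.induction_on with
  | C a =>
    refine ⟨1, fun m hm => ?_⟩
    obtain ⟨m, rfl⟩ := Nat.exists_eq_add_of_le' hm
    rw [pow_succ, Module.End.mul_apply]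
    have : D.toLinearMap (C a) = 0 := by
      rw [← algebraMap_eq]; exact D.map_algebraMap a
    rw [this, map_zero]
  | add p q hp hq =>
    obtain ⟨n, hn⟩ := hp
    obtain ⟨n', hn'⟩ := hq
    exact ⟨max n n', fun m hm => by
      rw [map_add, hn m (le_trans (le_max_left _ _) hm), hn' m (le_trans (le_max_right _ _) hm),
        add_zero]⟩
  | mul_X p i hp =>
    obtain ⟨n, hn⟩ := hp
    obtain ⟨r, hr⟩ := hD i
    have key : ∀ m : ℕ, (D.toLinearMap ^ (m + 1)) (p * X i) =
        X i * (D.toLinearMap ^ (m + 1)) p +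
          (((m + 1 : ℕ) : k) * r) • (D.toLinearMap ^ m) p := by
      intro m
      induction m with
      | zero =>
        simp [Derivation.leibniz, hr, smul_eq_C_mul]
        ring
      | succ m ih =>
        rw [pow_succ' _ (m + 1), Module.End.mul_apply, ih, map_add, map_smul, ← Module.End.mul_apply,
          ← pow_succ' _ m]
        have : ∀ q, D.toLinearMap (X i * q) =
            X i * D q + r • q := by
          intro q
          simp [Derivation.leibniz, hr, smul_eq_C_mul]
          ring
        rw [this, Module.End.mul_apply]
        simp only [smul_eq_C_mul, map_mul, map_add, map_natCast, map_one, Nat.cast_add,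
          Nat.cast_one, Derivation.coeFn_coe]
        ring
    refine ⟨n + 1, fun m hm => ?_⟩
    obtain ⟨m, rfl⟩ : ∃ l, m = l + 1 := ⟨m - 1, by omega⟩
    rw [key, hn _ (by omega), hn _ (by omega)]
    simp

/-- Polynomials of degree less than `n`. -/
def degLT (ι k : Type*) [Field k] (n : ℕ) : Submodule k (MvPolynomial ι k) :=
  Submodule.span k ((fun d => monomial d 1) '' {d : ι →₀ ℕ | d.degree < n})

theorem degLT_mono {m n : ℕ} (h : m ≤ n) : degLT ι k m ≤ degLT ι k n :=
  Submodule.span_mono (Set.image_mono fun _ hd => lt_of_lt_of_le hd h)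

theorem monomial_mem_degLT {n : ℕ} {d : ι →₀ ℕ} (hd : d.degree < n) (r : k) :
    monomial d r ∈ degLT ι k n := by
  have : (monomial d r : MvPolynomial ι k) = r • monomial d 1 := by
    rw [smul_monomial, smul_eq_mul, mul_one]
  rw [this]
  exact Submodule.smul_mem _ _ (Submodule.subset_span ⟨d, hd, rfl⟩)

theorem degLT_zero : degLT ι k 0 = ⊥ := by simp [degLT]

theorem exists_mem_degLT (f : MvPolynomial ι k) : ∃ n, f ∈ degLT ι k n := by
  induction f using MvPolynomial.induction_on' with
  | monomial d r => exact ⟨d.degree + 1, monomial_mem_degLT (by omega) r⟩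
  | add p q hp hq =>
    obtain ⟨n, hn⟩ := hp
    obtain ⟨n', hn'⟩ := hq
    exact ⟨max n n', Submodule.add_mem _ (degLT_mono (le_max_left _ _) hn)
      (degLT_mono (le_max_right _ _) hn')⟩

theorem pderiv_mem_degLT {n : ℕ} (i : ι) {f : MvPolynomial ι k} (hf : f ∈ degLT ι k (n + 1)) :
    pderiv i f ∈ degLT ι k n := by
  have : degLT ι k (n + 1) ≤ (degLT ι k n).comap (pderiv (R := k) i).toLinearMap := by
    rw [degLT, Submodule.span_le]
    rintro _ ⟨d, hd, rfl⟩
    simp only [Submodule.comap_coe, Set.mem_preimage, SetLike.mem_coe, Derivation.coeFn_coe,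
      pderiv_monomial, one_mul]
    by_cases h : d i = 0
    · simp [h]
    · apply monomial_mem_degLT
      have h1 : Finsupp.single i 1 ≤ d := by
        classical
        rw [Finsupp.single_le_iff]; omega
      have h2 := congrArg Finsupp.degree (tsub_add_cancel_of_le h1)
      rw [map_add, Finsupp.degree_single] at h2
      have h3 : d.degree < n + 1 := hd
      omega
  exact this hf

/-- Euler's formula: `∑ X_i ∂_i` is multiplication by `n` on the part of degree `n`. -/
theorem sub_euler_mem_degLT [Fintype ι] {n : ℕ} {f : MvPolynomial ι k}
    (hf : f ∈ degLT ι k (n + 1)) :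
    (n : k) • f - ∑ i, X i * pderiv i f ∈ degLT ι k n := by
  let T : MvPolynomial ι k →ₗ[k] MvPolynomial ι k := (n : k) • LinearMap.id -
    ∑ i, LinearMap.mulLeft k (X i) ∘ₗ (pderiv (R := k) i).toLinearMap
  have hT : ∀ f, T f = (n : k) • f - ∑ i, X i * pderiv i f := fun f => by
    simp [T, LinearMap.sum_apply]
  rw [← hT]
  have : degLT ι k (n + 1) ≤ (degLT ι k n).comap T := by
    rw [degLT, Submodule.span_le]
    rintro _ ⟨d, hd, rfl⟩
    simp only [Submodule.comap_coe, Set.mem_preimage, SetLike.mem_coe]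
    have h1 : ∀ i, X i * pderiv i (monomial d (1 : k)) = (d i : k) • monomial d 1 := by
      intro i
      rw [X_mul_pderiv_monomial, Nat.cast_smul_eq_nsmul]
    rw [hT]
    simp only [h1]
    rw [← Finset.sum_smul, ← sub_smul, ← Nat.cast_sum, ← Finsupp.degree_eq_sum]
    have hd' : d.degree < n + 1 := hd
    rcases Nat.lt_succ_iff_lt_or_eq.1 hd' with h | h
    · exact Submodule.smul_mem _ _ (monomial_mem_degLT h 1)
    · simp [h]
  exact this hf

/-- Exactness of the Koszul complex for perturbed multiplications by the variables. -/
theorem isBoundary_of_pderiv_eq_zero [Fintype ι] [CharZero k]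
    {L : ι → MvPolynomial ι k →ₗ[k] MvPolynomial ι k} {a : ι → ι → k}
    (hL : ∀ i f, L i f = X i * f + ∑ j, a i j • pderiv j f)
    (hcomm : ∀ i j p, L i (L j p) = L j (L i p)) {f : ι → MvPolynomial ι k}
    (hf : ∀ j, pderiv j (∑ i, L i (f i)) = 0) : IsBoundary L f := by
  classical
  have hpc : ∀ i j (p : MvPolynomial ι k), pderiv i (pderiv j p) = pderiv j (pderiv i p) := by
    intro i j p
    have : ⁅pderiv (R := k) (σ := ι) i, pderiv (R := k) j⁆ = 0 := by
      apply MvPolynomial.derivation_ext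
      intro l
      rw [Derivation.commutator_apply, pderiv_X, pderiv_X]
      simp only [Pi.single_apply]
      split_ifs <;> simp
    have h := DFunLike.congr_fun this p
    rw [Derivation.commutator_apply] at h
    simpa [sub_eq_zero] using h
  have hdL : ∀ j i p, pderiv j (L i p) = L i (pderiv j p) + if i = j then p else 0 := by
    intro j i p
    rw [hL, hL, map_add, Derivation.leibniz, map_sum, pderiv_X, Pi.single_apply]
    simp only [Derivation.map_smul, hpc j]
    by_cases h : i = j
    · subst h; simp; abel
    · simp [h]
  have key : ∀ n (f : ι → MvPolynomial ι k), (∀ j, f j ∈ degLT ι k n) →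
      (∀ j, pderiv j (∑ i, L i (f i)) = 0) → IsBoundary L f := by
    intro n
    induction n with
    | zero =>
      intro f hn _
      refine ⟨0, by simp, fun j => ?_⟩
      have := hn j
      rw [degLT_zero, Submodule.mem_bot] at this
      simp [this]
    | succ n ih =>
      intro f hn hf
      -- The boundary of the exterior derivative of `f`. As `[∂_j, L_i] = δ_ij`, the hypothesis on
      -- `f` turns it into `e_j = f_j + ∑ L_i ∂_i f_j`. Euler's formula makes this `(n + 1) f_j` up
      -- to lower degree, and the derivative terms of `L_i` also lower the degree.
      set e : ι → MvPolynomial ι k := fun j => ∑ i, L i (pderiv i (f j) - pderiv j (f i)) with he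
      have hb : IsBoundary L e := ⟨fun i j => pderiv i (f j) - pderiv j (f i),
        fun i j => (neg_sub _ _).symm, fun j => rfl⟩
      have he2 : ∀ j, e j = ∑ i, L i (pderiv i (f j)) + f j := by
        intro j
        have h1 := hf j
        rw [map_sum] at h1
        simp only [hdL, Finset.sum_add_distrib, Finset.sum_ite_eq', Finset.mem_univ,
          if_true] at h1
        simp only [he, map_sub, Finset.sum_sub_distrib]
        rw [sub_eq_add_neg, neg_eq_of_add_eq_zero_right h1]
      have hlow : IsBoundary L (((n : k) + 1) • f - e) := by
        apply ih
        · intro j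
          have h1 : (((n : k) + 1) • f - e) j =
              ((n : k) • f j - ∑ i, X i * pderiv i (f j)) -
                ∑ i, ∑ l, a i l • pderiv l (pderiv i (f j)) := by
            rw [Pi.sub_apply, Pi.smul_apply, he2, add_smul, one_smul]
            simp only [hL, Finset.sum_add_distrib]
            abel
          rw [h1]
          refine Submodule.sub_mem _ (sub_euler_mem_degLT (hn j)) ?_
          refine Submodule.sum_mem _ fun i _ => Submodule.sum_mem _ fun l _ =>
            Submodule.smul_mem _ _ (pderiv_mem_degLT l ?_)
          exact degLT_mono (Nat.le_succ n) (pderiv_mem_degLT i (hn j))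
        · intro j
          have h1 := hb.sum_eq_zero hcomm
          simp only [Pi.sub_apply, Pi.smul_apply, map_sub, map_smul, Finset.sum_sub_distrib, h1,
            sub_zero, ← Finset.smul_sum]
          rw [Derivation.map_smul, hf j, smul_zero]
      have h2 := (hlow.add hb).smul ((n : k) + 1)⁻¹
      rwa [sub_add_cancel, smul_smul, inv_mul_cancel₀ (Nat.cast_add_one_ne_zero n),
        one_smul] at h2
  choose m hm using fun j => exists_mem_degLT (f j)
  exact key (∑ j, m j) f (fun j => degLT_mono
    (Finset.single_le_sum (fun _ _ => Nat.zero_le _) (Finset.mem_univ j)) (hm j)) hf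

end Derivations

end Calogero

end

/-! ### Twisted commutators at vanishing coupling, sector by sector. -/

noncomputable section

namespace Calogero

open MvPolynomial

variable {N : ℕ}

section Ring

variable {K : Type*} [CommRing K] (ρ : ℝ →+* K) (σ : ℤˣ) (g : Vec N ≃ₗᵢ[ℝ] Vec N)

/-- The derivation part of `twComm`. -/
def twDer (α : Fin 2) (x : Vec N) :
    Derivation K (MvPolynomial (Fin 2 × Fin N) K) (MvPolynomial (Fin 2 × Fin N) K) :=
  if α = 0 then pd ρ 1 x else -((σ : ℤ) : K) • pd ρ 0 (g x)

/-- The twisted commutator with `x_α` on the sector of `g`, for vanishing coupling constants. -/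
def twComm (α : Fin 2) (x : Vec N) :
    MvPolynomial (Fin 2 × Fin N) K →ₗ[K] MvPolynomial (Fin 2 × Fin N) K :=
  LinearMap.mulLeft K (lin ρ α (x - ((σ : ℤ) : ℝ) • g x)) + (twDer ρ σ g α x).toLinearMap

theorem twComm_apply (α : Fin 2) (x : Vec N) (p : MvPolynomial (Fin 2 × Fin N) K) :
    twComm ρ σ g α x p = lin ρ α (x - ((σ : ℤ) : ℝ) • g x) * p + twDer ρ σ g α x p := by
  simp [twComm]

theorem twDer_zero (x : Vec N) : twDer (K := K) ρ σ g 0 x = pd ρ 1 x := rfl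

theorem twDer_one_apply (x : Vec N) (p : MvPolynomial (Fin 2 × Fin N) K) :
    twDer (K := K) ρ σ g 1 x p = -((σ : ℤ) : K) • pd ρ 0 (g x) p := rfl

theorem twDer_add (α : Fin 2) (x y : Vec N) (p : MvPolynomial (Fin 2 × Fin N) K) :
    twDer ρ σ g α (x + y) p = twDer ρ σ g α x p + twDer ρ σ g α y p := by
  fin_cases α
  · exact pd_add_left ρ 1 x y p
  · simp only [Fin.mk_one, twDer_one_apply, map_add, pd_add_left, smul_add]

theorem twDer_smul (α : Fin 2) (r : ℝ) (x : Vec N) (p : MvPolynomial (Fin 2 × Fin N) K) :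
    twDer ρ σ g α (r • x) p = ρ r • twDer ρ σ g α x p := by
  fin_cases α
  · exact pd_smul_left ρ 1 r x p
  · simp only [Fin.mk_one, twDer_one_apply, map_smul, pd_smul_left]
    rw [smul_comm]

theorem twComm_add (α : Fin 2) (x y : Vec N) :
    twComm (K := K) ρ σ g α (x + y) = twComm ρ σ g α x + twComm ρ σ g α y := by
  apply LinearMap.ext
  intro p
  rw [LinearMap.add_apply, twComm_apply, twComm_apply, twComm_apply, twDer_add, map_add, smul_add,
    add_sub_add_comm, lin_add]
  ring

theorem twComm_smul (α : Fin 2) (r : ℝ) (x : Vec N) :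
    twComm (K := K) ρ σ g α (r • x) = ρ r • twComm ρ σ g α x := by
  apply LinearMap.ext
  intro p
  rw [LinearMap.smul_apply, twComm_apply, twComm_apply, twDer_smul, map_smul,
    smul_comm _ r, ← smul_sub, lin_smul, smul_mul_assoc, smul_add]

theorem twComm_eq_sum (α : Fin 2) (x : Vec N) :
    twComm (K := K) ρ σ g α x =
      ∑ i, ρ (x i) • twComm ρ σ g α (EuclideanSpace.single i 1) := by
  let T : Vec N →+ (MvPolynomial (Fin 2 × Fin N) K →ₗ[K] MvPolynomial (Fin 2 × Fin N) K) :=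
    AddMonoidHom.mk' (twComm ρ σ g α) (twComm_add ρ σ g α)
  change T x = _
  conv_lhs => rw [vec_eq_sum x]
  rw [map_sum]
  exact Finset.sum_congr rfl fun i _ => twComm_smul ρ σ g α _ _

theorem twDer_lin (α β : Fin 2) (x y : Vec N) :
    twDer ρ σ g α x (lin ρ β y) = if α = β then 0 else
      if α = 0 then C (ρ ⟪x, y⟫) else C (ρ (-((σ : ℤ) : ℝ) * ⟪g x, y⟫)) := by
  fin_cases α <;> fin_cases β <;> simp [twDer_zero, twDer_one_apply, pd_lin, smul_eq_C_mul]

theorem twDer_comm (α β : Fin 2) (x y : Vec N) (p : MvPolynomial (Fin 2 × Fin N) K) :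
    twDer ρ σ g α x (twDer ρ σ g β y p) = twDer ρ σ g β y (twDer ρ σ g α x p) := by
  fin_cases α <;> fin_cases β
  · exact pd_comm ρ 1 1 x y p
  · change pd ρ 1 x (-((σ : ℤ) : K) • pd ρ 0 (g y) p) = -((σ : ℤ) : K) • pd ρ 0 (g y) (pd ρ 1 x p)
    rw [Derivation.map_smul, pd_comm]
  · change -((σ : ℤ) : K) • pd ρ 0 (g x) (pd ρ 1 y p) = pd ρ 1 y (-((σ : ℤ) : K) • pd ρ 0 (g x) p)
    rw [Derivation.map_smul, pd_comm]
  · change -((σ : ℤ) : K) • pd ρ 0 (g x) (-((σ : ℤ) : K) • pd ρ 0 (g y) p) =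
      -((σ : ℤ) : K) • pd ρ 0 (g y) (-((σ : ℤ) : K) • pd ρ 0 (g x) p)
    rw [Derivation.map_smul, Derivation.map_smul, pd_comm]

/-- The derivations commute, and each differentiates the other's linear factor to the same constant,
because `g` is orthogonal and `σ² = 1`. -/
theorem twComm_comm (α β : Fin 2) (x y : Vec N) (p : MvPolynomial (Fin 2 × Fin N) K) :
    twComm ρ σ g α x (twComm ρ σ g β y p) = twComm ρ σ g β y (twComm ρ σ g α x p) := by
  have h : twDer ρ σ g α x (lin ρ β (y - ((σ : ℤ) : ℝ) • g y)) =
      twDer ρ σ g β y (lin ρ α (x - ((σ : ℤ) : ℝ) • g x)) := by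
    have hs := sign_mul_self σ
    have key : ∀ x y : Vec N, ⟪x, y - ((σ : ℤ) : ℝ) • g y⟫ =
        -((σ : ℤ) : ℝ) * ⟪g y, x - ((σ : ℤ) : ℝ) • g x⟫ := by
      intro x y
      simp only [inner_sub_right, inner_smul_right, LinearIsometryEquiv.inner_map_map]
      rw [real_inner_comm (g y) x, real_inner_comm x y]
      linear_combination (-⟪x, y⟫) * hs
    rw [twDer_lin, twDer_lin]
    fin_cases α <;> fin_cases β
    · rfl
    · exact congrArg (fun r => C (ρ r)) (key x y)
    · exact congrArg (fun r => C (ρ r)) (key y x).symm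
    · rfl
  simp only [twComm_apply, map_add, Derivation.leibniz, smul_eq_mul, twDer_comm ρ σ g α β, h]
  ring

theorem twComm_X (i : Fin N) (α : Fin 2) (x : Vec N)
    (hx : x - ((σ : ℤ) : ℝ) • g x = EuclideanSpace.single i 1)
    (p : MvPolynomial (Fin 2 × Fin N) K) :
    twComm ρ σ g α x p = X (α, i) * p + twDer ρ σ g α x p := by
  rw [twComm_apply, hx, lin_single]

theorem twDer_eq_sum (α : Fin 2) (x : Vec N) (p : MvPolynomial (Fin 2 × Fin N) K) :
    twDer ρ σ g α x p = ∑ J : Fin 2 × Fin N,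
      (if α = J.1 then 0 else if α = 0 then ρ (x J.2) else -((σ : ℤ) : K) * ρ (g x J.2)) •
        pderiv J p := by
  rw [Fintype.sum_prod_type, Fin.sum_univ_two]
  fin_cases α
  · simp [twDer_zero, pd_apply]
  · simp [twDer_one_apply, pd_apply, Finset.smul_sum, mul_smul]

end Ring

section Field

variable {k : Type*} [Field k] (ρ : ℝ →+* k) {σ : ℤˣ} {g : Vec N ≃ₗᵢ[ℝ] Vec N}

theorem sum_repr_mul (b : Module.Basis (Fin N) ℝ (Vec N)) (j l : Fin N) :
    ∑ i, b.repr (EuclideanSpace.single j 1) i * (b i) l = if j = l then 1 else 0 := by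
  have h := congrArg (fun x : Vec N => x l) (b.sum_repr (EuclideanSpace.single j 1))
  simp only [WithLp.ofLp_sum, Finset.sum_apply, PiLp.smul_apply, smul_eq_mul] at h
  rw [h]
  simp [eq_comm]

/-- The choice of a basis of the vector space does not matter for exactness. -/
theorem isBoundary_twComm_of_basis (b : Module.Basis (Fin N) ℝ (Vec N))
    {f : Fin 2 × Fin N → MvPolynomial (Fin 2 × Fin N) k}
    (h : ∀ f' : Fin 2 × Fin N → MvPolynomial (Fin 2 × Fin N) k,
      ∑ I, twComm ρ σ g I.1 (b I.2) (f' I) =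
        ∑ I, twComm ρ σ g I.1 (EuclideanSpace.single I.2 1) (f I) →
      IsBoundary (fun I : Fin 2 × Fin N => twComm ρ σ g I.1 (b I.2)) f') :
    IsBoundary (fun I : Fin 2 × Fin N => twComm ρ σ g I.1 (EuclideanSpace.single I.2 1)) f := by
  let P : Fin 2 × Fin N → Fin 2 × Fin N → k := fun I J =>
    if I.1 = J.1 then ρ (b I.2 J.2) else 0
  let Q : Fin 2 × Fin N → Fin 2 × Fin N → k := fun J I =>
    if J.1 = I.1 then ρ (b.repr (EuclideanSpace.single J.2 1) I.2) else 0
  have hQP : ∀ J L, ∑ I, Q J I * P I L = if J = L then 1 else 0 := by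
    rintro ⟨α, j⟩ ⟨β, l⟩
    rw [Fintype.sum_prod_type]
    have h1 : ∀ γ : Fin 2, ∑ i, Q (α, j) (γ, i) * P (γ, i) (β, l) =
        if α = γ then if γ = β then if j = l then 1 else 0 else 0 else 0 := by
      intro γ
      simp only [P, Q]
      split_ifs with h1 h2 h3 h4
      · have := congrArg ρ (sum_repr_mul b j l)
        rw [if_pos h3, map_sum] at this
        simpa using this
      · have := congrArg ρ (sum_repr_mul b j l)
        rw [if_neg h3, map_sum] at this
        simpa using this
      · simp
      · simp
      · simp
    simp only [h1, Finset.sum_ite_eq, Finset.mem_univ, if_true, Prod.mk.injEq]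
    split_ifs <;> simp_all
  have hL : ∀ I : Fin 2 × Fin N, twComm ρ σ g I.1 (b I.2) =
      ∑ J : Fin 2 × Fin N, P I J • twComm ρ σ g J.1 (EuclideanSpace.single J.2 1) := by
    rintro ⟨α, i⟩
    rw [Fintype.sum_prod_type, Finset.sum_eq_single α]
    · simp only [P, if_true]
      exact twComm_eq_sum ρ σ g α (b i)
    · intro β _ hβ
      simp [P, Ne.symm hβ]
    · simp
  exact IsBoundary.of_changeBasis hQP hL (h _ (sum_changeBasis hQP hL f))

theorem commutator_pd_mulLeft (α : Fin 2) {x : Vec N} (hx : ⟪x, x⟫ = 1) :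
    ((pd ρ α x).toLinearMap * LinearMap.mulLeft k (lin ρ α x) :
      Module.End k (MvPolynomial (Fin 2 × Fin N) k)) =
      LinearMap.mulLeft k (lin ρ α x) * (pd ρ α x).toLinearMap + 1 := by
  apply LinearMap.ext
  intro p
  have h : pd (K := k) ρ α x (lin ρ α x) = 1 := by simp only [pd_lin, hx, if_true, map_one]
  simp [Module.End.mul_apply, h, add_comm]

variable [CharZero k]

/-- Here `1 - σ g` is invertible. In the basis it maps to the standard one, the operators are
multiplications by the variables plus constant-coefficient derivatives, so the Poincaré lemma
applies. -/
theorem pderiv_eq_zero_isBoundary_twComm (hg : signFix σ g = ⊥)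
    {f : Fin 2 × Fin N → MvPolynomial (Fin 2 × Fin N) k}
    (hf : ∀ J, pderiv J (∑ I, twComm ρ σ g I.1 (EuclideanSpace.single I.2 1) (f I)) = 0) :
    IsBoundary (fun I : Fin 2 × Fin N => twComm ρ σ g I.1 (EuclideanSpace.single I.2 1)) f := by
  let T : Vec N →ₗ[ℝ] Vec N :=
    LinearMap.id - ((σ : ℤ) : ℝ) • (g.toLinearEquiv : Vec N →ₗ[ℝ] Vec N)
  have hT : ∀ y, T y = y - ((σ : ℤ) : ℝ) • g y := fun y => rfl
  have hinj : Function.Injective T := by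
    rw [← LinearMap.ker_eq_bot, LinearMap.ker_eq_bot']
    intro z hz
    rw [hT, sub_eq_zero] at hz
    have : z ∈ signFix σ g := by
      rw [mem_signFix]
      conv_rhs => rw [hz, sign_smul_sign_smul]
    rwa [hg, Submodule.mem_bot] at this
  let e := LinearEquiv.ofInjectiveEndo T hinj
  let b : Module.Basis (Fin N) ℝ (Vec N) :=
    (EuclideanSpace.basisFun (Fin N) ℝ).toBasis.map e.symm
  have hb : ∀ i, b i - ((σ : ℤ) : ℝ) • g (b i) = EuclideanSpace.single i 1 := by
    intro i
    have h1 : b i = e.symm (EuclideanSpace.single i 1) := by simp [b]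
    have h2 : T (b i) = e (b i) := rfl
    rw [← hT, h2, h1, LinearEquiv.apply_symm_apply]
  refine isBoundary_twComm_of_basis ρ b fun f' hf' => ?_
  refine isBoundary_of_pderiv_eq_zero
    (a := fun I J => if I.1 = J.1 then 0 else if I.1 = 0 then ρ (b I.2 J.2) else
      -((σ : ℤ) : k) * ρ (g (b I.2) J.2)) (fun I p => ?_) (fun I J p => twComm_comm ρ σ g _ _ _ _ p)
    fun J => ?_
  · rw [twComm_X ρ σ g I.2 _ _ (hb I.2), twDer_eq_sum]
  · rw [hf', hf J]

/-- The exactness statement only needs the image of `f` to have zero derivatives. So a chain with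
constant image is a boundary, and its image is zero. This separates the class sums at vanishing
coupling. -/
theorem eq_zero_of_sum_twComm_eq_C (hg : signFix σ g = ⊥)
    {f : Fin 2 × Fin N → MvPolynomial (Fin 2 × Fin N) k} {r : k}
    (hf : ∑ I, twComm ρ σ g I.1 (EuclideanSpace.single I.2 1) (f I) = C r) : r = 0 := by
  have h := pderiv_eq_zero_isBoundary_twComm ρ hg (f := f) (fun J => by rw [hf, pderiv_C])
  have h2 := h.sum_eq_zero (fun I J p => twComm_comm ρ σ g _ _ _ _ p)
  rw [h2] at hf
  exact ((C_eq_zero).1 hf.symm)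

/-- A partial sum of the formal antiderivative, long enough for the finite set `F`. Being built from
`∂_x` and multiplication by `x_α`, it commutes with whatever commutes with these. -/
theorem exists_pd_antideriv (α : Fin 2) {x : Vec N} (hx : ⟪x, x⟫ = 1)
    (F : Finset (MvPolynomial (Fin 2 × Fin N) k)) :
    ∃ J : Module.End k (MvPolynomial (Fin 2 × Fin N) k), (∀ f ∈ F, pd ρ α x (J f) = f) ∧
      ∀ T : Module.End k (MvPolynomial (Fin 2 × Fin N) k),
        (∀ p, T (pd ρ α x p) = pd ρ α x (T p)) → (∀ p, T (lin ρ α x * p) = lin ρ α x * T p) →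
        ∀ p, J (T p) = T (J p) := by
  choose n hn using exists_pow_apply_eq_zero (pd (K := k) ρ α x) (fun I => by
    obtain ⟨β, i⟩ := I
    rw [pd_X]
    split_ifs
    · exact ⟨_, rfl⟩
    · exact ⟨0, by simp⟩)
  let m := F.sup n
  refine ⟨antideriv k (pd ρ α x).toLinearMap (LinearMap.mulLeft k (lin ρ α x)) m,
    fun f hf => ?_, fun T h1 h2 p => ?_⟩
  · have h := LinearMap.congr_fun (mul_antideriv (k := k) (commutator_pd_mulLeft ρ α hx) m) f
    rw [LinearMap.sub_apply, LinearMap.smul_apply, Module.End.mul_apply, Module.End.mul_apply,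
      hn f m (Finset.le_sup hf), map_zero, smul_zero, sub_zero, Module.End.one_apply] at h
    exact h
  · have hc1 : Commute T (pd ρ α x).toLinearMap := LinearMap.ext h1
    have hc2 : Commute T (LinearMap.mulLeft k (lin ρ α x)) := LinearMap.ext h2
    exact (LinearMap.congr_fun (commute_antideriv (k := k) hc1 hc2 m).eq p).symm

/-- For an eigenvector `x` the multiplication part vanishes, and the operators of `x_1` and `x_0`
are `-∂_{0,x}` and `∂_{1,x}`. Both have right inverses, as `isBoundary_of_rightInverse` requires. -/
theorem isBoundary_twComm_of_ne_bot (hg : signFix σ g ≠ ⊥)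
    {f : Fin 2 × Fin N → MvPolynomial (Fin 2 × Fin N) k}
    (hf : ∑ I, twComm ρ σ g I.1 (EuclideanSpace.single I.2 1) (f I) = 0) :
    IsBoundary (fun I : Fin 2 × Fin N => twComm ρ σ g I.1 (EuclideanSpace.single I.2 1)) f := by
  obtain ⟨x', hx', hx0'⟩ := Submodule.exists_mem_ne_zero_of_ne_bot hg
  obtain ⟨x, hx, hxx⟩ : ∃ x ∈ signFix σ g, ⟪x, x⟫ = 1 := by
    refine ⟨(‖x'‖⁻¹ : ℝ) • x', Submodule.smul_mem _ _ hx', ?_⟩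
    have : ‖x'‖ ≠ 0 := norm_ne_zero_iff.2 hx0'
    rw [inner_smul_left, inner_smul_right, real_inner_self_eq_norm_sq]
    simp only [RCLike.conj_to_real]
    field_simp
  obtain ⟨i₀⟩ : Nonempty (Fin N) := by
    by_contra h
    rw [not_nonempty_iff] at h
    have : x = 0 := by ext i; exact h.elim i
    simp [this] at hxx
  obtain ⟨b, hb⟩ : ∃ b : OrthonormalBasis (Fin N) ℝ (Vec N), b i₀ = x := by
    obtain ⟨b, hb⟩ := Orthonormal.exists_orthonormalBasis_extension_of_card_eq (𝕜 := ℝ)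
      (E := Vec N) (ι := Fin N) (by simp) (v := fun _ => x) (s := {i₀}) (by
        rw [orthonormal_iff_ite]
        rintro ⟨i, rfl⟩ ⟨j, rfl⟩
        simpa using hxx)
    exact ⟨b, hb i₀ rfl⟩
  have hgx : ((σ : ℤ) : ℝ) • g x = x := by rw [mem_signFix.1 hx, sign_smul_sign_smul]
  have h1x : ∀ p : MvPolynomial (Fin 2 × Fin N) k, twComm ρ σ g 1 x p = -pd ρ 0 x p := by
    intro p
    rw [twComm_apply, hgx, sub_self, twDer_one_apply, neg_smul, ← map_intCast ρ, ← pd_smul_left,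
      hgx]
    simp [lin]
  have h0x : ∀ p : MvPolynomial (Fin 2 × Fin N) k, twComm ρ σ g 0 x p = pd ρ 1 x p := by
    intro p
    rw [twComm_apply, hgx, sub_self, twDer_zero]
    simp [lin]
  refine isBoundary_twComm_of_basis ρ b.toBasis fun f' hf' => ?_
  rw [hf] at hf'
  refine isBoundary_of_rightInverse (p := ((1 : Fin 2), i₀)) (q := ((0 : Fin 2), i₀)) (by simp)
    (fun F => ?_) (fun p => ?_) hf'
  · obtain ⟨J, hJ, hJc⟩ := exists_pd_antideriv ρ 0 hxx F
    refine ⟨-J, fun I hI p => ?_, fun p hp => ?_⟩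
    · rw [LinearMap.neg_apply, LinearMap.neg_apply, map_neg, hJc]
      · intro p
        have := twComm_comm ρ σ g I.1 1 (b I.2) x p
        rw [h1x, h1x, map_neg, neg_inj] at this
        simpa using this
      · intro p
        -- Only the `1`-operators differentiate `x_0`, with result proportional to `(b i, x)`. This
        -- vanishes for `i ≠ i₀` because the basis is orthonormal and contains `x`.
        have h0 : twDer ρ σ g I.1 (b I.2) (lin (K := k) ρ 0 x) = 0 := by
          rw [twDer_lin]
          obtain ⟨α, i⟩ := I
          by_cases hα : α = 0
          · simp [hα]
          · have hα1 : α = 1 := by fin_cases α <;> simp at hα ⊢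
            subst hα1
            have hi : i ≠ i₀ := fun h => hI (by rw [h])
            have h2 : ⟪b i, x⟫ = 0 := by rw [← hb]; exact b.orthonormal.2 hi
            simp [inner_map_of_mem_signFix hx, h2]
        rw [OrthonormalBasis.coe_toBasis, twComm_apply, twComm_apply, Derivation.leibniz, h0]
        simp only [smul_eq_mul]
        ring
    · simp only [OrthonormalBasis.coe_toBasis, hb]
      rw [h1x, LinearMap.neg_apply, map_neg, neg_neg, hJ p hp]
  · obtain ⟨J, hJ, hJc⟩ := exists_pd_antideriv ρ 1 hxx {p}
    refine ⟨J, fun q => ?_, ?_⟩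
    · simp only [OrthonormalBasis.coe_toBasis, hb]
      apply hJc
      · intro q
        rw [h1x, h1x, map_neg, pd_comm]
      · intro q
        rw [h1x, h1x, pd_mul, pd_lin]
        simp
    · simp only [OrthonormalBasis.coe_toBasis, hb]
      rw [h0x, hJ p (Finset.mem_singleton_self p)]

/-- Vanishing of the first homology for vanishing coupling constants. -/
theorem isBoundary_twComm {f : Fin 2 × Fin N → MvPolynomial (Fin 2 × Fin N) k}
    (hf : ∑ I, twComm ρ σ g I.1 (EuclideanSpace.single I.2 1) (f I) = 0) :
    IsBoundary (fun I : Fin 2 × Fin N => twComm ρ σ g I.1 (EuclideanSpace.single I.2 1)) f := by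
  by_cases hg : signFix σ g = ⊥
  · exact pderiv_eq_zero_isBoundary_twComm ρ hg fun J => by rw [hf, map_zero]
  · exact isBoundary_twComm_of_ne_bot ρ hg hf

end Field

end Calogero

end

/-! ### Symbols at the deformation parameter zero. -/

noncomputable section

namespace Calogero

open MvPolynomial

section Reduction

variable {N : ℕ} {R : Finset (Vec N)}

/-- Real numbers as constant polynomials in the deformation parameter. -/
abbrev realPoly : ℝ →+* Polynomial ℂ := Polynomial.C.comp Complex.ofRealHom

/-- Specialization of the deformation parameter to zero. -/
abbrev red : MvPolynomial (Fin 2 × Fin N) (Polynomial ℂ) →+* MvPolynomial (Fin 2 × Fin N) ℂ :=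
  MvPolynomial.map Polynomial.constantCoeff

theorem red_smul (r : Polynomial ℂ) (p : MvPolynomial (Fin 2 × Fin N) (Polynomial ℂ)) :
    red (r • p) = r.coeff 0 • red p := by
  rw [smul_eq_C_mul, map_mul, map_C, smul_eq_C_mul]; rfl

theorem red_lin (α : Fin 2) (x : Vec N) :
    red (lin realPoly α x) = lin Complex.ofRealHom α x := by
  simp [lin, map_sum, red_smul, -map_X, MvPolynomial.map_X]

theorem red_pd (α : Fin 2) (x : Vec N) (p : MvPolynomial (Fin 2 × Fin N) (Polynomial ℂ)) :
    red (pd realPoly α x p) = pd Complex.ofRealHom α x (red p) := by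
  simp only [pd_apply, map_sum, red_smul, pderiv_map]
  simp

theorem subst_C {K : Type*} [CommRing K] (ρ : ℝ →+* K) (G : Fin 2 → Vec N ≃ₗᵢ[ℝ] Vec N) (a : K) :
    subst ρ G (C a) = C a := by
  rw [subst, aeval_C]; rfl

theorem red_act (g : Vec N ≃ₗᵢ[ℝ] Vec N) (p : MvPolynomial (Fin 2 × Fin N) (Polynomial ℂ)) :
    red (act realPoly g p) = act Complex.ofRealHom g (red p) := by
  have : (red.comp (act realPoly g).toRingHom : MvPolynomial (Fin 2 × Fin N) (Polynomial ℂ) →+* _) =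
    (act Complex.ofRealHom g).toRingHom.comp red := by
    apply MvPolynomial.ringHom_ext
    · intro r
      have h1 : act realPoly g (C r) = C r := subst_C _ _ _
      have h2 : red (C r : MvPolynomial (Fin 2 × Fin N) (Polynomial ℂ)) =
        C (Polynomial.constantCoeff r) := map_C _ _
      have h3 := subst_C Complex.ofRealHom (fun _ => g) (Polynomial.constantCoeff r)
      change red (act realPoly g (C r)) = act Complex.ofRealHom g (red (C r))
      rw [h1, h2]; exact h3.symm
    · rintro ⟨α, i⟩
      change red (act realPoly g (X (α, i))) = act Complex.ofRealHom g (red (X (α, i)))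
      rw [← lin_single realPoly, subst_lin, red_lin, red_lin, subst_lin]
  exact RingHom.congr_fun this p

theorem exists_smul_of_red_eq_zero {p : MvPolynomial (Fin 2 × Fin N) (Polynomial ℂ)}
    (h : red p = 0) : ∃ q, p = (Polynomial.X : Polynomial ℂ) • q := by
  have hX : ∀ r : Polynomial ℂ, Polynomial.constantCoeff r = 0 ↔ Polynomial.X ∣ r := fun r => by
    rw [Polynomial.X_dvd_iff, Polynomial.constantCoeff_apply]
  obtain ⟨q, hq⟩ := (C_dvd_iff_map_hom_eq_zero _ _ hX p).2 h
  exact ⟨q, by rw [hq, smul_eq_C_mul]⟩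

variable (R) in
/-- Specialization of the deformation parameter to zero on the Fock space. -/
def redFock : Fock R (Polynomial ℂ) →+ Fock R ℂ :=
  Finsupp.mapRange.addMonoidHom red.toAddMonoidHom

@[simp] theorem redFock_apply (f : Fock R (Polynomial ℂ)) (w : W R) :
    redFock R f w = red (f w) := rfl

@[simp] theorem redFock_single (w : W R) (p : MvPolynomial (Fin 2 × Fin N) (Polynomial ℂ)) :
    redFock R (Finsupp.single w p) = Finsupp.single w (red p) := by
  simp [redFock]

theorem redFock_smul (r : Polynomial ℂ) (f : Fock R (Polynomial ℂ)) :
    redFock R (r • f) = r.coeff 0 • redFock R f := by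
  apply Finsupp.ext
  intro w
  exact red_smul r (f w)

theorem redFock_map {T : Module.End (Polynomial ℂ) (Fock R (Polynomial ℂ))}
    {T' : Module.End ℂ (Fock R ℂ)}
    (h : ∀ w p, redFock R (T (Finsupp.single w p)) = T' (redFock R (Finsupp.single w p)))
    (f : Fock R (Polynomial ℂ)) : redFock R (T f) = T' (redFock R f) := by
  induction f using Finsupp.induction_linear with
  | zero => simp
  | add f g hf hg => simp only [map_add, hf, hg]
  | single w p => exact h w p

theorem exists_smul_of_redFock_eq_zero {f : Fock R (Polynomial ℂ)} (h : redFock R f = 0) :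
    ∃ f', f = (Polynomial.X : Polynomial ℂ) • f' := by
  have h1 : ∀ w, ∃ q, f w = (Polynomial.X : Polynomial ℂ) • q := fun w =>
    exists_smul_of_red_eq_zero (by rw [← redFock_apply, h]; rfl)
  choose q hq using h1
  refine ⟨Finsupp.onFinset f.support q fun w hw => ?_, ?_⟩
  · rw [Finsupp.mem_support_iff, hq]
    exact smul_ne_zero Polynomial.X_ne_zero hw
  · apply Finsupp.ext
    intro w
    rw [Finsupp.smul_apply, Finsupp.onFinset_apply, hq]

variable (R) in
/-- Constant families. -/
def constFock : Fock R ℂ →+ Fock R (Polynomial ℂ) :=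
  Finsupp.mapRange.addMonoidHom
    (MvPolynomial.map Polynomial.C :
      MvPolynomial (Fin 2 × Fin N) ℂ →+* MvPolynomial (Fin 2 × Fin N) (Polynomial ℂ)).toAddMonoidHom

theorem redFock_constFock (f : Fock R ℂ) : redFock R (constFock R f) = f := by
  apply Finsupp.ext
  intro w
  change red (MvPolynomial.map Polynomial.C (f w)) = f w
  rw [red, MvPolynomial.map_map]
  have : Polynomial.constantCoeff.comp Polynomial.C = RingHom.id ℂ := by
    ext
    all_goals simp
  rw [this, MvPolynomial.map_id]

theorem sectorMap_id_apply
    (T : W R → MvPolynomial (Fin 2 × Fin N) ℂ →ₗ[ℂ] MvPolynomial (Fin 2 × Fin N) ℂ)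
    (f : Fock R ℂ) (w : W R) : sectorMap id T f w = T w (f w) := by
  induction f using Finsupp.induction_linear with
  | zero => simp
  | add f g hf hg => rw [map_add, Finsupp.add_apply, hf, hg, Finsupp.add_apply, map_add]
  | single u p =>
    rw [sectorMap_single]
    by_cases h : u = w
    · subst h; simp
    · simp [h]

variable (R) in
/-- Left multiplication by `x_α` for vanishing coupling constants. -/
def opLeft (α : Fin 2) (x : Vec N) : Module.End ℂ (Fock R ℂ) :=
  ![opFree R Complex.ofRealHom x, opX R Complex.ofRealHom x] α

variable (R) in
/-- Right multiplication by `x_α` for vanishing coupling constants. -/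
def opRight (α : Fin 2) (x : Vec N) : Module.End ℂ (Fock R ℂ) :=
  sectorMap id fun w =>
    LinearMap.mulLeft ℂ (lin Complex.ofRealHom α ((w : Vec N ≃ₗᵢ[ℝ] Vec N) x)) +
      ![0, (pd Complex.ofRealHom 0 ((w : Vec N ≃ₗᵢ[ℝ] Vec N) x)).toLinearMap] α

theorem opRight_zero_single (x : Vec N) (w : W R) (p : MvPolynomial (Fin 2 × Fin N) ℂ) :
    opRight R 0 x (Finsupp.single w p) =
      Finsupp.single w (lin Complex.ofRealHom 0 ((w : Vec N ≃ₗᵢ[ℝ] Vec N) x) * p) := by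
  simp [opRight]

theorem opRight_one_single (x : Vec N) (w : W R) (p : MvPolynomial (Fin 2 × Fin N) ℂ) :
    opRight R 1 x (Finsupp.single w p) =
      Finsupp.single w (lin Complex.ofRealHom 1 ((w : Vec N ≃ₗᵢ[ℝ] Vec N) x) * p +
        pd Complex.ofRealHom 0 ((w : Vec N ≃ₗᵢ[ℝ] Vec N) x) p) := by
  simp [opRight]

/-- Associativity at vanishing coupling; in the mixed case the scalar products created by the two
derivatives cancel. -/
theorem opRight_opLeft (α β : Fin 2) (x y : Vec N) (f : Fock R ℂ) :
    opRight R α x (opLeft R β y f) = opLeft R β y (opRight R α x f) := by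
  have : opRight R α x * opLeft R β y = opLeft R β y * opRight R α x := by
    apply fock_ext
    intro w p
    simp only [Module.End.mul_apply]
    fin_cases α <;> fin_cases β
    · change opRight R 0 x (opFree R _ y _) = opFree R _ y (opRight R 0 x _)
      have h := pd_lin Complex.ofRealHom 1 0 y ((w : Vec N ≃ₗᵢ[ℝ] Vec N) x)
      rw [if_neg one_ne_zero] at h
      rw [opFree_single, opRight_zero_single, opRight_zero_single, opFree_single, pd_mul, h]
      refine congrArg (Finsupp.single w) ?_
      ring
    · change opRight R 0 x (opX R _ y _) = opX R _ y (opRight R 0 x _)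
      rw [opX_single, opRight_zero_single, opRight_zero_single, opX_single, mul_left_comm]
    · change opRight R 1 x (opFree R _ y _) = opFree R _ y (opRight R 1 x _)
      have h1 := pd_lin Complex.ofRealHom 0 0 ((w : Vec N ≃ₗᵢ[ℝ] Vec N) x) y
      have h2 := pd_lin Complex.ofRealHom 1 1 y ((w : Vec N ≃ₗᵢ[ℝ] Vec N) x)
      rw [if_pos rfl] at h1 h2
      rw [real_inner_comm] at h2
      rw [opFree_single, opRight_one_single, opRight_one_single, opFree_single, map_add, map_add,
        pd_mul, pd_mul, h1, h2, pd_comm]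
      refine congrArg (Finsupp.single w) ?_
      ring
    · change opRight R 1 x (opX R _ y _) = opX R _ y (opRight R 1 x _)
      have h := pd_lin Complex.ofRealHom 0 1 ((w : Vec N ≃ₗᵢ[ℝ] Vec N) x) y
      rw [if_neg zero_ne_one] at h
      rw [opX_single, opRight_one_single, opRight_one_single, opX_single, pd_mul, h]
      refine congrArg (Finsupp.single w) ?_
      ring
  exact LinearMap.congr_fun this f

end Reduction

/-- The coupling constants scaled by the deformation parameter. -/
abbrev scaled {N : ℕ} {R : Finset (Vec N)} (ν : R → ℂ) (v : R) : Polynomial ℂ :=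
  Polynomial.X * Polynomial.C (ν v)

namespace Model

variable {N : ℕ} {R : Finset (Vec N)} {hR : IsRootSystem R} {ν : R → ℂ}
  {B : Type*} [Ring B] [Algebra (Polynomial ℂ) B] (A : Model realPoly hR (scaled ν) B)

/-- The symbol at the parameter zero. -/
def symb : B →+ Fock R ℂ := (redFock R).comp A.ev.toAddMonoidHom

theorem symb_def (b : B) : A.symb b = redFock R (A.ev b) := rfl

theorem symb_smul (r : Polynomial ℂ) (b : B) : A.symb (r • b) = r.coeff 0 • A.symb b := by
  rw [symb_def, map_smul, redFock_smul, symb_def]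

theorem exists_smul_of_symb_eq_zero {b : B} (h : A.symb b = 0) :
    ∃ b', b = (Polynomial.X : Polynomial ℂ) • b' := by
  obtain ⟨f, hf⟩ := exists_smul_of_redFock_eq_zero h
  have hf : A.ev b = (Polynomial.X : Polynomial ℂ) • f := hf
  exact ⟨A.quant f, by rw [← A.quant_ev b, hf, map_smul]⟩

/-- A right inverse of the symbol map. -/
def lift : Fock R ℂ →+ B := A.quant.toAddMonoidHom.comp (constFock R)

theorem symb_lift (f : Fock R ℂ) : A.symb (A.lift f) = f := by
  change redFock R (A.ev (A.quant (constFock R f))) = f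
  rw [ev_quant, redFock_constFock]

theorem symb_vec_mul (α : Fin 2) (x : Vec N) (b : B) :
    A.symb (A.vec α x * b) = opLeft R α x (A.symb b) := by
  rw [symb_def, ev_vec_mul, symb_def]
  fin_cases α
  · change redFock R (opD realPoly hR (scaled ν) x _) = opFree R Complex.ofRealHom x _
    rw [opD, LinearMap.add_apply, LinearMap.sum_apply, map_add, map_sum]
    -- The reflection part of the Dunkl operator carries the factor `t` from `scaled`.
    rw [Finset.sum_eq_zero, add_zero]
    · apply redFock_map
      intro w p
      simp only [opFree_single, redFock_single, map_add, map_mul, red_lin, red_pd]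
    · intro v _
      rw [LinearMap.smul_apply, redFock_smul]
      simp [scaled, mul_assoc]
  · change redFock R (opX R realPoly x _) = opX R Complex.ofRealHom x _
    apply redFock_map
    intro w p
    simp only [opX_single, redFock_single, map_mul, red_lin]

theorem symb_grp_mul (g : W R) (b : B) :
    A.symb (A.grp g * b) = opG Complex.ofRealHom g (A.symb b) := by
  rw [symb_def, ev_grp_mul, symb_def]
  apply redFock_map
  intro w p
  simp only [opG_single, redFock_single, red_act]

theorem symb_one : A.symb 1 = Finsupp.single 1 1 := by
  rw [symb_def, ev_one, redFock_single, map_one]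

theorem symb_grp (g : W R) : A.symb (A.grp g) = Finsupp.single g 1 := by
  have := A.symb_grp_mul g 1
  rwa [mul_one, symb_one, opG_single, mul_one, map_one] at this

/-- Only left multiplications are given on the Fock space. Right multiplication is found on group
elements and carried over to words, since at `t = 0` it commutes with left multiplication by
letters. -/
theorem symb_mul_vec (b : B) (α : Fin 2) (x : Vec N) :
    A.symb (b * A.vec α x) = opRight R α x (A.symb b) := by
  let M : Submodule (Polynomial ℂ) B :=
    { carrier := {b | A.symb (b * A.vec α x) = opRight R α x (A.symb b)}
      add_mem' := fun {a b} ha hb => by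
        simp only [Set.mem_ofPred_eq] at ha hb ⊢
        rw [add_mul, map_add, map_add, map_add, ha, hb]
      zero_mem' := by simp
      smul_mem' := fun r b hb => by
        simp only [Set.mem_ofPred_eq] at hb ⊢
        rw [smul_mul_assoc, symb_smul, symb_smul, map_smul, hb] }
  have : b ∈ M := by
    refine A.generated.mem_of_word_mem ?_ b
    intro l g
    change A.symb _ = _
    induction l with
    | nil =>
      have h1 : A.symb (A.vec α x) = Finsupp.single 1 (lin Complex.ofRealHom α x) := by
        have := A.symb_vec_mul α x 1
        rw [mul_one, symb_one] at this
        rw [this]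
        fin_cases α
        · change opFree R _ x _ = _
          simp
        · change opX R _ x _ = _
          simp
      rw [Realization.word_nil, one_mul, symb_grp_mul, h1, symb_grp, opG_single, subst_lin, mul_one]
      fin_cases α
      · change _ = opRight R 0 x (Finsupp.single g 1)
        rw [opRight_zero_single, mul_one]; rfl
      · change _ = opRight R 1 x (Finsupp.single g 1)
        rw [opRight_one_single, mul_one, Derivation.map_one_eq_zero, add_zero]; rfl
    | cons p l ih =>
      have h : A.word (p :: l) * A.grp g = A.vec p.1 p.2 * (A.word l * A.grp g) := by
        rw [Realization.word_cons, mul_assoc]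
      rw [h, mul_assoc, symb_vec_mul, ih, symb_vec_mul, opRight_opLeft]
  exact this

/-- The twisted commutators act on symbols by `twComm`. -/
theorem symb_twisted_commutator (σ : ℤˣ) (α : Fin 2) (x : Vec N) (b : B) (w : W R) :
    A.symb (A.vec α x * b - ((σ : ℤ) : Polynomial ℂ) • (b * A.vec α x)) w =
      twComm Complex.ofRealHom σ (w : Vec N ≃ₗᵢ[ℝ] Vec N) α x (A.symb b w) := by
  have hσ : (((σ : ℤ) : Polynomial ℂ)).coeff 0 = ((σ : ℤ) : ℂ) := by
    rcases Int.units_eq_one_or σ with rfl | rfl <;> simp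
  have hlin : ((σ : ℤ) : ℂ) • lin Complex.ofRealHom α ((w : Vec N ≃ₗᵢ[ℝ] Vec N) x) =
      lin Complex.ofRealHom α (((σ : ℤ) : ℝ) • (w : Vec N ≃ₗᵢ[ℝ] Vec N) x) := by
    rw [lin_smul, map_intCast]
  rw [map_sub, symb_smul, symb_vec_mul, symb_mul_vec, hσ, Finsupp.sub_apply, Finsupp.smul_apply,
    twComm_apply, lin_sub, ← hlin]
  fin_cases α
  · change opFree R _ x _ w - _ • opRight R 0 x _ w = _
    rw [opFree, opRight, sectorMap_id_apply, sectorMap_id_apply]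
    simp only [Matrix.cons_val_zero, LinearMap.add_apply, LinearMap.mulLeft_apply,
      add_zero, smul_eq_C_mul, Fin.zero_eta, twDer_zero,
      Derivation.coeFn_coe]
    ring
  · change opX R _ x _ w - _ • opRight R 1 x _ w = _
    rw [opX, opRight, sectorMap_id_apply, sectorMap_id_apply]
    simp only [Matrix.cons_val_one, Matrix.cons_val_fin_one, LinearMap.add_apply,
      LinearMap.mulLeft_apply, smul_eq_C_mul, Fin.mk_one, twDer_one_apply,
      Derivation.coeFn_coe, map_neg]
    ring

end Model

end Calogero

end

noncomputable section

namespace Calogero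

/-! ### Finiteness of the reflection group. -/

section Finiteness

variable {N : ℕ} {R : Finset (Vec N)}

theorem apply_sub_mem_span (g : W R) (x : Vec N) :
    (g : Vec N ≃ₗᵢ[ℝ] Vec N) x - x ∈ Submodule.span ℝ (R : Set (Vec N)) := by
  obtain ⟨g, hg⟩ := g
  change g x - x ∈ _
  induction hg using Subgroup.closure_induction generalizing x with
  | mem g hg =>
    obtain ⟨v, hv, rfl⟩ := hg
    rw [refl_apply, sub_sub_cancel_left]
    exact Submodule.neg_mem _ (Submodule.smul_mem _ _ (Submodule.subset_span hv))
  | one => simp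
  | mul g h _ _ ihg ihh =>
    have := Submodule.add_mem _ (ihg (h x)) (ihh x)
    rwa [sub_add_sub_cancel] at this
  | inv g _ ih =>
    have h1 : g (g⁻¹ x) = x := g.apply_symm_apply x
    have := Submodule.neg_mem _ (ih (g⁻¹ x))
    rwa [h1, neg_sub] at this

/-- The reflection group of a finite root system is finite. -/
theorem IsRootSystem.finite_W (hR : IsRootSystem R) : Finite (W R) := by
  apply Finite.of_injective (rootPerm hR)
  intro g h hgh
  apply Subtype.ext
  apply LinearIsometryEquiv.ext
  intro x
  have hroot : ∀ v ∈ R, (g : Vec N ≃ₗᵢ[ℝ] Vec N) v = (h : Vec N ≃ₗᵢ[ℝ] Vec N) v := fun v hv =>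
    congrArg Subtype.val (congrArg (fun e : R ≃ R => e ⟨v, hv⟩) hgh)
  have hspan : ∀ z ∈ Submodule.span ℝ (R : Set (Vec N)),
      (g : Vec N ≃ₗᵢ[ℝ] Vec N) z = (h : Vec N ≃ₗᵢ[ℝ] Vec N) z := by
    intro z hz
    induction hz using Submodule.span_induction with
    | mem v hv => exact hroot v hv
    | zero => simp
    | add a b _ _ ha hb => rw [map_add, map_add, ha, hb]
    | smul r a _ ha => rw [map_smul, map_smul, ha]
  -- `d` and `e = h⁻¹ d` lie in the span of the roots, where `g` and `h` agree, so `g e = h e = d`.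
  -- Then `(g x, d) = (x, e) = (h x, d)` and `(d, d) = 0`.
  set d := (g : Vec N ≃ₗᵢ[ℝ] Vec N) x - (h : Vec N ≃ₗᵢ[ℝ] Vec N) x with hd
  have hdS : d ∈ Submodule.span ℝ (R : Set (Vec N)) := by
    have := Submodule.sub_mem _ (apply_sub_mem_span g x) (apply_sub_mem_span h x)
    rwa [sub_sub_sub_cancel_right] at this
  have hsub : ∀ u : W R, ∀ z ∈ Submodule.span ℝ (R : Set (Vec N)),
      (u : Vec N ≃ₗᵢ[ℝ] Vec N) z ∈ Submodule.span ℝ (R : Set (Vec N)) := fun u z hz => by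
    have := Submodule.add_mem _ (apply_sub_mem_span u z) hz
    rwa [sub_add_cancel] at this
  set e := ((h⁻¹ : W R) : Vec N ≃ₗᵢ[ℝ] Vec N) d with he
  have heS := hsub h⁻¹ d hdS
  have h1 : (h : Vec N ≃ₗᵢ[ℝ] Vec N) e = d :=
    (h : Vec N ≃ₗᵢ[ℝ] Vec N).apply_symm_apply d
  have h2 : (g : Vec N ≃ₗᵢ[ℝ] Vec N) e = d := by rw [hspan e heS, h1]
  have h3 : ⟪d, d⟫ = 0 := by
    have h4 : ⟪(g : Vec N ≃ₗᵢ[ℝ] Vec N) x, d⟫ = ⟪x, e⟫ := by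
      rw [← h2, LinearIsometryEquiv.inner_map_map]
    have h5 : ⟪(h : Vec N ≃ₗᵢ[ℝ] Vec N) x, d⟫ = ⟪x, e⟫ := by
      rw [← h1, LinearIsometryEquiv.inner_map_map]
    conv_lhs => rw [hd]
    rw [inner_sub_left, ← hd, h4, h5, sub_self]
  exact sub_eq_zero.1 (inner_self_eq_zero.1 h3)

end Finiteness

/-! ### Commutator subspaces, averaging over the group, and class sums. -/

namespace Realization

variable {N : ℕ} {R : Finset (Vec N)} {K : Type*} [CommRing K] {ρ : ℝ →+* K} {c : R → K}
  {B : Type*} [Ring B] [Algebra K B] (A : Realization R ρ c B) (σ : ℤˣ)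

/-- The twisted commutator with a generator. -/
def twist (I : Fin 2 × Fin N) : B →ₗ[K] B :=
  LinearMap.mulLeft K (A.gen I) - ((σ : ℤ) : K) • LinearMap.mulRight K (A.gen I)

theorem twist_apply (I : Fin 2 × Fin N) (b : B) :
    A.twist σ I b = A.gen I * b - ((σ : ℤ) : K) • (b * A.gen I) := rfl

/-- The span of the twisted commutators with the generators. -/
def twistRange : Submodule K B := ⨆ I, LinearMap.range (A.twist σ I)

theorem mem_twistRange {b : B} :
    b ∈ A.twistRange σ ↔ ∃ f : Fin 2 × Fin N → B, b = ∑ I, A.twist σ I (f I) := by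
  rw [twistRange, Submodule.mem_iSup_iff_exists_finsupp]
  constructor
  · rintro ⟨f, hf, rfl⟩
    choose f' hf' using hf
    refine ⟨f', ?_⟩
    rw [Finsupp.sum_fintype _ _ fun _ => rfl]
    exact Finset.sum_congr rfl fun I _ => (hf' I).symm
  · rintro ⟨f, rfl⟩
    refine ⟨Finsupp.equivFunOnFinite.symm fun I => A.twist σ I (f I), fun I => ⟨f I, rfl⟩, ?_⟩
    rw [Finsupp.sum_fintype _ _ fun _ => rfl]
    rfl

theorem twist_mem_twistRange (I : Fin 2 × Fin N) (b : B) : A.twist σ I b ∈ A.twistRange σ :=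
  Submodule.mem_iSup_of_mem I ⟨b, rfl⟩

/-- The span of the twisted commutators with the generators and of the commutators with the group.
The functionals that vanish on it are the `σ`-traces. -/
def commutators : Submodule K B :=
  A.twistRange σ ⊔ Submodule.span K (Set.range fun p : W R × B => A.grp p.1 * p.2 - p.2 * A.grp p.1)

theorem twist_mem_commutators (I : Fin 2 × Fin N) (b : B) : A.twist σ I b ∈ A.commutators σ :=
  Submodule.mem_sup_left (A.twist_mem_twistRange σ I b)

theorem grp_commutator_mem (g : W R) (b : B) :
    A.grp g * b - b * A.grp g ∈ A.commutators σ :=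
  Submodule.mem_sup_right (Submodule.subset_span ⟨(g, b), rfl⟩)

/-- Conjugation by a group element. -/
def conj (g : W R) : B →ₗ[K] B :=
  LinearMap.mulLeft K (A.grp g) ∘ₗ LinearMap.mulRight K (A.grp g⁻¹)

theorem conj_apply (g : W R) (b : B) : A.conj g b = A.grp g * (b * A.grp g⁻¹) := rfl

theorem conj_grp (g h : W R) : A.conj g (A.grp h) = A.grp (g * h * g⁻¹) := by
  rw [conj_apply, ← map_mul, ← map_mul, mul_assoc]

theorem conj_sub_mem (g : W R) (b : B) : A.conj g b - b ∈ A.commutators σ := by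
  have := A.grp_commutator_mem σ g (b * A.grp g⁻¹)
  rwa [mul_assoc b, ← map_mul, inv_mul_cancel, map_one, mul_one] at this

theorem conj_twist_mem (g : W R) (I : Fin 2 × Fin N) (b : B) :
    A.conj g (A.twist σ I b) ∈ A.twistRange σ := by
  have h := A.vec_commutator_mem (M := A.twistRange σ) (σ := σ) (A.twist_mem_twistRange σ) I.1
    ((g : Vec N ≃ₗᵢ[ℝ] Vec N) (EuclideanSpace.single I.2 1)) (A.conj g b)
  convert h using 1
  have h1 := A.grp_mul_vec g I.1 (EuclideanSpace.single I.2 1)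
  have h2 : A.vec I.1 (EuclideanSpace.single I.2 1) * A.grp g⁻¹ =
      A.grp g⁻¹ * A.vec I.1 ((g : Vec N ≃ₗᵢ[ℝ] Vec N) (EuclideanSpace.single I.2 1)) := by
    rw [A.grp_mul_vec]
    congr 2
    exact ((g : Vec N ≃ₗᵢ[ℝ] Vec N).symm_apply_apply _).symm
  rw [vec_single] at h1 h2
  simp only [twist_apply, conj_apply, sub_mul, mul_sub, smul_mul_assoc, mul_smul_comm, mul_assoc]
  rw [h2, ← mul_assoc (A.grp g), h1, mul_assoc]

section Average

variable [Fintype (W R)]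

/-- Averaging over the group. -/
def avg : B →ₗ[K] B := ρ ((Fintype.card (W R) : ℝ)⁻¹) • ∑ g : W R, A.conj g

theorem avg_apply (b : B) : A.avg b = ρ ((Fintype.card (W R) : ℝ)⁻¹) • ∑ g : W R, A.conj g b := by
  rw [avg, LinearMap.smul_apply, LinearMap.sum_apply]

theorem inv_card_smul_card (b : B) :
    ρ ((Fintype.card (W R) : ℝ)⁻¹) • ∑ _g : W R, b = b := by
  rw [Finset.sum_const, Finset.card_univ, ← Nat.cast_smul_eq_nsmul K, smul_smul,
    ← map_natCast ρ, ← map_mul, inv_mul_cancel₀, map_one, one_smul]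
  exact Nat.cast_ne_zero.2 Fintype.card_ne_zero

theorem avg_sub_mem (b : B) : A.avg b - b ∈ A.commutators σ := by
  have h : A.avg b - b = ρ ((Fintype.card (W R) : ℝ)⁻¹) • ∑ g : W R, (A.conj g b - b) := by
    rw [Finset.sum_sub_distrib, smul_sub, inv_card_smul_card, avg_apply]
  rw [h]
  exact Submodule.smul_mem _ _ (Submodule.sum_mem _ fun g _ => A.conj_sub_mem σ g b)

theorem avg_grp_mul (g : W R) (b : B) : A.avg (A.grp g * b) = A.avg (b * A.grp g) := by
  rw [avg_apply, avg_apply]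
  congr 1
  rw [← Equiv.sum_comp (Equiv.mulRight g) fun u => A.conj u (b * A.grp g)]
  refine Finset.sum_congr rfl fun u _ => ?_
  simp only [conj_apply, Equiv.coe_mulRight, mul_inv_rev, map_mul, mul_assoc]
  congr 3
  rw [← mul_assoc, ← map_mul, mul_inv_cancel, map_one, one_mul]

/-- Averaging kills commutators with the group and permutes twisted commutators, since conjugation
sends `x_α` to `(g x)_α`. For invariant elements only the twisted commutators with generators
matter. -/
theorem avg_mem_twistRange {b : B} (hb : b ∈ A.commutators σ) : A.avg b ∈ A.twistRange σ := by
  have : A.commutators σ ≤ (A.twistRange σ).comap A.avg := by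
    refine sup_le ?_ (Submodule.span_le.2 ?_)
    · refine iSup_le fun I => ?_
      rintro _ ⟨b, rfl⟩
      change A.avg (A.twist σ I b) ∈ A.twistRange σ
      rw [avg_apply]
      exact Submodule.smul_mem _ _ (Submodule.sum_mem _ fun g _ => A.conj_twist_mem σ g I b)
    · rintro _ ⟨⟨g, b⟩, rfl⟩
      change A.avg (A.grp g * b - b * A.grp g) ∈ A.twistRange σ
      rw [map_sub, avg_grp_mul, sub_self]
      exact Submodule.zero_mem _
  exact this hb

open Classical in
/-- The sum of a conjugacy class. -/
def classElt (C : ConjClasses (W R)) : B :=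
  ∑ g : W R, if ConjClasses.mk g = C then A.grp g else 0

open Classical in
theorem avg_classElt (C : ConjClasses (W R)) : A.avg (A.classElt C) = A.classElt C := by
  have h : ∀ g : W R, A.conj g (A.classElt C) = A.classElt C := by
    intro g
    rw [classElt, map_sum]
    conv_rhs => rw [← Equiv.sum_comp (MulAut.conj g).toEquiv]
    refine Finset.sum_congr rfl fun u _ => ?_
    have : ConjClasses.mk (g * u * g⁻¹) = ConjClasses.mk u :=
      ConjClasses.mk_eq_mk_iff_isConj.2 (isConj_iff.2 ⟨g, rfl⟩).symm
    change _ = if ConjClasses.mk (g * u * g⁻¹) = C then A.grp (g * u * g⁻¹) else 0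
    rw [this, apply_ite (A.conj g), conj_grp, map_zero]
  rw [avg_apply, Finset.sum_congr rfl fun g _ => h g, inv_card_smul_card]

theorem exists_classElt_sub_smul_grp_mem (g : W R) :
    ∃ n : ℕ, n ≠ 0 ∧ A.classElt (ConjClasses.mk g) - n • A.grp g ∈ A.commutators σ := by
  classical
  refine ⟨(Finset.univ.filter fun u : W R => ConjClasses.mk u = ConjClasses.mk g).card,
    Finset.card_ne_zero.2 ⟨g, by simp⟩, ?_⟩
  have : A.classElt (ConjClasses.mk g) =
      ∑ u with ConjClasses.mk u = ConjClasses.mk g, A.grp u := by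
    rw [classElt, Finset.sum_filter]
  rw [this, ← Finset.sum_const, ← Finset.sum_sub_distrib]
  refine Submodule.sum_mem _ fun u hu => ?_
  obtain ⟨h, rfl⟩ := isConj_iff.1
    (ConjClasses.mk_eq_mk_iff_isConj.1 (Finset.mem_filter.1 hu).2.symm)
  rw [← conj_grp]
  exact A.conj_sub_mem σ h _

end Average

end Realization

end Calogero

end

/-! ### Absence of torsion modulo commutators. -/

noncomputable section

namespace Calogero

namespace Model

variable {N : ℕ} {R : Finset (Vec N)} {hR : IsRootSystem R} {ν : R → ℂ}
  {B : Type*} [Ring B] [Algebra (Polynomial ℂ) B] (A : Model realPoly hR (scaled ν) B) (σ : ℤˣ)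

theorem symb_twist (I : Fin 2 × Fin N) (b : B) (w : W R) :
    A.symb (A.twist σ I b) w = twComm Complex.ofRealHom σ (w : Vec N ≃ₗᵢ[ℝ] Vec N) I.1
      (EuclideanSpace.single I.2 1) (A.symb b w) := by
  rw [← symb_twisted_commutator, Realization.vec_single, Realization.twist_apply]

/-- The commutator of `[x_α, y_β]` with any element is divisible by the deformation parameter. -/
theorem exists_commutator_bracket (α β : Fin 2) (x y : Vec N) (b : B) :
    ∃ n ∈ A.commutators σ, (A.vec α x * A.vec β y - A.vec β y * A.vec α x) * b -
      b * (A.vec α x * A.vec β y - A.vec β y * A.vec α x) = (Polynomial.X : Polynomial ℂ) • n := by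
  refine ⟨(!![0, 1; -1, 0] : Matrix (Fin 2) (Fin 2) (Polynomial ℂ)) α β • ∑ v : R,
    (Polynomial.C (ν v) * realPoly (⟪x, (v : Vec N)⟫ * ⟪y, (v : Vec N)⟫ /
      ⟪(v : Vec N), (v : Vec N)⟫)) •
        (A.grp (rootRefl R v) * b - b * A.grp (rootRefl R v)),
    Submodule.smul_mem _ _ (Submodule.sum_mem _ fun v _ => Submodule.smul_mem _ _
      (A.grp_commutator_mem σ _ _)), ?_⟩
  rw [Realization.vec_comm, smul_mul_assoc, mul_smul_comm, ← smul_sub, smul_comm Polynomial.X]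
  congr 1
  rw [Realization.bracket, add_mul, mul_add, smul_mul_assoc, mul_smul_comm, one_mul, mul_one,
    add_sub_add_left_eq_sub, Finset.sum_mul, Finset.mul_sum, ← Finset.sum_sub_distrib,
    Finset.smul_sum]
  refine Finset.sum_congr rfl fun v _ => ?_
  rw [smul_mul_assoc, mul_smul_comm, ← smul_sub, smul_smul, scaled, mul_assoc]

/-- As `σ² = 1`, the left side is the ordinary commutator of `[a_J, a_I]` with `b`. The scalar part
of the bracket drops out, and the reflections come with a factor `t`. -/
theorem exists_twist_twist_sub (I J : Fin 2 × Fin N) (b : B) :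
    ∃ n ∈ A.commutators σ, A.twist σ J (A.twist σ I b) - A.twist σ I (A.twist σ J b) =
      (Polynomial.X : Polynomial ℂ) • n := by
  obtain ⟨n, hn, h⟩ := A.exists_commutator_bracket σ J.1 I.1 (EuclideanSpace.single J.2 1)
    (EuclideanSpace.single I.2 1) b
  refine ⟨n, hn, ?_⟩
  rw [← h, Realization.vec_single, Realization.vec_single]
  have hs : ((σ : ℤ) : Polynomial ℂ) * ((σ : ℤ) : Polynomial ℂ) = 1 := by
    rw [← Int.cast_mul, ← Units.val_mul, Int.units_mul_self]; simp
  simp only [Realization.twist_apply, mul_sub, sub_mul, mul_smul_comm, smul_mul_assoc, smul_sub,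
    smul_smul, hs, one_smul, mul_assoc]
  abel

/-- In each sector the symbols of `f` form a cycle, hence a boundary. The bounding arrays are lifted
to `B`; what remains of `f` has zero symbol and is divisible by `t`. -/
theorem exists_eq_sum_twist_add {f : Fin 2 × Fin N → B}
    (hf : A.symb (∑ I, A.twist σ I (f I)) = 0) :
    ∃ (g : Fin 2 × Fin N → Fin 2 × Fin N → B) (f' : Fin 2 × Fin N → B),
      (∀ I J, g I J = -g J I) ∧
        ∀ J, f J = ∑ I, A.twist σ I (g I J) + (Polynomial.X : Polynomial ℂ) • f' J := by
  have := hR.finite_W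
  have h1 : ∀ w : W R, IsBoundary (fun I => twComm Complex.ofRealHom σ
      (w : Vec N ≃ₗᵢ[ℝ] Vec N) I.1 (EuclideanSpace.single I.2 1)) fun I => A.symb (f I) w := by
    intro w
    apply isBoundary_twComm
    have := congrArg (fun F : Fock R ℂ => F w) hf
    simp only [map_sum, Finsupp.finsetSum_apply, symb_twist, Finsupp.zero_apply] at this
    exact this
  choose g hg hfg using h1
  have hfg : ∀ (w : W R) J, A.symb (f J) w = ∑ I, twComm Complex.ofRealHom σ
      (w : Vec N ≃ₗᵢ[ℝ] Vec N) I.1 (EuclideanSpace.single I.2 1) (g w I J) := hfg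
  let G : Fin 2 × Fin N → Fin 2 × Fin N → Fock R ℂ := fun I J =>
    Finsupp.equivFunOnFinite.symm fun w => g w I J
  have hG : ∀ I J w, G I J w = g w I J := fun I J w => rfl
  have h2 : ∀ J, ∃ f', f J - ∑ I, A.twist σ I (A.lift (G I J)) =
      (Polynomial.X : Polynomial ℂ) • f' := by
    intro J
    apply A.exists_smul_of_symb_eq_zero
    apply Finsupp.ext
    intro w
    rw [map_sub, map_sum, Finsupp.sub_apply, Finsupp.finsetSum_apply, hfg w J]
    simp only [symb_twist, symb_lift, hG, sub_self, Finsupp.zero_apply]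
  choose f' hf' using h2
  have hanti : ∀ I J, G I J = -G J I := by
    intro I J
    apply Finsupp.ext
    intro w
    rw [Finsupp.neg_apply, hG, hG, hg]
  have hlift : ∀ I J, A.lift (G I J) = -A.lift (G J I) := fun I J => by
    rw [hanti I J, map_neg A.lift]
  exact ⟨fun I J => A.lift (G I J), f', hlift, fun J => (eq_add_of_sub_eq' (hf' J))⟩

theorem half_smul (b : B) :
    (Polynomial.C (2⁻¹ : ℂ)) • ((2 : Polynomial ℂ) • b) = b := by
  have : (2 : Polynomial ℂ) = Polynomial.C 2 := rfl
  rw [smul_smul, this, ← map_mul, inv_mul_cancel₀ two_ne_zero, map_one, one_smul]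

/-- Substituting `f_J = ∑ twist_I g_IJ + t f'_J` leaves a double sum of twists and `t` times twisted
commutators. If the double sum lies in `t` times the commutators, then `t` cancels. -/
theorem mem_commutators_of_smul_mem_twistRange (hB : ∀ a b : B,
    (Polynomial.X : Polynomial ℂ) • a = (Polynomial.X : Polynomial ℂ) • b → a = b) {b : B}
    (h : (Polynomial.X : Polynomial ℂ) • b ∈ A.twistRange σ) : b ∈ A.commutators σ := by
  obtain ⟨f, hf⟩ := (A.mem_twistRange σ).1 h
  obtain ⟨g, f', hg, hf'⟩ := A.exists_eq_sum_twist_add σ (f := f) (by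
    rw [← hf, symb_smul, Polynomial.coeff_X_zero, zero_smul])
  have h1 : ∀ I J, ∃ n ∈ A.commutators σ,
      A.twist σ J (A.twist σ I (g I J)) - A.twist σ I (A.twist σ J (g I J)) =
        (Polynomial.X : Polynomial ℂ) • n := fun I J => A.exists_twist_twist_sub σ I J _
  choose n hn hn' using h1
  -- Antisymmetry of `g` turns twice the double sum into a sum of commutators of two twists, each
  -- divisible by `t`.
  have h2 : (2 : Polynomial ℂ) • ∑ J, ∑ I, A.twist σ J (A.twist σ I (g I J)) =
      (Polynomial.X : Polynomial ℂ) • ∑ J, ∑ I, n I J := by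
    have h3 : ∑ J, ∑ I, A.twist σ J (A.twist σ I (g I J)) =
        -∑ J, ∑ I, A.twist σ I (A.twist σ J (g I J)) := by
      rw [Finset.sum_comm, ← Finset.sum_neg_distrib]
      refine Finset.sum_congr rfl fun J _ => ?_
      rw [← Finset.sum_neg_distrib]
      refine Finset.sum_congr rfl fun I _ => ?_
      rw [hg J I, map_neg, map_neg]
    rw [two_smul]
    conv_lhs => enter [2]; rw [h3]
    rw [← sub_eq_add_neg, ← Finset.sum_sub_distrib, Finset.smul_sum]
    refine Finset.sum_congr rfl fun J _ => ?_
    rw [← Finset.sum_sub_distrib, Finset.smul_sum]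
    exact Finset.sum_congr rfl fun I _ => hn' I J
  have h4 : (2 : Polynomial ℂ) • b = ∑ J, ∑ I, n I J +
      (2 : Polynomial ℂ) • ∑ J, A.twist σ J (f' J) := by
    apply hB
    rw [smul_add, ← h2, smul_comm Polynomial.X (2 : Polynomial ℂ),
      smul_comm Polynomial.X (2 : Polynomial ℂ), ← smul_add, hf]
    congr 1
    rw [Finset.smul_sum, ← Finset.sum_add_distrib]
    refine Finset.sum_congr rfl fun J _ => ?_
    conv_lhs => rw [hf' J]
    rw [map_add, map_sum, map_smul]
  rw [← half_smul b, h4]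
  refine Submodule.smul_mem _ _ (Submodule.add_mem _ ?_ (Submodule.smul_mem _ _ ?_))
  · exact Submodule.sum_mem _ fun J _ => Submodule.sum_mem _ fun I _ => hn I J
  · exact Submodule.sum_mem _ fun J _ => A.twist_mem_commutators σ J _

end Model

end Calogero

end

/-! ### The universal trace over `ℂ[t]`. -/

noncomputable section

namespace Calogero

theorem signFix_eq_bot_of_isConj {N : ℕ} {R : Finset (Vec N)} {σ : ℤˣ} {g h : W R}
    (hgh : IsConj g h) (hg : signFix σ (g : Vec N ≃ₗᵢ[ℝ] Vec N) = ⊥) :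
    signFix σ (h : Vec N ≃ₗᵢ[ℝ] Vec N) = ⊥ := by
  obtain ⟨u, rfl⟩ := isConj_iff.1 hgh
  rw [Submodule.eq_bot_iff] at hg ⊢
  intro x hx
  let e : Vec N ≃ₗᵢ[ℝ] Vec N := u.1
  have h1 : ((u * g * u⁻¹ : W R) : Vec N ≃ₗᵢ[ℝ] Vec N) x = e ((g : Vec N ≃ₗᵢ[ℝ] Vec N) (e.symm x)) :=
    rfl
  rw [mem_signFix, h1] at hx
  have h2 : e.symm x = 0 := by
    apply hg
    rw [mem_signFix, ← map_smul, ← hx, e.symm_apply_apply]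
  rw [← e.apply_symm_apply x, h2, map_zero]

theorem mk_mem_classesWithout {N : ℕ} {R : Finset (Vec N)} {σ : ℤˣ} {g : W R} :
    ConjClasses.mk g ∈ classesWithout R σ ↔ signFix σ (g : Vec N ≃ₗᵢ[ℝ] Vec N) = ⊥ := by
  constructor
  · intro h
    have := h g ConjClasses.mem_carrier_mk
    rw [Module.End.hasEigenvalue_iff, not_not] at this
    exact this
  · intro h u hu
    rw [Module.End.hasEigenvalue_iff, not_not]
    exact signFix_eq_bot_of_isConj
      (ConjClasses.mk_eq_mk_iff_isConj.1 (ConjClasses.mem_carrier_iff_mk_eq.1 hu)).symm h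

namespace Model

variable {N : ℕ} {R : Finset (Vec N)} {hR : IsRootSystem R} {ν : R → ℂ}
  {B : Type*} [Ring B] [Algebra (Polynomial ℂ) B] (A : Model realPoly hR (scaled ν) B) (σ : ℤˣ)
  [Fintype (W R)]

/-- Averaging reduces this to the twisted commutators with generators, and `b` differs from its
average by commutators with the group. -/
theorem mem_commutators_of_smul_mem (hB : ∀ a b : B,
    (Polynomial.X : Polynomial ℂ) • a = (Polynomial.X : Polynomial ℂ) • b → a = b) {b : B}
    (h : (Polynomial.X : Polynomial ℂ) • b ∈ A.commutators σ) : b ∈ A.commutators σ := by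
  have h1 := A.avg_mem_twistRange σ h
  rw [map_smul] at h1
  have h2 := A.mem_commutators_of_smul_mem_twistRange σ hB h1
  have h3 := Submodule.sub_mem _ h2 (A.avg_sub_mem σ b)
  rwa [sub_sub_cancel] at h3

open Classical in
theorem symb_classElt (C : ConjClasses (W R)) (w : W R) :
    A.symb (A.classElt C) w = if ConjClasses.mk w = C then 1 else 0 := by
  rw [Realization.classElt, map_sum, Finsupp.finsetSum_apply, Finset.sum_eq_single w]
  · split_ifs
    · rw [symb_grp, Finsupp.single_eq_same]
    · rw [map_zero, Finsupp.zero_apply]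
  · intro u _ hu
    split_ifs
    · rw [symb_grp, Finsupp.single_eq_of_ne hu.symm]
    · rw [map_zero, Finsupp.zero_apply]
  · simp

/-- Linear combinations of the sums of the conjugacy classes without eigenvalue `σ`. -/
def classSum [Fintype (classesWithout R σ)] :
    (classesWithout R σ → Polynomial ℂ) →ₗ[Polynomial ℂ] B :=
  Fintype.linearCombination (Polynomial ℂ) fun C : classesWithout R σ =>
    A.classElt (C : ConjClasses (W R))

variable [Fintype (classesWithout R σ)]

theorem classSum_apply (t : classesWithout R σ → Polynomial ℂ) :
    A.classSum σ t = ∑ C, t C • A.classElt (C : ConjClasses (W R)) := rfl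

theorem classSum_single (C : classesWithout R σ) [DecidableEq (classesWithout R σ)] :
    A.classSum σ (Pi.single C 1) = A.classElt (C : ConjClasses (W R)) := by
  rw [classSum, Fintype.linearCombination_apply_single, one_smul]

/-- Class sums are invariant under averaging, so the sum is in the span of the twisted commutators
with generators. Its symbol in the sector `C` is the constant in question, hence zero by
`eq_zero_of_sum_twComm_eq_C`. -/
theorem coeff_zero_of_classSum_mem {t : classesWithout R σ → Polynomial ℂ}
    (h : A.classSum σ t ∈ A.commutators σ) (C : classesWithout R σ) : (t C).coeff 0 = 0 := by
  obtain ⟨⟨C⟩, hC⟩ := C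
  change ConjClasses.mk C ∈ classesWithout R σ at hC
  set c : classesWithout R σ := ⟨ConjClasses.mk C, hC⟩ with hc
  have h1 := A.avg_mem_twistRange σ h
  have h2 : A.avg (A.classSum σ t) = A.classSum σ t := by
    rw [classSum_apply, map_sum]
    exact Finset.sum_congr rfl fun D _ => by rw [map_smul, Realization.avg_classElt]
  rw [h2] at h1
  obtain ⟨f, hf⟩ := (A.mem_twistRange σ).1 h1
  have h3 := congrArg (fun b => A.symb b C) hf
  simp only [classSum_apply, map_sum, Finsupp.finsetSum_apply, symb_twist, symb_smul,
    Finsupp.smul_apply, symb_classElt] at h3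
  rw [Finset.sum_eq_single c] at h3
  · rw [if_pos rfl, MvPolynomial.smul_eq_C_mul, mul_one] at h3
    exact eq_zero_of_sum_twComm_eq_C _ (mk_mem_classesWithout.1 hC) h3.symm
  · intro D _ hD
    rw [if_neg, smul_zero]
    intro h
    exact hD (Subtype.ext h.symm)
  · simp

/-- All coefficients of the relation are divisible by `X`, and the quotient by `X` is again a
relation since there is no torsion. Iterating, every coefficient vanishes. -/
theorem classSum_injective_mod (hB : ∀ a b : B,
    (Polynomial.X : Polynomial ℂ) • a = (Polynomial.X : Polynomial ℂ) • b → a = b)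
    {t : classesWithout R σ → Polynomial ℂ} (h : A.classSum σ t ∈ A.commutators σ) : t = 0 := by
  have key : ∀ (n : ℕ) (t : classesWithout R σ → Polynomial ℂ), A.classSum σ t ∈ A.commutators σ →
      ∀ C, (t C).coeff n = 0 := by
    intro n
    induction n with
    | zero => intro t ht C; exact A.coeff_zero_of_classSum_mem σ ht C
    | succ n ih =>
      intro t ht C
      have h1 : ∀ C, ∃ s, t C = Polynomial.X * s := fun C =>
        Polynomial.X_dvd_iff.2 (A.coeff_zero_of_classSum_mem σ ht C)
      choose s hs using h1
      have h2 : t = (Polynomial.X : Polynomial ℂ) • s := funext hs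
      rw [h2, map_smul] at ht
      rw [hs, Polynomial.coeff_X_mul]
      exact ih s (A.mem_commutators_of_smul_mem σ hB ht) C
  funext C
  exact Polynomial.ext fun n => key n t h C

theorem exists_sub_classSum_mem (b : B) :
    ∃ t, b - A.classSum σ t ∈ A.commutators σ := by
  classical
  let M : Submodule (Polynomial ℂ) B := A.commutators σ ⊔ LinearMap.range (A.classSum σ)
  have hM : ∀ b, b ∈ M := by
    apply A.generated.mem_of_word_mem
    refine A.word_mul_grp_mem (σ := σ) (fun I b => Submodule.mem_sup_left ?_) fun g hg => ?_
    · exact A.twist_mem_commutators σ I b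
    · obtain ⟨n, hn, h⟩ := A.exists_classElt_sub_smul_grp_mem σ g
      have h1 : A.classElt (ConjClasses.mk g) ∈ M := Submodule.mem_sup_right
        ⟨Pi.single ⟨ConjClasses.mk g, mk_mem_classesWithout.2 hg⟩ 1, A.classSum_single σ _⟩
      have h2 := M.sub_mem h1 (Submodule.mem_sup_left h)
      rw [sub_sub_cancel] at h2
      have h3 := M.smul_mem (Polynomial.C ((n : ℂ)⁻¹)) h2
      rwa [← Nat.cast_smul_eq_nsmul (Polynomial ℂ), smul_smul, ← map_natCast Polynomial.C, ← map_mul,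
        inv_mul_cancel₀ (Nat.cast_ne_zero.2 hn), map_one, one_smul] at h3
  obtain ⟨y, hy, _, ⟨t, rfl⟩, h⟩ := Submodule.mem_sup.1 (hM b)
  exact ⟨t, by rwa [← h, add_sub_cancel_right]⟩

/-- The universal `σ`-trace over the polynomials in the deformation parameter. -/
theorem exists_universal_trace (hB : ∀ a b : B,
    (Polynomial.X : Polynomial ℂ) • a = (Polynomial.X : Polynomial ℂ) • b → a = b) :
    ∃ φ : B →ₗ[Polynomial ℂ] (classesWithout R σ → Polynomial ℂ),
      (∀ b ∈ A.commutators σ, φ b = 0) ∧ ∀ t, φ (A.classSum σ t) = t := by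
  let q := (A.commutators σ).mkQ
  let e : (classesWithout R σ → Polynomial ℂ) ≃ₗ[Polynomial ℂ] B ⧸ A.commutators σ :=
    LinearEquiv.ofBijective (q ∘ₗ A.classSum σ) (by
      constructor
      · rw [injective_iff_map_eq_zero]
        intro t ht
        exact A.classSum_injective_mod σ hB ((Submodule.Quotient.mk_eq_zero _).1 ht)
      · intro y
        obtain ⟨b, rfl⟩ := (A.commutators σ).mkQ_surjective y
        obtain ⟨t, ht⟩ := A.exists_sub_classSum_mem σ b
        exact ⟨t, ((Submodule.Quotient.eq _).2 ht).symm⟩)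
  refine ⟨e.symm.toLinearMap ∘ₗ q, fun b hb => ?_, fun t => e.symm_apply_apply t⟩
  have : q b = 0 := (Submodule.Quotient.mk_eq_zero _).2 hb
  rw [LinearMap.comp_apply, this, map_zero]

end Model

end Calogero

end

noncomputable section

namespace Calogero

variable {N : ℕ} {R : Finset (Vec N)} {ν : R → ℂ}

/-! ### The presented algebra and its universal property. -/

section Presentation

/-- The presented algebra realizes the relations. -/
def presented (R : Finset (Vec N)) (ν : R → ℂ) : Realization R Complex.ofRealHom ν (H R ν) where
  gen := a R ν
  grp :=
    { toFun := grp R ν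
      map_one' := (RingQuot.mkAlgHom_rel ℂ (Rel.grp_one (ν := ν))).trans (map_one _)
      map_mul' := fun g h => (RingQuot.mkAlgHom_rel ℂ (Rel.grp_mul (ν := ν) g h)).trans
        (map_mul _ _ _) }
  grp_vec g α x := by
    have h : ∀ x : Vec N, RingQuot.mkAlgHom ℂ (Rel R ν) (freeVec R α x) =
        ∑ i, Complex.ofRealHom (x i) • a R ν (α, i) := fun x => by
      rw [freeVec, map_sum]
      exact Finset.sum_congr rfl fun i _ => map_smul _ _ _
    have := RingQuot.mkAlgHom_rel ℂ (Rel.grp_vec (ν := ν) g α x)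
    rw [map_mul, map_mul, h, h] at this
    exact this
  comm α β x y := by
    have h : ∀ (α : Fin 2) (x : Vec N), RingQuot.mkAlgHom ℂ (Rel R ν) (freeVec R α x) =
        ∑ i, Complex.ofRealHom (x i) • a R ν (α, i) := fun α x => by
      rw [freeVec, map_sum]
      exact Finset.sum_congr rfl fun i _ => map_smul _ _ _
    have := RingQuot.mkAlgHom_rel ℂ (Rel.comm (ν := ν) α β x y)
    rw [map_sub, map_mul, map_mul, h, h, map_smul, map_add, map_smul, map_one, map_sum] at this
    simp only [map_smul] at this
    exact this

@[simp] theorem presented_grp (g : W R) : (presented R ν).grp g = grp R ν g := rfl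

theorem presented_isGenerated : (presented R ν).IsGenerated := by
  rw [Realization.IsGenerated, eq_top_iff]
  intro b _
  obtain ⟨f, rfl⟩ := RingQuot.mkAlgHom_surjective ℂ (Rel R ν) b
  induction f using FreeAlgebra.induction with
  | grade0 r => rw [AlgHom.commutes]; exact Subalgebra.algebraMap_mem _ r
  | grade1 x =>
    rcases x with I | g
    · exact Algebra.subset_adjoin (Or.inl ⟨I, rfl⟩)
    · exact Algebra.subset_adjoin (Or.inr ⟨g, rfl⟩)
  | mul f g hf hg => rw [map_mul]; exact Subalgebra.mul_mem _ (hf trivial) (hg trivial)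
  | add f g hf hg => rw [map_add]; exact Subalgebra.add_mem _ (hf trivial) (hg trivial)

variable {Q : Type*} [Ring Q] [Algebra ℂ Q] (A : Realization R Complex.ofRealHom ν Q)

/-- The universal property of the presented algebra, on the free algebra. -/
def freeHom : FreeAlgebra ℂ (Gen R) →ₐ[ℂ] Q := FreeAlgebra.lift ℂ (Sum.elim A.gen A.grp)

theorem freeHom_grp (g : W R) : freeHom A (freeGrp R g) = A.grp g := by
  rw [freeHom, freeGrp, FreeAlgebra.lift_ι_apply, Sum.elim_inr]

theorem freeHom_vec (α : Fin 2) (x : Vec N) : freeHom A (freeVec R α x) = A.vec α x := by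
  rw [freeVec, map_sum, Realization.vec]
  refine Finset.sum_congr rfl fun i _ => ?_
  rw [map_smul, freeHom, FreeAlgebra.lift_ι_apply, Sum.elim_inl]
  rfl

/-- The universal property of the presented algebra. -/
def presentedHom : H R ν →ₐ[ℂ] Q :=
  RingQuot.liftAlgHom ℂ ⟨freeHom A, by
    intro x y h
    induction h with
    | grp_one => rw [freeHom_grp, map_one, map_one]
    | grp_mul g h => rw [map_mul, freeHom_grp, freeHom_grp, freeHom_grp, map_mul]
    | grp_vec g α x =>
      rw [map_mul, map_mul, freeHom_grp, freeHom_vec, freeHom_vec, A.grp_mul_vec]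
    | comm α β x y =>
      rw [map_sub, map_mul, map_mul, freeHom_vec, freeHom_vec, A.vec_comm, map_smul, map_add,
        map_smul, map_one, map_sum]
      simp only [map_smul, freeHom_grp]
      rfl⟩

theorem presentedHom_a (I : Fin 2 × Fin N) : presentedHom A (a R ν I) = A.gen I := by
  rw [presentedHom, a, RingQuot.liftAlgHom_mkAlgHom_apply, freeHom, FreeAlgebra.lift_ι_apply,
    Sum.elim_inl]

theorem presentedHom_grp (g : W R) : presentedHom A (grp R ν g) = A.grp g := by
  rw [presentedHom, grp, RingQuot.liftAlgHom_mkAlgHom_apply, freeHom_grp]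

end Presentation

/-! ### Specialization of the deformation parameter to one. -/

section Specialization

variable {B : Type*} [Ring B] [Algebra (Polynomial ℂ) B]

variable (B) in
/-- The ideal of the specialization of the deformation parameter to one. -/
def specIdeal : Ideal B where
  carrier := {b | ∃ t : B, b = (Polynomial.X - 1 : Polynomial ℂ) • t}
  add_mem' := by
    rintro _ _ ⟨s, rfl⟩ ⟨t, rfl⟩
    exact ⟨s + t, (smul_add _ _ _).symm⟩
  zero_mem' := ⟨0, (smul_zero _).symm⟩
  smul_mem' := by
    rintro r _ ⟨t, rfl⟩
    exact ⟨r * t, by rw [smul_eq_mul, mul_smul_comm]⟩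

instance : (specIdeal B).IsTwoSided where
  mul_mem_of_left r := by
    rintro ⟨t, rfl⟩
    exact ⟨t * r, by rw [smul_mul_assoc]⟩

variable (B) in
/-- The specialization of the deformation parameter to one. -/
abbrev Spec1 : Type _ := B ⧸ specIdeal B

variable (B) in
/-- The projection to the specialization. -/
abbrev spec1 : B →+* Spec1 B := Ideal.Quotient.mk (specIdeal B)

instance : Algebra ℂ (Spec1 B) := Algebra.compHom (Spec1 B) Polynomial.C

theorem spec1_C_smul (r : ℂ) (b : B) : spec1 B (Polynomial.C r • b) = r • spec1 B b := rfl

theorem spec1_X_smul (b : B) : spec1 B ((Polynomial.X : Polynomial ℂ) • b) = spec1 B b := by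
  rw [← sub_eq_zero, ← map_sub, Ideal.Quotient.eq_zero_iff_mem]
  exact ⟨b, by rw [sub_smul, one_smul]⟩

/-- The specialization of a realization. -/
def Realization.spec (A : Realization R realPoly (scaled ν) B) :
    Realization R Complex.ofRealHom ν (Spec1 B) where
  gen I := spec1 B (A.gen I)
  grp := (spec1 B : B →* Spec1 B).comp A.grp
  grp_vec g α x := by
    have := congrArg (spec1 B) (A.grp_vec g α x)
    rw [map_mul, map_mul, map_sum, map_sum] at this
    exact this
  comm α β x y := by
    have := congrArg (spec1 B) (A.comm α β x y)
    rw [map_sub, map_mul, map_mul, map_sum, map_sum] at this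
    refine Eq.trans this ?_
    have h1 : ∀ b : B, spec1 B ((!![0, 1; -1, 0] : Matrix (Fin 2) (Fin 2) (Polynomial ℂ)) α β • b) =
        (!![0, 1; -1, 0] : Matrix (Fin 2) (Fin 2) ℂ) α β • spec1 B b := by
      intro b
      fin_cases α <;> fin_cases β <;> simp
    rw [h1, map_add, map_sum]
    congr 2
    refine Finset.sum_congr rfl fun v _ => ?_
    rw [scaled, mul_assoc, mul_smul, spec1_X_smul, RingHom.comp_apply, ← map_mul, spec1_C_smul]
    rfl

end Specialization

end Calogero

end

noncomputable section

namespace Calogero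

variable {N : ℕ} {R : Finset (Vec N)} {ν : R → ℂ}

/-! ### Construction of traces with prescribed class values. -/

section Existence

/-- The functionals on the presented algebra that are induced from functionals on a deformation. -/
theorem exists_functional {B : Type*} [Ring B] [Algebra (Polynomial ℂ) B]
    (A : Realization R realPoly (scaled ν) B) (f : B →+ ℂ)
    (hC : ∀ (r : ℂ) b, f (Polynomial.C r • b) = r * f b)
    (hX : ∀ b, f ((Polynomial.X : Polynomial ℂ) • b) = f b) :
    ∃ sp : H R ν →ₗ[ℂ] ℂ, ∀ h b, spec1 B b = presentedHom A.spec h → sp h = f b := by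
  have hker : ∀ b b', spec1 B b = spec1 B b' → f b = f b' := by
    intro b b' h
    rw [← sub_eq_zero, ← map_sub, Ideal.Quotient.eq_zero_iff_mem] at h
    obtain ⟨t, ht⟩ := h
    rw [← sub_eq_zero, ← map_sub, ht, sub_smul, one_smul, map_sub, hX, sub_self]
  have hsurj : ∀ h : H R ν, ∃ b, spec1 B b = presentedHom A.spec h := fun h =>
    Ideal.Quotient.mk_surjective _
  choose r hr using hsurj
  refine ⟨{ toFun := fun h => f (r h), map_add' := fun h h' => ?_, map_smul' := fun s h => ?_ },
    fun h b hb => hker _ _ (by rw [hr, hb])⟩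
  · rw [← map_add]
    exact hker _ _ (by rw [map_add, hr, hr, hr, map_add])
  · rw [RingHom.id_apply, smul_eq_mul, ← hC]
    exact hker _ _ (by rw [spec1_C_smul, hr, hr, map_smul])

theorem presentedHom_spec_classElt {B : Type*} [Ring B] [Algebra (Polynomial ℂ) B]
    [Fintype (W R)] (A : Realization R realPoly (scaled ν) B) (C : ConjClasses (W R)) :
    spec1 B (A.classElt C) = presentedHom A.spec ((presented R ν).classElt C) := by
  rw [Realization.classElt, Realization.classElt, map_sum, map_sum]
  refine Finset.sum_congr rfl fun g _ => ?_
  split_ifs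
  · rw [presented_grp, presentedHom_grp]; rfl
  · rw [map_zero, map_zero]

theorem IsInvariantCoupling.scaled (hν : IsInvariantCoupling R ν) (v w : R)
    (h : IsConj (rootRefl R v) (rootRefl R w)) :
    Calogero.scaled ν v = Calogero.scaled ν w := by
  rw [Calogero.scaled, Calogero.scaled, hν v w h]

/-- The universal trace on the Dunkl algebra, weighted by `s` and evaluated at `t = 1`, ignores
multiples of `t - 1` and descends to a functional on the presented algebra. -/
theorem exists_trace_classElt (hR : IsRootSystem R) (hν : IsInvariantCoupling R ν) (κ : ℤˣ)
    [Fintype (W R)] (s : classesWithout R κ → ℂ) :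
    ∃ sp : H R ν →ₗ[ℂ] ℂ, (∀ I f, sp (a R ν I * f) = ((κ : ℤ) : ℂ) * sp (f * a R ν I)) ∧
      (∀ g f, sp (grp R ν g * f) = sp (f * grp R ν g)) ∧
        ∀ C : classesWithout R κ, sp ((presented R ν).classElt (C : ConjClasses (W R))) = s C := by
  classical
  have := Fintype.ofFinite (classesWithout R κ)
  let A := dunklModel realPoly hR hν.scaled
  obtain ⟨φ, hφ, hφ'⟩ := A.exists_universal_trace κ fun a b h =>
    smul_dunklAlgebra_cancel realPoly hR hν.scaled Polynomial.X_ne_zero h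
  let f : dunklAlgebra realPoly hR hν.scaled →+ ℂ :=
    ∑ C, (AddMonoidHom.mulLeft (s C)).comp ((Polynomial.evalRingHom 1).toAddMonoidHom.comp
      ((Pi.evalAddMonoidHom _ C).comp φ.toAddMonoidHom))
  have hf : ∀ b, f b = ∑ C, s C * (φ b C).eval 1 := fun b => by
    simp [f]
  obtain ⟨sp, hsp⟩ := exists_functional A.toRealization f
    (fun r b => by
      rw [hf, hf, Finset.mul_sum]
      refine Finset.sum_congr rfl fun C _ => ?_
      rw [map_smul, Pi.smul_apply, smul_eq_mul, Polynomial.eval_mul, Polynomial.eval_C,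
        mul_left_comm])
    (fun b => by
      rw [hf, hf]
      refine Finset.sum_congr rfl fun C _ => ?_
      rw [map_smul, Pi.smul_apply, smul_eq_mul, Polynomial.eval_mul, Polynomial.eval_X, one_mul])
  have hσ : ∀ b, f (((κ : ℤ) : Polynomial ℂ) • b) = ((κ : ℤ) : ℂ) * f b := fun b => by
    rcases Int.units_eq_one_or κ with rfl | rfl <;> simp
  have hker : ∀ b ∈ A.commutators κ, f b = 0 := fun b hb => by simp [hf, hφ b hb]
  have hsurj : ∀ h : H R ν, ∃ b, spec1 _ b = presentedHom A.spec h := fun h =>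
    Ideal.Quotient.mk_surjective _
  refine ⟨sp, fun I h => ?_, fun g h => ?_, fun C => ?_⟩
  · obtain ⟨b, hb⟩ := hsurj h
    rw [hsp (a R ν I * h) (A.gen I * b) (by rw [map_mul, map_mul, hb, presentedHom_a]; rfl),
      hsp (h * a R ν I) (b * A.gen I) (by rw [map_mul, map_mul, hb, presentedHom_a]; rfl), ← hσ,
      ← sub_eq_zero, ← map_sub]
    exact hker _ (A.twist_mem_commutators κ I b)
  · obtain ⟨b, hb⟩ := hsurj h
    rw [hsp (grp R ν g * h) (A.grp g * b) (by rw [map_mul, map_mul, hb, presentedHom_grp]; rfl),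
      hsp (h * grp R ν g) (b * A.grp g) (by rw [map_mul, map_mul, hb, presentedHom_grp]; rfl),
      ← sub_eq_zero, ← map_sub]
    exact hker _ (A.grp_commutator_mem κ g b)
  · rw [hsp _ _ (presentedHom_spec_classElt A.toRealization _), ← A.classSum_single κ C, hf, hφ',
      Finset.sum_eq_single C]
    · simp
    · intro D _ hD; simp [hD]
    · simp

end Existence

/-! ### Parity and the passage between `κ`-traces and twisted commutators. -/

section Parity

theorem sign_pow_eq (κ : ℤˣ) {n : ℕ} {p : ZMod 2} (h : (n : ZMod 2) = p) :
    ((κ : ℤ) : ℂ) ^ n = ((κ : ℤ) : ℂ) ^ p.val := by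
  subst h
  rw [ZMod.val_natCast]
  rcases Int.units_eq_one_or κ with rfl | rfl
  · simp
  · simpa using neg_one_pow_eq_pow_mod_two n

theorem mem_kappaTraces {κ : ℤˣ} {sp : H R ν →ₗ[ℂ] ℂ}
    (hgen : ∀ I f, sp (a R ν I * f) = ((κ : ℤ) : ℂ) * sp (f * a R ν I))
    (hgrp : ∀ g f, sp (grp R ν g * f) = sp (f * grp R ν g)) : sp ∈ kappaTraces R ν κ := by
  have hword : ∀ (l : List (Fin 2 × Fin N)) (b : H R ν), sp ((l.map (a R ν)).prod * b) =
      ((κ : ℤ) : ℂ) ^ l.length * sp (b * (l.map (a R ν)).prod) := by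
    intro l
    induction l with
    | nil => simp
    | cons I l ih =>
      intro b
      rw [List.map_cons, List.prod_cons, mul_assoc, hgen, mul_assoc, ih, List.length_cons, pow_succ',
        mul_assoc (_ : ℂ), mul_assoc b]
  have hpart : ∀ p, ∀ f ∈ parityPart R ν p, ∀ b,
      sp (f * b) = ((κ : ℤ) : ℂ) ^ p.val * sp (b * f) := by
    intro p f hf b
    induction hf using Submodule.span_induction with
    | mem f hf =>
      obtain ⟨l, g, hl, rfl⟩ := hf
      rw [mul_assoc, hword, mul_assoc, hgrp, sign_pow_eq κ hl, mul_assoc]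
    | zero => simp
    | add f f' _ _ hf hf' => rw [add_mul, mul_add, map_add, map_add, hf, hf', mul_add]
    | smul r f _ hf =>
      rw [smul_mul_assoc, mul_smul_comm, map_smul, map_smul, hf, smul_eq_mul, smul_eq_mul,
        mul_left_comm]
  intro p q f hf g hg
  have h2 : ∀ p : ZMod 2, p = 0 ∨ p = 1 := by decide
  -- `hpart` allows an arbitrary second factor, so it is applied to `g` if `g` is even and to `f`
  -- otherwise.
  rcases h2 q with rfl | rfl
  · rw [hpart 0 g hg f]; simp
  · rw [hpart p f hf g]
    congr 2
    rw [show (1 : ZMod 2).val = 1 from rfl, mul_one]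

namespace Realization

variable {Q : Type*} [Ring Q] [Algebra ℂ Q] (A : Realization R Complex.ofRealHom ν Q)

/-- The realization with the opposite generators. -/
def neg : Realization R Complex.ofRealHom ν Q where
  gen I := -A.gen I
  grp := A.grp
  grp_vec g α x := by
    simp only [smul_neg, Finset.sum_neg_distrib, mul_neg, neg_mul]
    exact congrArg Neg.neg (A.grp_vec g α x)
  comm α β x y := by
    simp only [smul_neg, Finset.sum_neg_distrib, mul_neg, neg_mul, neg_neg]
    exact A.comm α β x y

/-- The span of the monomials of parity `p`. -/
def parity (p : ZMod 2) : Submodule ℂ Q :=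
  Submodule.span ℂ {f | ∃ (l : List (Fin 2 × Fin N)) (g : W R),
    (l.length : ZMod 2) = p ∧ f = (l.map A.gen).prod * A.grp g}

variable {A}

theorem IsGenerated.mem_of_monomial_mem (hA : A.IsGenerated) {M : Submodule ℂ Q}
    (h : ∀ (l : List (Fin 2 × Fin N)) (g : W R), (l.map A.gen).prod * A.grp g ∈ M)
    (b : Q) : b ∈ M := by
  refine hA.mem_of_word_mem (fun l g => ?_) b
  refine A.word_mem_of_basisWord_mem (n := l.length) (fun l _ => ?_) l rfl
  rw [word_basisWord]
  exact h l g

theorem IsGenerated.eq_zero_of_vanish_grp (hA : A.IsGenerated) {σ : ℤˣ} {sp : Q →ₗ[ℂ] ℂ}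
    (hgen : ∀ I f, sp (A.gen I * f) = ((σ : ℤ) : ℂ) * sp (f * A.gen I))
    (hgrp : ∀ g : W R, signFix σ (g : Vec N ≃ₗᵢ[ℝ] Vec N) = ⊥ → sp (A.grp g) = 0) : sp = 0 := by
  apply LinearMap.ext
  intro b
  refine hA.mem_of_word_mem (M := LinearMap.ker sp) (fun l g => ?_) b
  refine A.word_mul_grp_mem (σ := σ) (fun I f => ?_) hgrp l g
  rw [LinearMap.mem_ker, map_sub, map_smul, hgen, smul_eq_mul, sub_self]

variable {θ : Q →ₐ[ℂ] Q}

theorem map_monomial_of_map_gen (hgen : ∀ I, θ (A.gen I) = -A.gen I)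
    (hgrp : ∀ g, θ (A.grp g) = A.grp g) (l : List (Fin 2 × Fin N)) (g : W R) :
    θ ((l.map A.gen).prod * A.grp g) = (-1 : ℂ) ^ l.length • ((l.map A.gen).prod * A.grp g) := by
  induction l with
  | nil => simp [hgrp]
  | cons I l ih =>
    rw [List.map_cons, List.prod_cons, mul_assoc, map_mul, ih, hgen, List.length_cons,
      pow_succ', mul_smul, mul_smul_comm, neg_mul, neg_one_smul, smul_neg]

theorem IsGenerated.add_map_mem_parity (hA : A.IsGenerated) (hgen : ∀ I, θ (A.gen I) = -A.gen I)
    (hgrp : ∀ g, θ (A.grp g) = A.grp g) (b : Q) : b + θ b ∈ A.parity 0 := by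
  refine hA.mem_of_monomial_mem (M := (A.parity 0).comap
    (LinearMap.id + θ.toLinearMap)) (fun l g => ?_) b
  change _ + θ _ ∈ A.parity 0
  rw [map_monomial_of_map_gen hgen hgrp]
  rcases Nat.even_or_odd l.length with h | h
  · have hm : (l.map A.gen).prod * A.grp g ∈ A.parity 0 :=
      Submodule.subset_span ⟨l, g, (ZMod.natCast_eq_zero_iff_even).2 h, rfl⟩
    rw [h.neg_one_pow, one_smul]
    exact Submodule.add_mem _ hm hm
  · rw [h.neg_one_pow, neg_one_smul]
    simp

theorem IsGenerated.sub_map_mem_parity (hA : A.IsGenerated) (hgen : ∀ I, θ (A.gen I) = -A.gen I)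
    (hgrp : ∀ g, θ (A.grp g) = A.grp g) (b : Q) : b - θ b ∈ A.parity 1 := by
  refine hA.mem_of_monomial_mem (M := (A.parity 1).comap
    (LinearMap.id - θ.toLinearMap)) (fun l g => ?_) b
  change _ - θ _ ∈ A.parity 1
  rw [map_monomial_of_map_gen hgen hgrp]
  rcases Nat.even_or_odd l.length with h | h
  · rw [h.neg_one_pow, one_smul]
    simp
  · have hm : (l.map A.gen).prod * A.grp g ∈ A.parity 1 :=
      Submodule.subset_span ⟨l, g, (ZMod.natCast_eq_one_iff_odd).2 h, rfl⟩
    rw [h.neg_one_pow, neg_one_smul]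
    simpa using Submodule.add_mem _ hm hm

/-- The functional splits under the parity automorphism `θ`. Its even part satisfies the `κ`-twisted
condition for all `f`. Its odd part satisfies the untwisted one and vanishes on the whole group.
Both are zero by the reduction of words, with `σ = κ` and `σ = 1`. -/
theorem IsGenerated.eq_zero_of_parity (hA : A.IsGenerated) (hθ : ∀ I, θ (A.gen I) = -A.gen I)
    (hθ' : ∀ g, θ (A.grp g) = A.grp g) {κ : ℤˣ} {sp : Q →ₗ[ℂ] ℂ}
    (hodd : ∀ I, ∀ f ∈ A.parity 1, sp (A.gen I * f) = ((κ : ℤ) : ℂ) * sp (f * A.gen I))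
    (heven : ∀ I, ∀ f ∈ A.parity 0, sp (A.gen I * f) = sp (f * A.gen I))
    (hgrp : ∀ g : W R, signFix κ (g : Vec N ≃ₗᵢ[ℝ] Vec N) = ⊥ → sp (A.grp g) = 0) : sp = 0 := by
  have h1 : sp ∘ₗ (LinearMap.id + θ.toLinearMap) = 0 := by
    apply hA.eq_zero_of_vanish_grp (σ := κ)
    · intro I f
      have h := hodd I _ (hA.sub_map_mem_parity hθ hθ' f)
      change sp (_ * _ + θ _) = _ * sp (_ * _ + θ _)
      rw [map_mul, map_mul, hθ, neg_mul, mul_neg, ← sub_eq_add_neg, ← sub_eq_add_neg,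
        ← mul_sub, ← sub_mul, h]
    · intro g hg
      change sp (A.grp g + θ _) = 0
      rw [hθ', map_add, hgrp g hg, add_zero]
  have h2 : sp ∘ₗ (LinearMap.id - θ.toLinearMap) = 0 := by
    apply hA.eq_zero_of_vanish_grp (σ := 1)
    · intro I f
      have h := heven I _ (hA.add_map_mem_parity hθ hθ' f)
      change sp (_ * _ - θ _) = _ * sp (_ * _ - θ _)
      rw [map_mul, map_mul, hθ, neg_mul, mul_neg, sub_neg_eq_add, sub_neg_eq_add,
        ← mul_add, ← add_mul, h]
      simp
    · intro g _
      change sp (A.grp g - θ _) = 0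
      rw [hθ', sub_self, map_zero]
  apply LinearMap.ext
  intro b
  have e1 : sp (b + θ b) = 0 := LinearMap.congr_fun h1 b
  have e2 : sp (b - θ b) = 0 := LinearMap.congr_fun h2 b
  have e3 : (2 : ℂ) * sp b = 0 := by
    rw [map_add] at e1
    rw [map_sub] at e2
    linear_combination e1 + e2
  rw [LinearMap.zero_apply]
  exact (mul_eq_zero.1 e3).resolve_left two_ne_zero

end Realization

theorem a_mem_parityPart (I : Fin 2 × Fin N) : a R ν I ∈ parityPart R ν 1 :=
  Submodule.subset_span ⟨[I], 1, by simp, by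
    rw [show grp R ν 1 = 1 from map_one (presented R ν).grp]; simp⟩

theorem grp_mem_parityPart (g : W R) : grp R ν g ∈ parityPart R ν 0 :=
  Submodule.subset_span ⟨[], g, by simp, by simp⟩

theorem eq_zero_of_mem_kappaTraces {κ : ℤˣ} {sp : H R ν →ₗ[ℂ] ℂ} (hsp : sp ∈ kappaTraces R ν κ)
    (hgrp : ∀ g : W R, signFix κ (g : Vec N ≃ₗᵢ[ℝ] Vec N) = ⊥ → sp (grp R ν g) = 0) : sp = 0 := by
  have hodd : ∀ I, ∀ f ∈ parityPart R ν 1,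
      sp (a R ν I * f) = ((κ : ℤ) : ℂ) * sp (f * a R ν I) := fun I f hf => by
    rw [hsp 1 1 _ (a_mem_parityPart I) f hf, show (1 : ZMod 2).val = 1 from rfl, mul_one, pow_one]
  have heven : ∀ I, ∀ f ∈ parityPart R ν 0, sp (a R ν I * f) = sp (f * a R ν I) := fun I f hf => by
    rw [hsp 1 0 _ (a_mem_parityPart I) f hf]; simp
  -- The relations are even in the generators, so changing their sign defines the parity
  -- automorphism.
  exact presented_isGenerated.eq_zero_of_parity (θ := presentedHom (presented R ν).neg)
    (presentedHom_a _) (presentedHom_grp _) hodd heven hgrp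

end Parity

/-! ### Traces correspond to functions on the classes. -/

section Classification

/-- The values of the `κ`-traces on the sums of the conjugacy classes without eigenvalue `κ`. -/
def traceValues (R : Finset (Vec N)) (ν : R → ℂ) [Fintype (W R)] (κ : ℤˣ) :
    kappaTraces R ν κ →ₗ[ℂ] classesWithout R κ → ℂ where
  toFun sp C := (sp : H R ν →ₗ[ℂ] ℂ) ((presented R ν).classElt (C : ConjClasses (W R)))
  map_add' _ _ := rfl
  map_smul' _ _ := rfl

theorem grp_eq_of_isConj {κ : ℤˣ} {sp : H R ν →ₗ[ℂ] ℂ} (hsp : sp ∈ kappaTraces R ν κ) {g h : W R}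
    (hgh : IsConj g h) : sp (grp R ν g) = sp (grp R ν h) := by
  obtain ⟨u, rfl⟩ := isConj_iff.1 hgh
  have := hsp 0 0 _ (grp_mem_parityPart (u * g)) _ (grp_mem_parityPart u⁻¹)
  have hmul : ∀ g h : W R, grp R ν g * grp R ν h = grp R ν (g * h) := fun g h =>
    (map_mul (presented R ν).grp g h).symm
  rw [hmul, hmul, inv_mul_cancel_left] at this
  simpa using this.symm

/-- A trace is constant on conjugacy classes, so its value on a class sum is the class size times
its value on an element. Zero values therefore force it to vanish on all group elements without
eigenvalue `κ`. -/
theorem traceValues_injective [Fintype (W R)] (κ : ℤˣ) : Function.Injective (traceValues R ν κ) := by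
  classical
  rw [injective_iff_map_eq_zero]
  rintro ⟨sp, hsp⟩ h
  apply Subtype.ext
  apply eq_zero_of_mem_kappaTraces hsp
  intro g hg
  have h1 : sp ((presented R ν).classElt (ConjClasses.mk g)) = 0 :=
    congrFun h ⟨ConjClasses.mk g, mk_mem_classesWithout.2 hg⟩
  rw [Realization.classElt, ← Finset.sum_filter, map_sum] at h1
  have h2 : ∀ u ∈ Finset.univ.filter fun u : W R => ConjClasses.mk u = ConjClasses.mk g,
      sp ((presented R ν).grp u) = sp (grp R ν g) := fun u hu => grp_eq_of_isConj hsp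
    (ConjClasses.mk_eq_mk_iff_isConj.1 (Finset.mem_filter.1 hu).2)
  rw [Finset.sum_congr rfl h2, Finset.sum_const, smul_eq_zero] at h1
  refine h1.resolve_left (Finset.card_ne_zero.2 ⟨g, by simp⟩)

theorem traceValues_surjective [Fintype (W R)] (hR : IsRootSystem R)
    (hν : IsInvariantCoupling R ν) (κ : ℤˣ) :
    Function.Surjective (traceValues R ν κ) := by
  intro s
  obtain ⟨sp, h1, h2, h3⟩ := exists_trace_classElt hR hν κ s
  exact ⟨⟨sp, mem_kappaTraces h1 h2⟩, funext h3⟩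

end Classification

end Calogero

end

theorem theorem2 (N : ℕ) (R : Finset (Calogero.Vec N)) (hR : Calogero.IsRootSystem R)
    (ν : R → ℂ) (hν : Calogero.IsInvariantCoupling R ν) (κ : ℤˣ) :
    Module.rank ℂ (Calogero.kappaTraces R ν κ) =
      Cardinal.mk (Calogero.classesWithout R κ) := by
  have := hR.finite_W
  have := Fintype.ofFinite (Calogero.W R)
  have := Fintype.ofFinite (Calogero.classesWithout R κ)
  rw [(LinearEquiv.ofBijective (Calogero.traceValues R ν κ)
    ⟨Calogero.traceValues_injective κ, Calogero.traceValues_surjective hR hν κ⟩).rank_eq,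
    rank_fun', Cardinal.mk_fintype]
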